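/- Let $\mathbb N=\{0,1,2,\dots\}$ and $l\ge 1$. Let $\gamma$ be holomorphic on an open neighbourhood $W$ of $0$ in $\mathbb C$, with $\gamma(0)=0$, $\gamma'(0)=1$. Let $b_1,\dots,b_l\in\mathbb C$ and $c_1,\dots,c_l\in\mathbb C$ with $\operatorname{Re}c_j>0$, and put $\beta_j(z)=b_j-c_j\gamma(z)$. For $v_1,\dots,v_l\ge0$ and $s\in\mathbb C^l$, the cut-off nested sum $$\mathop{\mathrm{fp}\!\sum}_{1\le n_l<\cdots<n_1}(n_1+v_1)^{s_1}\cdots(n_l+v_l)^{s_l}$$ denotes the finite part as $N\to\infty$ of $\sum_{1\le n_l<\cdots<n_1\le N}\prod_i(n_i+v_i)^{s_i}$, i.e. the constant term $C$ in an expansion of these sums as $C+\sum_{(\alpha,k)\in S}a_{\alpha,k}N^{\alpha}(\log N)^k+o(1)$ with $S\subset(\mathbb C\times\mathbb N)\setminus\{(0,0)\}$ finite. **1.** Let $$P=\bigcup_{m=1}^{l}\Big\{z:\ \sum_{i\le m}c_i\gamma(z_i)\in\sum_{i\le m}b_i+m-\mathbb N\Big\}$$ (a union of hyperplanes when $\gamma(z)=z$).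 For all $v_1,\dots,v_l\ge 0$ the cut-off nested sum $\mathop{\mathrm{fp}\!\sum}_{1\le n_l<\cdots<n_1}\prod_i(n_i+v_i)^{\beta_i(z_i)}$ exists for every $z\in W^l\setminus P$ and, as a function of $(z_1,\dots,z_l)$, is meromorphic on $W^l$ with poles on $P$: near each point of $W^l$ it equals, outside $P$, a quotient $g/h$ of holomorphic functions, with $h\not\equiv0$ having all its zeros on $P$. In particular, if for no $m\in\{1,\dots,l\}$ one has $\sum_{i\le m}b_i\in\{-m,-m+1,-m+2,\dots\}$, it is holomorphic at $(0,\dots,0)$. When $l=2$ and $v_1=v_2=v\ge0$, a pole at $(0,0)$ can occur only if $b_1=-1$ or $b_1+b_2\in\{-2,-1,0,2,4,6,\dots\}$; otherwise the map extends holomorphically to a neighbourhood of $(0,0)$. **2.** Let $b_1,\dots,b_{l-1}\in\mathbb N$ and $b_l\in\mathbb Z$, let $v\ge0$, and consider, for $z\ne 0$ near $0$, the map $$f(z)=\mathop{\mathrm{fp}\!\sum}_{1\le n_l<\cdots<n_1}(n_1+v)^{\beta_1(z)}\cdots(n_l+v)^{\beta_l(z)}.$$ * If $b_l\in\mathbb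 N$, then $f$ extends holomorphically to $z=0$, and the value of the extension at $z=0$ is a polynomial in $v$ whose coefficients are rational functions of $c_1,\dots,c_l$ (with rational coefficients, and without poles where all $\operatorname{Re}c_j>0$) that depend only on $l$ and $b_1,\dots,b_l$, not on $\gamma$. * If $b_l\le-1$, then $f$ is meromorphic at $z=0$ with at most a simple pole, and its residue at $z=0$ is a polynomial in $v$ whose coefficients are rational functions of $c_1,\dots,c_l$ of the same kind, independent of $\gamma$. -/

import Mathlib

open Filter Topology

/-- `HasFinitePart u C`: the sequence `u` has, as `N → ∞`, an asymptotic expansion in powers of `N`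
(with complex exponents) and `log N`, up to a remainder tending to zero, whose constant term
(the coefficient of `N ^ 0 * (log N) ^ 0`) is `C`. The constant term of such an expansion is unique,
as the functions `N ^ a * (log N) ^ k` for distinct pairs `(a, k)` are asymptotically independent. -/
def HasFinitePart (u : ℕ → ℂ) (C : ℂ) : Prop :=
  ∃ (S : Finset (ℂ × ℕ)) (a : ℂ × ℕ → ℂ), ((0, 0) : ℂ × ℕ) ∉ S ∧
    Tendsto (fun N : ℕ => u N - ∑ p ∈ S, a p * (N : ℂ) ^ p.1 * ((Real.log N : ℝ) : ℂ) ^ p.2)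
      atTop (𝓝 C)

/-- The truncated nested sum `∑_{1 ≤ n_l < ⋯ < n_1 ≤ N} ∏ i, (n_i + v_i) ^ s_i`
(the index `i : Fin l` stands for the mathematical index `i + 1`). -/
noncomputable def nestedSum {l : ℕ} (v : Fin l → ℝ) (s : Fin l → ℂ) (N : ℕ) : ℂ :=
  ∑ n ∈ (Fintype.piFinset fun _ : Fin l => Finset.Icc 1 N).filter
      (fun n : Fin l → ℕ => ∀ i j, i < j → n j < n i),
    ∏ i, ((n i : ℂ) + (v i : ℂ)) ^ s i

/-- `C` is the cut-off nested sum with shifts `v` and exponents `s`: the finite part, as `N → ∞`,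
of the truncated nested sums. -/
def IsCutoffNestedSum {l : ℕ} (v : Fin l → ℝ) (s : Fin l → ℂ) (C : ℂ) : Prop :=
  HasFinitePart (nestedSum v s) C

/-- `γ` is holomorphic on the open neighbourhood `W` of `0`, with `γ 0 = 0` and `γ' 0 = 1`. -/
structure IsRegulator (W : Set ℂ) (γ : ℂ → ℂ) : Prop where
  isOpen : IsOpen W
  zero_mem : (0 : ℂ) ∈ W
  holo : DifferentiableOn ℂ γ W
  map_zero : γ 0 = 0
  hasDerivAt : HasDerivAt γ 1 0

/-- The exponents `β_i (z_i) = b_i - c_i γ(z_i)`. -/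
def exponents {l : ℕ} (b c : Fin l → ℂ) (γ : ℂ → ℂ) (z : Fin l → ℂ) : Fin l → ℂ :=
  fun i => b i - c i * γ (z i)

/-- The union of the hypersurfaces `∑_{i ≤ m} c_i γ(z_i) = ∑_{i ≤ m} b_i + m - k`,
`1 ≤ m ≤ l`, `k ∈ ℕ`. -/
def polarSet {l : ℕ} (b c : Fin l → ℂ) (γ : ℂ → ℂ) : Set (Fin l → ℂ) :=
  {z | ∃ m : ℕ, 1 ≤ m ∧ m ≤ l ∧ ∃ k : ℕ,
    (∑ i : Fin l with i.val < m, c i * γ (z i)) =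
      (∑ i : Fin l with i.val < m, b i) + (m : ℂ) - (k : ℂ)}

/-- `f`, considered outside `P`, is a meromorphic function on `U` of several variables all of whose
poles lie on `P`: around each point of `U` it is a quotient `g / h` of holomorphic functions, where
`h` is not identically zero near the point and the zeros of `h` lie on `P`. -/
def MeromorphicWithPolesOn {l : ℕ} (f : (Fin l → ℂ) → ℂ) (U P : Set (Fin l → ℂ)) : Prop :=
  ∀ p ∈ U, ∃ g h : (Fin l → ℂ) → ℂ, AnalyticAt ℂ g p ∧ AnalyticAt ℂ h p ∧
    (∃ᶠ q in 𝓝 p, h q ≠ 0) ∧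
    ∀ᶠ q in 𝓝 p, (h q = 0 → q ∈ P) ∧ (q ∉ P → f q = g q / h q)

/-- `f c v` is a polynomial in `v` whose coefficients are rational functions, over `ℚ`, of
`c_1, …, c_l`, with denominators that do not vanish when all `c_j` have positive real part. -/
def IsPolynomialWithRationalCoeffs {l : ℕ} (f : (Fin l → ℂ) → ℝ → ℂ) : Prop :=
  ∃ (d : ℕ) (num den : ℕ → MvPolynomial (Fin l) ℚ),
    ∀ c : Fin l → ℂ, (∀ j, 0 < (c j).re) →
      (∀ k, MvPolynomial.aeval c (den k) ≠ 0) ∧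
      ∀ v : ℝ, 0 ≤ v → f c v =
        ∑ k ∈ Finset.range d,
          MvPolynomial.aeval c (num k) / MvPolynomial.aeval c (den k) * (v : ℂ) ^ k

/-! Existence. Multiplication by `(N + w) ^ s` and summation preserve asymptotic expansions in `N ^
α * (log N) ^ k`, because each such term is a difference of terms of the same kind up to any order
in `N`. Hence truncated nested sums have full expansions, with exponents read off from partial sums
of the `s i`; the constant term is isolated exactly when 0 is not among these exponents, that is off
the polar set. It is unique: sampling at `N = p ^ k`, for a prime `p` with `p ^ α ≠ 1` for the
finitely many relevant `α ≠ 0`, turns an expansion into an exponential polynomial without constant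
term, which has no nonzero limit.

Recursion. Euler–Maclaurin summation is applied to the outermost variable. With `w = 1 + v₁ - v₂`,
the combination `∑_{j<J} binom (s+1) j * B_j(w) * x ^ (s+1-j)` is an antidifference of `(s+1) *
(x+w) ^ s` up to `O(x ^ (Re s - J))`. Abel summation against the inner sum gives boundary terms, of
finite part 0 off the polar set, and nested sums of smaller depth whose first two exponents are
merged. For finite parts, `(s₁+1) S(s₁,s₂,…) = G - ∑_{j<J} binom (s₁+1) j * B_j(w) *
S(s₁+s₂+1-j,…)`, where `G` is analytic once `J` is large (`exists_regSum_cons_cons`; depth one is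
`exists_regSum_singleton`). Analyticity of `G` follows by treating a family of sequences of
polynomial growth as one analytic map into bounded sequences.

Meromorphy. By induction on depth, the recursion only divides by the factors `s₁ + 1`, which vanish
on the polar set only (`quotientAt_regSum`). In depth two with equal shifts, `w = 1` and `B_j(1) =
0` for odd `j ≥ 3`, which removes the odd positive values of `b₁ + b₂`.

Diagonal. If `b₁ ≥ -1` is an integer, Euler–Maclaurin is exact at `z = 0`, so `G` vanishes there and
contributes no uncontrolled constant. For `j ≤ b₁ + 1` the merged head exponent is at least `b₂`;
for `j > b₁ + 1` the binomial coefficient has a zero at `z = 0`, compensating one extra pole order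
of the merged sum. This closes an induction bounding pole orders and keeping leading values rational
(`rationalAtZero_diagSum`). The regulator enters only through `γ z = z * F z` with `F 0 = 1`, so it
disappears from these values. -/

/-! ### Shift operators and limits of exponential polynomials -/

open Polynomial in
/-- The shift `(E u) k = u (k + 1)` on sequences. -/
noncomputable def seqShift : Module.End ℂ (ℕ → ℂ) := LinearMap.funLeft ℂ ℂ Nat.succ

theorem seqShift_apply (u : ℕ → ℂ) (k : ℕ) : seqShift u k = u (k + 1) := rfl

-- `E - w` sends `w ^ k * k ^ j` to `w ^ (k+1) * ((k+1) ^ j - k ^ j)`, lowering the degree of the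
-- polynomial factor, so `d` applications annihilate every degree below `d`.
open Polynomial in
theorem aeval_seqShift_sub_pow_geom (w : ℂ) (d : ℕ) : ∀ j < d,
    aeval seqShift ((X - C w) ^ d) (fun k : ℕ => w ^ k * (k : ℂ) ^ j) = 0 := by
  induction d with
  | zero => intro j hj; omega
  | succ d ih =>
    intro j hj
    have h1 : aeval seqShift (X - C w) (fun k : ℕ => w ^ k * (k : ℂ) ^ j) =
        ∑ i ∈ Finset.range j, (w * (j.choose i : ℂ)) • (fun k : ℕ => w ^ k * (k : ℂ) ^ i) := by
      funext k
      have h2 : ((k : ℂ) + 1) ^ j = ∑ i ∈ Finset.range j, (k : ℂ) ^ i * (j.choose i : ℂ) +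
          (k : ℂ) ^ j := by
        rw [add_pow, Finset.sum_range_succ]; simp
      simp only [map_sub, aeval_X, aeval_C, LinearMap.sub_apply, Module.algebraMap_end_apply,
        Pi.sub_apply, seqShift_apply, Pi.smul_apply, smul_eq_mul, Finset.sum_apply]
      push_cast
      rw [h2, mul_add, Finset.mul_sum, pow_succ, add_sub_assoc]
      have h3 : w ^ k * w * (k : ℂ) ^ j - w * (w ^ k * (k : ℂ) ^ j) = 0 := by ring
      rw [h3, add_zero]
      exact Finset.sum_congr rfl fun i _ => by ring
    rw [pow_succ, map_mul, Module.End.mul_apply, h1, map_sum]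
    refine Finset.sum_eq_zero fun i hi => ?_
    rw [map_smul, ih i (by have := Finset.mem_range.1 hi; omega), smul_zero]

-- A shift does not change the limit, so `E` acts on limits as the scalar 1.
open Polynomial in
theorem tendsto_aeval_seqShift (Q : ℂ[X]) {u : ℕ → ℂ} {c : ℂ} (h : Tendsto u atTop (𝓝 c)) :
    Tendsto (aeval seqShift Q u) atTop (𝓝 (Q.eval 1 * c)) := by
  induction Q using Polynomial.induction_on' with
  | add p q hp hq =>
    simp only [map_add, LinearMap.add_apply, eval_add, add_mul]
    exact hp.add hq
  | monomial n a =>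
    have h1 : ∀ n : ℕ, (seqShift ^ n) u = fun k => u (k + n) := by
      intro n
      induction n with
      | zero => rfl
      | succ n ih =>
        rw [pow_succ', Module.End.mul_apply, ih]
        funext k
        rw [seqShift_apply]; congr 1; omega
    simp only [aeval_monomial, Module.End.mul_apply, Module.algebraMap_end_apply, eval_monomial,
      one_pow, mul_one, h1]
    exact (h.comp (tendsto_add_atTop_nat n)).const_mul a

open Polynomial in
theorem eq_zero_of_tendsto_polynomial {P : ℂ[X]} (hP : P.eval 0 = 0) {c : ℂ}
    (h : Tendsto (fun k : ℕ => P.eval (k : ℂ)) atTop (𝓝 c)) : c = 0 := by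
  by_cases hd : 0 < P.degree
  · exfalso
    have h1 : Tendsto (fun k : ℕ => ‖(k : ℂ)‖) atTop atTop := by
      simpa using tendsto_natCast_atTop_atTop (R := ℝ)
    exact not_tendsto_nhds_of_tendsto_atTop (P.tendsto_norm_atTop hd h1) _ h.norm
  · rw [eq_C_of_degree_le_zero (not_lt.1 hd)] at h hP
    simp only [eval_C] at h hP
    rw [hP] at h
    exact tendsto_nhds_unique h tendsto_const_nhds

open Polynomial in
/-- An exponential polynomial without constant term has no nonzero limit. -/
theorem eq_zero_of_tendsto_exponential_polynomial {ι : Type*} (S : Finset ι) (a w : ι → ℂ)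
    (e : ι → ℕ) (he : ∀ i ∈ S, w i = 1 → e i ≠ 0) {c : ℂ}
    (h : Tendsto (fun k : ℕ => ∑ i ∈ S, a i * (w i ^ k * (k : ℂ) ^ e i)) atTop (𝓝 c)) :
    c = 0 := by
  classical
  -- `Q` of the shift kills the terms with base `w i ≠ 1`, and `(X - 1) ^ d` those with base 1. By a
  -- Bézout relation `A * Q` acts as the projection to the base-1 terms. Its value at 1 is 1, so the
  -- limit is kept and becomes the limit of an ordinary polynomial vanishing at 0.
  set Q : ℂ[X] := ∏ i ∈ S with w i ≠ 1, (X - C (w i) : ℂ[X]) ^ (e i + 1) with hQ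
  set d := ∑ i ∈ S, (e i + 1) + 1 with hd
  have hQ1 : Q.eval 1 ≠ 0 := by
    rw [hQ, eval_prod, Finset.prod_ne_zero_iff]
    intro i hi
    simp only [eval_pow, eval_sub, eval_X, eval_C]
    exact pow_ne_zero _ (sub_ne_zero.2 fun hh => (Finset.mem_filter.1 hi).2 hh.symm)
  have hco : IsCoprime Q ((X - C 1) ^ d) := by
    refine IsCoprime.pow_right (IsCoprime.symm ?_)
    rw [(irreducible_X_sub_C (1 : ℂ)).coprime_iff_not_dvd, dvd_iff_isRoot]
    exact hQ1
  obtain ⟨A, B, hAB⟩ := hco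
  have hkillQ : ∀ i ∈ S, w i ≠ 1 →
      aeval seqShift Q (fun k : ℕ => w i ^ k * (k : ℂ) ^ e i) = 0 := by
    intro i hi hwi
    rw [hQ, ← Finset.prod_erase_mul _ _ (Finset.mem_filter.2 ⟨hi, hwi⟩), map_mul,
      Module.End.mul_apply, aeval_seqShift_sub_pow_geom _ _ _ (Nat.lt_succ_self _), map_zero]
  have hkill1 : ∀ i ∈ S, w i = 1 →
      aeval seqShift ((X - C (1 : ℂ)) ^ d) (fun k : ℕ => w i ^ k * (k : ℂ) ^ e i) = 0 := by
    intro i hi hwi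
    rw [hwi]
    refine aeval_seqShift_sub_pow_geom 1 d _ ?_
    have := Finset.single_le_sum (f := fun i => e i + 1) (fun _ _ => Nat.zero_le _) hi
    omega
  have key : aeval seqShift (A * Q) (fun k : ℕ => ∑ i ∈ S, a i * (w i ^ k * (k : ℂ) ^ e i)) =
      fun k : ℕ => ∑ i ∈ S with w i = 1, a i * (k : ℂ) ^ e i := by
    have e1 : (fun k : ℕ => ∑ i ∈ S, a i * (w i ^ k * (k : ℂ) ^ e i)) =
        ∑ i ∈ S, a i • (fun k : ℕ => w i ^ k * (k : ℂ) ^ e i) := by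
      funext k; simp
    rw [e1, map_sum]
    have e2 : (fun k : ℕ => ∑ i ∈ S with w i = 1, a i * (k : ℂ) ^ e i) =
        ∑ i ∈ S, if w i = 1 then a i • (fun k : ℕ => w i ^ k * (k : ℂ) ^ e i) else 0 := by
      rw [← Finset.sum_filter]
      funext k
      simp only [Finset.sum_apply, Pi.smul_apply, smul_eq_mul]
      exact Finset.sum_congr rfl fun i hi => by rw [(Finset.mem_filter.1 hi).2]; simp
    rw [e2]
    refine Finset.sum_congr rfl fun i hi => ?_
    rw [map_smul]
    split_ifs with hwi
    · have : A * Q = 1 - B * (X - C 1) ^ d := by rw [← hAB]; ring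
      rw [this, map_sub, LinearMap.sub_apply, map_mul, Module.End.mul_apply, hkill1 i hi hwi]
      simp
    · rw [map_mul, Module.End.mul_apply, hkillQ i hi hwi]; simp
  have hAQ1 : (A * Q).eval 1 = 1 := by
    have := congrArg (eval 1) hAB
    simpa [hd] using this
  have hlim := tendsto_aeval_seqShift (A * Q) h
  rw [key, hAQ1, one_mul] at hlim
  refine eq_zero_of_tendsto_polynomial (P := ∑ i ∈ S with w i = 1, (C (a i) * X ^ e i : ℂ[X])) ?_ ?_
  · rw [eval_finsetSum]
    refine Finset.sum_eq_zero fun i hi => ?_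
    have hi := Finset.mem_filter.1 hi
    simp [he i hi.1 hi.2]
  · simpa [eval_finsetSum] using hlim

/-! ### Finite parts and their uniqueness -/

/-- The sequence `N ^ α * (log N) ^ k` for `p = (α, k)`. -/
noncomputable def powLog (p : ℂ × ℕ) : ℕ → ℂ :=
  fun N => (N : ℂ) ^ p.1 * ((Real.log N : ℝ) : ℂ) ^ p.2

/-- The span formulation makes linearity of finite parts a matter of submodule closure. -/
theorem hasFinitePart_iff {u : ℕ → ℂ} {c : ℂ} :
    HasFinitePart u c ↔ ∃ f ∈ Submodule.span ℂ (powLog '' {(0, 0)}ᶜ),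
      Tendsto (fun N => u N - f N) atTop (𝓝 c) := by
  constructor
  · rintro ⟨S, a, h0, h⟩
    refine ⟨∑ p ∈ S, a p • powLog p, Submodule.sum_mem _ fun p hp => Submodule.smul_mem _ _
      (Submodule.subset_span ⟨p, fun h => h0 (h ▸ hp), rfl⟩), ?_⟩
    simpa [powLog, mul_assoc] using h
  · rintro ⟨f, hf, h⟩
    rw [Finsupp.mem_span_image_iff_linearCombination] at hf
    obtain ⟨a, ha, rfl⟩ := hf
    refine ⟨a.support, a, fun h => (ha h) rfl, ?_⟩
    simpa [Finsupp.linearCombination_apply, Finsupp.sum, powLog, mul_assoc] using h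

theorem HasFinitePart.add {u w : ℕ → ℂ} {c d : ℂ} (hu : HasFinitePart u c)
    (hw : HasFinitePart w d) : HasFinitePart (fun N => u N + w N) (c + d) := by
  rw [hasFinitePart_iff] at *
  obtain ⟨f, hf, hf'⟩ := hu
  obtain ⟨g, hg, hg'⟩ := hw
  refine ⟨f + g, Submodule.add_mem _ hf hg, (hf'.add hg').congr fun N => ?_⟩
  simp only [Pi.add_apply]; ring

theorem HasFinitePart.const_mul {u : ℕ → ℂ} {c : ℂ} (a : ℂ) (hu : HasFinitePart u c) :
    HasFinitePart (fun N => a * u N) (a * c) := by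
  rw [hasFinitePart_iff] at *
  obtain ⟨f, hf, hf'⟩ := hu
  refine ⟨a • f, Submodule.smul_mem _ _ hf, (hf'.const_mul a).congr fun N => ?_⟩
  simp only [Pi.smul_apply, smul_eq_mul]; ring

theorem HasFinitePart.sum {ι : Type*} (s : Finset ι) {u : ι → ℕ → ℂ} {c : ι → ℂ}
    (h : ∀ i ∈ s, HasFinitePart (u i) (c i)) :
    HasFinitePart (fun N => ∑ i ∈ s, u i N) (∑ i ∈ s, c i) := by
  classical
  induction s using Finset.induction_on with
  | empty => exact hasFinitePart_iff.2 ⟨0, Submodule.zero_mem _, by simp⟩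
  | insert i s hi ih =>
    simp only [Finset.sum_insert hi]
    exact (h i (Finset.mem_insert_self _ _)).add
      (ih fun j hj => h j (Finset.mem_insert_of_mem hj))

theorem HasFinitePart.of_tendsto {u : ℕ → ℂ} {c : ℂ} (h : Tendsto u atTop (𝓝 c)) :
    HasFinitePart u c :=
  hasFinitePart_iff.2 ⟨0, Submodule.zero_mem _, by simpa using h⟩

theorem HasFinitePart.congr {u w : ℕ → ℂ} {c : ℂ} (h : HasFinitePart u c)
    (huw : ∀ᶠ N in atTop, u N = w N) : HasFinitePart w c := by
  rw [hasFinitePart_iff] at *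
  obtain ⟨f, hf, hf'⟩ := h
  exact ⟨f, hf, hf'.congr' (huw.mono fun N hN => by rw [hN])⟩

/-- If both powers were 1, then `α log p` and `α log q` would be integer multiples of `2πi`;
eliminating `α` gives a relation `p ^ m = q ^ n` with `m ≠ 0`, against unique factorization. -/
theorem natCast_prime_cpow_ne_one {p q : ℕ} (hp : p.Prime) (hq : q.Prime) (hpq : p ≠ q)
    {α : ℂ} (hα : α ≠ 0) (h : (p : ℂ) ^ α = 1) : (q : ℂ) ^ α ≠ 1 := by
  intro h'
  have hp0 : (p : ℂ) ≠ 0 := by exact_mod_cast hp.ne_zero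
  have hq0 : (q : ℂ) ≠ 0 := by exact_mod_cast hq.ne_zero
  rw [Complex.cpow_def_of_ne_zero hp0, Complex.exp_eq_one_iff] at h
  rw [Complex.cpow_def_of_ne_zero hq0, Complex.exp_eq_one_iff] at h'
  obtain ⟨a, ha⟩ := h
  obtain ⟨b, hb⟩ := h'
  have hlp : 0 < Real.log p := Real.log_pos (by exact_mod_cast hp.one_lt)
  have hlq : 0 < Real.log q := Real.log_pos (by exact_mod_cast hq.one_lt)
  rw [Complex.natCast_log.symm] at ha hb
  have hb0 : b ≠ 0 := by
    rintro rfl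
    simp only [Int.cast_zero, zero_mul, mul_eq_zero, Complex.ofReal_eq_zero] at hb
    exact hb.elim hlq.ne' hα
  have h1 : (b : ℂ) * (Real.log p : ℝ) = a * (Real.log q : ℝ) := by
    have : ((b : ℂ) * (Real.log p : ℝ)) * α = (a * (Real.log q : ℝ)) * α := by
      linear_combination (b : ℂ) * ha - a * hb
    exact mul_right_cancel₀ hα this
  have h2 : (b : ℝ) * Real.log p = a * Real.log q := by exact_mod_cast h1
  have h3 : (b.natAbs : ℝ) * Real.log p = a.natAbs * Real.log q := by
    have := congrArg abs h2
    rw [abs_mul, abs_mul, abs_of_pos hlp, abs_of_pos hlq] at this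
    simpa [Nat.cast_natAbs] using this
  have h4 : p ^ b.natAbs = q ^ a.natAbs := by
    have hp' : (0 : ℝ) < p := by exact_mod_cast hp.pos
    have hq' : (0 : ℝ) < q := by exact_mod_cast hq.pos
    rw [← Real.log_pow, ← Real.log_pow] at h3
    exact_mod_cast Real.log_injOn_pos (Set.mem_Ioi.2 (by positivity))
      (Set.mem_Ioi.2 (by positivity)) h3
  have h5 : p ∣ q ^ a.natAbs := h4 ▸ dvd_pow_self p (Int.natAbs_ne_zero.2 hb0)
  exact hpq ((Nat.prime_dvd_prime_iff_eq hp hq).1 (hp.dvd_of_dvd_pow h5))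

/-- Each nonzero `α` excludes at most one prime, and there are infinitely many primes. -/
theorem exists_prime_cpow_ne_one (S : Finset ℂ) (h0 : ∀ α ∈ S, α ≠ 0) :
    ∃ p : ℕ, p.Prime ∧ ∀ α ∈ S, (p : ℂ) ^ α ≠ 1 := by
  by_contra! h
  have h1 : {p : ℕ | p.Prime} ⊆ ⋃ α ∈ S, {p : ℕ | p.Prime ∧ (p : ℂ) ^ α = 1} := by
    intro p hp
    obtain ⟨α, hα, h2⟩ := h p hp
    exact Set.mem_biUnion hα ⟨hp, h2⟩
  refine Nat.infinite_setOfPred_prime ((S.finite_toSet.biUnion fun α hα => ?_).subset h1)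
  refine Set.Subsingleton.finite fun p hp q hq => ?_
  by_contra hpq
  exact natCast_prime_cpow_ne_one hp.1 hq.1 hpq (h0 α hα) hp.2 hq.2

/-- Along `N = p ^ k` the term `N ^ α * (log N) ^ i` becomes `(p ^ α) ^ k * (k log p) ^ i`. For a
suitable `p` the base is 1 only if `α = 0`, and then `i ≠ 0`, so no constant term occurs in the
expansion of the zero sequence. -/
theorem HasFinitePart.unique {u : ℕ → ℂ} {c d : ℂ} (hc : HasFinitePart u c)
    (hd : HasFinitePart u d) : c = d := by
  have h0 : HasFinitePart (fun _ => (0 : ℂ)) (c - d) := by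
    have := hc.add (hd.const_mul (-1))
    simpa [sub_eq_add_neg] using this
  obtain ⟨S, a, hS, h⟩ := h0
  obtain ⟨p, hp, hpS⟩ := exists_prime_cpow_ne_one ((S.image Prod.fst).erase 0)
    (fun α hα => (Finset.mem_erase.1 hα).1)
  have hp0 : (p : ℂ) ≠ 0 := by exact_mod_cast hp.ne_zero
  have h1 := h.comp (tendsto_pow_atTop_atTop_of_one_lt hp.one_lt)
  refine sub_eq_zero.1 (eq_zero_of_tendsto_exponential_polynomial S
    (fun i => -(a i * ((Real.log p : ℝ) : ℂ) ^ i.2)) (fun i => (p : ℂ) ^ i.1) (fun i => i.2)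
    ?_ (h1.congr fun k => ?_))
  · rintro ⟨α, k⟩ hi hw hk
    simp only at hw hk
    subst hk
    by_cases hα : α = 0
    · subst hα; exact hS hi
    · exact hpS α (Finset.mem_erase.2 ⟨hα, Finset.mem_image.2 ⟨_, hi, rfl⟩⟩) hw
  · simp only [Function.comp_apply, zero_sub, ← Finset.sum_neg_distrib]
    refine Finset.sum_congr rfl fun i _ => ?_
    have e1 : ((p ^ k : ℕ) : ℂ) ^ i.1 = ((p : ℂ) ^ i.1) ^ k := by
      rw [Nat.cast_pow, ← Complex.natCast_cpow_natCast_mul, ← Complex.cpow_nat_mul]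
    rw [e1]
    push_cast
    rw [Real.log_pow]
    push_cast
    rw [mul_pow]; ring

/-! ### Asymptotic expansions in powers and logarithms -/

open Asymptotics

/-- The sequence `u` has, to every order, an asymptotic expansion in the `N ^ α * (log N) ^ k`
with `(α, k) ∈ T`; the space of all such sequences. -/
def expansions (T : Set (ℂ × ℕ)) : Submodule ℂ (ℕ → ℂ) where
  carrier := {u | ∀ K : ℝ, ∃ f ∈ Submodule.span ℂ (powLog '' T),
    (fun N => u N - f N) =O[atTop] fun N : ℕ => (N : ℝ) ^ (-K)}
  add_mem' := by
    intro u w hu hw K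
    obtain ⟨f, hf, hf'⟩ := hu K
    obtain ⟨g, hg, hg'⟩ := hw K
    refine ⟨f + g, Submodule.add_mem _ hf hg, (hf'.add hg').congr_left fun N => ?_⟩
    simp only [Pi.add_apply]; ring
  zero_mem' := fun K => ⟨0, Submodule.zero_mem _, by simpa using isBigO_zero _ _⟩
  smul_mem' := by
    intro a u hu K
    obtain ⟨f, hf, hf'⟩ := hu K
    refine ⟨a • f, Submodule.smul_mem _ _ hf, (hf'.const_mul_left a).congr_left fun N => ?_⟩
    simp only [Pi.smul_apply, smul_eq_mul]; ring

theorem isBigO_rpow_natCast {a b : ℝ} (h : a ≤ b) :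
    (fun N : ℕ => (N : ℝ) ^ a) =O[atTop] fun N : ℕ => (N : ℝ) ^ b := by
  refine IsBigO.of_bound 1 ((eventually_ge_atTop 1).mono fun N hN => ?_)
  have hN' : (1 : ℝ) ≤ N := by exact_mod_cast hN
  rw [one_mul, Real.norm_of_nonneg (by positivity), Real.norm_of_nonneg (by positivity)]
  exact Real.rpow_le_rpow_of_exponent_le hN' h

theorem isBigO_cpow_natCast (α : ℂ) :
    (fun N : ℕ => (N : ℂ) ^ α) =O[atTop] fun N : ℕ => (N : ℝ) ^ α.re := by
  refine IsBigO.of_bound 1 ((eventually_ge_atTop 1).mono fun N hN => ?_)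
  rw [Complex.norm_natCast_cpow_of_pos (by omega), one_mul, Real.norm_of_nonneg (by positivity)]

theorem isBigO_powLog (p : ℂ × ℕ) {K : ℝ} (h : p.1.re < K) :
    powLog p =O[atTop] fun N : ℕ => (N : ℝ) ^ K := by
  have h1 : (fun N : ℕ => ((Real.log N : ℝ) : ℂ) ^ p.2) =O[atTop]
      fun N : ℕ => (N : ℝ) ^ (K - p.1.re) := by
    have := (isLittleO_log_rpow_rpow_atTop (s := K - p.1.re) (p.2 : ℝ)
      (by linarith)).isBigO.comp_tendsto
      (tendsto_natCast_atTop_atTop (R := ℝ))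
    refine IsBigO.trans (IsBigO.of_bound 1 (Eventually.of_forall fun N => ?_)) this
    rw [one_mul, norm_pow, Complex.norm_real]
    simp
  refine ((isBigO_cpow_natCast p.1).mul h1).congr' EventuallyEq.rfl ?_
  refine (eventually_ge_atTop 1).mono fun N hN => ?_
  have hN' : (0 : ℝ) < N := by exact_mod_cast hN
  simp only
  rw [← Real.rpow_add hN']; ring_nf

theorem span_le_expansions (T : Set (ℂ × ℕ)) : Submodule.span ℂ (powLog '' T) ≤ expansions T :=
  fun f hf _ => ⟨f, hf, by simpa using isBigO_zero _ _⟩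

theorem powLog_mem_expansions {T : Set (ℂ × ℕ)} {p : ℂ × ℕ} (hp : p ∈ T) :
    powLog p ∈ expansions T := span_le_expansions T (Submodule.subset_span ⟨p, hp, rfl⟩)

theorem expansions_mono {T T' : Set (ℂ × ℕ)} (h : T ⊆ T') : expansions T ≤ expansions T' :=
  fun _ hu K => let ⟨f, hf, hf'⟩ := hu K
    ⟨f, Submodule.span_mono (Set.image_mono h) hf, hf'⟩

theorem expansions_congr {T : Set (ℂ × ℕ)} {u w : ℕ → ℂ} (hu : u ∈ expansions T)
    (h : ∀ᶠ N in atTop, u N = w N) : w ∈ expansions T := fun K =>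
  let ⟨f, hf, hf'⟩ := hu K
  ⟨f, hf, hf'.congr' (h.mono fun N hN => by simp only [hN]) EventuallyEq.rfl⟩

/-- Sequences approximated to every order by sequences with expansions have expansions. -/
theorem mem_expansions_of_approx {T : Set (ℂ × ℕ)} {u : ℕ → ℂ}
    (h : ∀ K : ℝ, ∃ f ∈ expansions T, (fun N => u N - f N) =O[atTop] fun N : ℕ => (N : ℝ) ^ (-K)) :
    u ∈ expansions T := by
  intro K
  obtain ⟨f, hf, hf'⟩ := h K
  obtain ⟨g, hg, hg'⟩ := hf K
  refine ⟨g, hg, (hf'.add hg').congr_left fun N => ?_⟩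
  ring

theorem hasFinitePart_zero_of_mem_expansions {T : Set (ℂ × ℕ)} {u : ℕ → ℂ} (hT : (0, 0) ∉ T)
    (hu : u ∈ expansions T) : HasFinitePart u 0 := by
  obtain ⟨f, hf, hf'⟩ := hu 1
  refine hasFinitePart_iff.2 ⟨f, Submodule.span_mono (Set.image_mono ?_) hf, ?_⟩
  · intro p hp h
    exact hT (h ▸ hp)
  · refine hf'.trans_tendsto ?_
    exact (tendsto_rpow_neg_atTop one_pos).comp tendsto_natCast_atTop_atTop

/-- If `φ` is analytic at `0`, then `N ^ α * (log N) ^ k * φ (1 / N)` has an expansion. -/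
theorem powLog_mul_analytic_mem_expansions (α : ℂ) (k : ℕ) {φ : ℂ → ℂ} (hφ : AnalyticAt ℂ φ 0) :
    (fun N => powLog (α, k) N * φ ((N : ℂ)⁻¹)) ∈
      expansions (Set.range fun j : ℕ => (α - j, k)) := by
  intro K
  -- The Taylor remainder of order `J` contributes `N ^ (α - J) * (log N) ^ k`; the strict
  -- inequality `Re α - J < -K` absorbs the logarithms.
  obtain ⟨J, hJ⟩ := exists_nat_gt (α.re + K)
  obtain ⟨ψ, hψ, h⟩ := hφ.exists_eq_sum_add_pow_mul J
  have hpow : ∀ N : ℕ, 1 ≤ N → ∀ i : ℕ, powLog (α, k) N * ((N : ℂ)⁻¹) ^ i =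
      powLog (α - i, k) N := by
    intro N hN i
    have hN0 : (N : ℂ) ≠ 0 := by exact_mod_cast (by omega : N ≠ 0)
    simp only [powLog]
    rw [Complex.cpow_sub _ _ hN0, Complex.cpow_natCast, inv_pow, div_eq_mul_inv]
    ring
  refine ⟨∑ i ∈ Finset.range J, (iteratedDeriv i φ 0 / (i.factorial : ℂ)) • powLog (α - i, k),
    Submodule.sum_mem _ fun i _ => Submodule.smul_mem _ _ (Submodule.subset_span
      ⟨_, ⟨i, rfl⟩, rfl⟩), ?_⟩
  have hinv : Tendsto (fun N : ℕ => ((N : ℂ))⁻¹) atTop (𝓝 0) := tendsto_inv_atTop_nhds_zero_nat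
  have hb : (fun N : ℕ => ψ ((N : ℂ)⁻¹)) =O[atTop] fun _ => (1 : ℝ) :=
    ((hψ.continuousAt.tendsto.comp hinv).isBigO_one ℝ)
  have h2 := (isBigO_powLog (α - J, k) (K := -K) (by simp; linarith)).mul hb
  refine h2.congr' ?_ (Eventually.of_forall fun N => by simp)
  refine (eventually_ge_atTop 1).mono fun N hN => ?_
  simp only [h, smul_eq_mul, Finset.sum_apply, Pi.smul_apply]
  rw [mul_add, ← mul_assoc (powLog _ _) ((N : ℂ)⁻¹ ^ J), hpow N hN, Finset.mul_sum, ← sub_eq_zero]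
  have : ∀ i ∈ Finset.range J, powLog (α, k) N * ((N : ℂ)⁻¹ ^ i / (i.factorial : ℂ) *
      iteratedDeriv i φ 0) = iteratedDeriv i φ 0 / (i.factorial : ℂ) * powLog (α - i, k) N := by
    intro i _
    rw [← hpow N hN]; ring
  rw [Finset.sum_congr rfl this]; ring

theorem natCast_add_cpow {N : ℕ} (hN : 1 ≤ N) {w : ℝ} (hw : 0 ≤ w) (s : ℂ) :
    ((N : ℂ) + (w : ℂ)) ^ s = (N : ℂ) ^ s * (1 + w * (N : ℂ)⁻¹) ^ s := by
  have hN' : (0 : ℝ) < N := by exact_mod_cast hN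
  have e : ((N : ℂ) + w) = ((N : ℝ) : ℂ) * ((1 + w * (N : ℝ)⁻¹ : ℝ) : ℂ) := by
    have hN0 : (N : ℂ) ≠ 0 := by exact_mod_cast (by omega : N ≠ 0)
    push_cast
    field_simp
  rw [e, Complex.mul_cpow_ofReal_nonneg hN'.le (by positivity)]
  push_cast
  rfl

theorem analyticAt_one_add_mul_cpow (w s : ℂ) : AnalyticAt ℂ (fun t : ℂ => (1 + w * t) ^ s) 0 := by
  refine AnalyticAt.cpow (by fun_prop) (by fun_prop) ?_
  simp

/-- Multiplication by `(N + w) ^ s` shifts the exponents of an expansion by `s - ℕ`. -/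
theorem cpow_mul_mem_expansions {T : Set (ℂ × ℕ)} {u : ℕ → ℂ} (hu : u ∈ expansions T)
    {w : ℝ} (hw : 0 ≤ w) (s : ℂ) :
    (fun N : ℕ => ((N : ℂ) + (w : ℂ)) ^ s * u N) ∈
      expansions {p | ∃ q ∈ T, ∃ j : ℕ, p = (q.1 + s - j, q.2)} := by
  have key : ∀ p ∈ T, (fun N : ℕ => ((N : ℂ) + (w : ℂ)) ^ s * powLog p N) ∈
      expansions {p | ∃ q ∈ T, ∃ j : ℕ, p = (q.1 + s - j, q.2)} := by
    intro p hp
    refine expansions_mono ?_ (expansions_congr (powLog_mul_analytic_mem_expansions (p.1 + s) p.2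
      (analyticAt_one_add_mul_cpow w s)) ((eventually_ge_atTop 1).mono fun N hN => ?_))
    · rintro _ ⟨j, rfl⟩
      exact ⟨p, hp, j, rfl⟩
    · have hN0 : (N : ℂ) ≠ 0 := by exact_mod_cast (by omega : N ≠ 0)
      rw [natCast_add_cpow hN hw]
      simp only [powLog]
      rw [Complex.cpow_add _ _ hN0]
      ring
  have hO : (fun N : ℕ => ((N : ℂ) + (w : ℂ)) ^ s) =O[atTop] fun N : ℕ => (N : ℝ) ^ s.re := by
    have hinv : Tendsto (fun N : ℕ => ((N : ℂ))⁻¹) atTop (𝓝 0) := tendsto_inv_atTop_nhds_zero_nat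
    have hb : (fun N : ℕ => (1 + w * (N : ℂ)⁻¹) ^ s) =O[atTop] fun _ => (1 : ℝ) :=
      (((analyticAt_one_add_mul_cpow w s).continuousAt.tendsto.comp hinv).isBigO_one ℝ)
    refine ((isBigO_cpow_natCast s).mul hb).congr' ?_ (Eventually.of_forall fun N => by simp)
    exact (eventually_ge_atTop 1).mono fun N hN => (natCast_add_cpow hN hw s).symm
  refine mem_expansions_of_approx fun K => ?_
  obtain ⟨f, hf, hf'⟩ := hu (K + s.re)
  refine ⟨fun N : ℕ => ((N : ℂ) + (w : ℂ)) ^ s * f N, ?_, ?_⟩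
  · clear hf'
    induction hf using Submodule.span_induction with
    | mem x hx => obtain ⟨p, hp, rfl⟩ := hx; exact key p hp
    | zero =>
      refine expansions_congr (Submodule.zero_mem _) (Eventually.of_forall fun N => ?_)
      simp
    | add x y _ _ hx hy =>
      refine expansions_congr (Submodule.add_mem _ hx hy) (Eventually.of_forall fun N => ?_)
      simp only [Pi.add_apply]; ring
    | smul a x _ hx =>
      refine expansions_congr (Submodule.smul_mem _ a hx) (Eventually.of_forall fun N => ?_)
      simp only [Pi.smul_apply, smul_eq_mul]; ring
  · refine (hO.mul hf').congr' (Eventually.of_forall fun N => by ring)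
      ((eventually_ge_atTop 1).mono fun N hN => ?_)
    have hN' : (0 : ℝ) < N := by exact_mod_cast hN
    simp only
    rw [← Real.rpow_add hN']; ring_nf

/-! ### Approximate antidifferences and expansions of nested sums -/

theorem AnalyticAt.exists_eq_add_mul_add_sq_mul {g : ℂ → ℂ} (hg : AnalyticAt ℂ g 0) {a b : ℂ}
    (h0 : g 0 = a) (h1 : HasDerivAt g b 0) :
    ∃ ψ : ℂ → ℂ, AnalyticAt ℂ ψ 0 ∧ ∀ z, g z = a + b * z + z ^ 2 * ψ z := by
  obtain ⟨ψ, hψ, h⟩ := hg.exists_eq_sum_add_pow_mul 2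
  refine ⟨ψ, hψ, fun z => ?_⟩
  rw [h z, Finset.sum_range_succ, Finset.sum_range_one]
  simp only [pow_zero, Nat.factorial_zero, Nat.cast_one, div_one, iteratedDeriv_zero,
    pow_one, Nat.factorial_one, iteratedDeriv_one, smul_eq_mul, h0, h1.deriv]
  ring

/-- The difference of `N ^ (α + 1) * (log N) ^ k`, up to terms of order `N ^ (α - 1)`. -/
theorem powLog_difference_mem_expansions (α : ℂ) (k : ℕ) :
    (fun N => powLog (α + 1, k) (N + 1) - powLog (α + 1, k) N -
      ((α + 1) * powLog (α, k) N + k * powLog (α, k - 1) N)) ∈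
      expansions {p | ∃ j i : ℕ, p = (α - 1 - j, i)} := by
  have hslit : (1 : ℂ) + 0 ∈ Complex.slitPlane := by simp
  -- With `t = 1/N` and `log (N+1) = log N + log (1+t)`, the binomial theorem leads to these
  -- functions of `t`. To first order only `i = 0` and `i = 1` contribute, which the powers of 0
  -- encode.
  have hg : ∀ i : ℕ, ∃ ψ : ℂ → ℂ, AnalyticAt ℂ ψ 0 ∧ ∀ t,
      (1 + t) ^ (α + 1) * Complex.log (1 + t) ^ i =
        0 ^ i + ((α + 1) * 0 ^ i + i * 0 ^ (i - 1)) * t + t ^ 2 * ψ t := by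
    intro i
    refine AnalyticAt.exists_eq_add_mul_add_sq_mul ?_ (by simp) ?_
    · exact (AnalyticAt.cpow (by fun_prop) (by fun_prop) hslit).mul
        ((AnalyticAt.clog (by fun_prop) hslit).pow i)
    · have h1 : HasDerivAt (fun t : ℂ => 1 + t) 1 0 := (hasDerivAt_id (0 : ℂ)).const_add 1
      have h2 := (h1.cpow_const (c := α + 1) hslit).mul ((h1.clog hslit).pow i)
      refine h2.congr_deriv ?_
      simp
  choose ψ hψ hg using hg
  have hmem : (∑ i ∈ Finset.range (k + 1), (k.choose i : ℂ) •
      fun N => powLog (α - 1, k - i) N * ψ i ((N : ℂ)⁻¹)) ∈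
      expansions {p | ∃ j i : ℕ, p = (α - 1 - j, i)} := by
    refine Submodule.sum_mem _ fun i _ => Submodule.smul_mem _ _ ?_
    refine expansions_mono ?_ (powLog_mul_analytic_mem_expansions (α - 1) (k - i) (hψ i))
    rintro _ ⟨j, rfl⟩
    exact ⟨j, k - i, rfl⟩
  refine expansions_congr hmem ((eventually_ge_atTop 1).mono fun N hN => ?_)
  have hN' : (0 : ℝ) < N := by exact_mod_cast hN
  have hN0 : (N : ℂ) ≠ 0 := by exact_mod_cast (by omega : N ≠ 0)
  set L : ℂ := ((Real.log N : ℝ) : ℂ) with hL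
  set t : ℂ := (N : ℂ)⁻¹ with ht
  have hlog : ((Real.log ((N + 1 : ℕ) : ℝ) : ℝ) : ℂ) = Complex.log (1 + t) + L := by
    have e : ((N + 1 : ℕ) : ℝ) = (1 + (N : ℝ)⁻¹) * N := by push_cast; field_simp
    rw [e, Real.log_mul (by positivity) hN'.ne', Complex.ofReal_add,
      Complex.ofReal_log (by positivity)]
    push_cast
    rw [hL, Complex.natCast_log]
  have hpow : ((N + 1 : ℕ) : ℂ) ^ (α + 1) = (N : ℂ) ^ (α + 1) * (1 + t) ^ (α + 1) := by
    have := natCast_add_cpow hN zero_le_one (α + 1)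
    push_cast at this ⊢
    simpa using this
  have e1 : (N : ℂ) ^ (α + 1) = (N : ℂ) ^ α * N := by
    rw [Complex.cpow_add _ _ hN0, Complex.cpow_one]
  have e2 : (N : ℂ) ^ (α - 1) = (N : ℂ) ^ α * t := by
    rw [Complex.cpow_sub _ _ hN0, Complex.cpow_one, div_eq_mul_inv]
  have hNt : (N : ℂ) * t = 1 := mul_inv_cancel₀ hN0
  have s0 : ∑ i ∈ Finset.range (k + 1), (k.choose i : ℂ) * L ^ (k - i) * 0 ^ i = L ^ k := by
    rw [Finset.sum_eq_single 0]
    · simp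
    · intro i _ hi; simp [hi]
    · simp
  have s1 : ∑ i ∈ Finset.range (k + 1), (k.choose i : ℂ) * L ^ (k - i) * (i * 0 ^ (i - 1)) =
      k * L ^ (k - 1) := by
    rw [Finset.sum_eq_single 1]
    · simp
    · intro i _ hi
      rcases Nat.eq_zero_or_pos i with rfl | hi'
      · simp
      · have : i - 1 ≠ 0 := by omega
        simp [this]
    · intro h
      have : k = 0 := by simpa using h
      simp [this]
  simp only [Finset.sum_apply, Pi.smul_apply, smul_eq_mul, powLog, ← hL]
  rw [hpow, hlog, add_pow, e1, e2]
  have s2 : ∀ i ∈ Finset.range (k + 1), (k.choose i : ℂ) * ((N : ℂ) ^ α * t * L ^ (k - i) * ψ i t) =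
      (N : ℂ) ^ α * N * ((1 + t) ^ (α + 1) * (Complex.log (1 + t) ^ i * L ^ (k - i) *
        (k.choose i : ℂ))) - (N : ℂ) ^ α * N * ((k.choose i : ℂ) * L ^ (k - i) * 0 ^ i) -
      (N : ℂ) ^ α * (α + 1) * ((k.choose i : ℂ) * L ^ (k - i) * 0 ^ i) -
      (N : ℂ) ^ α * ((k.choose i : ℂ) * L ^ (k - i) * (i * 0 ^ (i - 1))) := by
    intro i _
    have := hg i t
    linear_combination (-(N : ℂ) ^ α * N * L ^ (k - i) * (k.choose i : ℂ)) * this +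
      ((N : ℂ) ^ α * L ^ (k - i) * (k.choose i : ℂ) * ((-(α + 1) * 0 ^ i - i * 0 ^ (i - 1))
        - t * ψ i t)) * hNt
  rw [Finset.sum_congr rfl s2, Finset.sum_sub_distrib, Finset.sum_sub_distrib,
    Finset.sum_sub_distrib, ← Finset.mul_sum, ← Finset.mul_sum, ← Finset.mul_sum,
    ← Finset.mul_sum, ← Finset.mul_sum, s0, s1]
  ring

theorem exists_antidifference_of_span {T T' : Set (ℂ × ℕ)} {K : ℝ}
    (h : ∀ p ∈ T, ∃ P ∈ Submodule.span ℂ (powLog '' T'),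
      (fun N => powLog p N - (P (N + 1) - P N)) =O[atTop] fun N : ℕ => (N : ℝ) ^ (-K))
    {f : ℕ → ℂ} (hf : f ∈ Submodule.span ℂ (powLog '' T)) :
    ∃ P ∈ Submodule.span ℂ (powLog '' T'),
      (fun N => f N - (P (N + 1) - P N)) =O[atTop] fun N : ℕ => (N : ℝ) ^ (-K) := by
  induction hf using Submodule.span_induction with
  | mem x hx => obtain ⟨p, hp, rfl⟩ := hx; exact h p hp
  | zero => exact ⟨0, Submodule.zero_mem _, by simpa using isBigO_zero _ _⟩
  | add x y _ _ hx hy =>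
    obtain ⟨P, hP, hP'⟩ := hx
    obtain ⟨Q, hQ, hQ'⟩ := hy
    refine ⟨P + Q, Submodule.add_mem _ hP hQ, (hP'.add hQ').congr_left fun N => ?_⟩
    simp only [Pi.add_apply]; ring
  | smul a x _ hx =>
    obtain ⟨P, hP, hP'⟩ := hx
    refine ⟨a • P, Submodule.smul_mem _ _ hP, (hP'.const_mul_left a).congr_left fun N => ?_⟩
    simp only [Pi.smul_apply, smul_eq_mul]; ring

/-- Induction on the number `M` of orders still to be gained. Differencing `N ^ (α+1) * (log N) ^ k`
reproduces a multiple of `N ^ α * (log N) ^ k` up to a lower logarithmic power and exponents `α - 1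
- j`, to which the induction hypothesis applies. For `M = 0` the term itself is negligible. -/
theorem exists_antidifference_aux (K : ℝ) (M : ℕ) : ∀ α : ℂ, α.re + K < M → ∀ k : ℕ,
    ∃ P ∈ Submodule.span ℂ (powLog '' {p | ∃ j i : ℕ, p = (α + 1 - j, i)}),
      (fun N => powLog (α, k) N - (P (N + 1) - P N)) =O[atTop] fun N : ℕ => (N : ℝ) ^ (-K) := by
  induction M with
  | zero =>
    intro α hα k
    refine ⟨0, Submodule.zero_mem _, ?_⟩
    simpa using isBigO_powLog (α, k) (K := -K) (by simp at hα ⊢; linarith)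
  | succ M ih =>
    intro α hα
    have hlow : ∀ u ∈ expansions {p : ℂ × ℕ | ∃ j i : ℕ, p = (α - 1 - j, i)},
        ∃ P ∈ Submodule.span ℂ (powLog '' {p | ∃ j i : ℕ, p = (α + 1 - j, i)}),
        (fun N => u N - (P (N + 1) - P N)) =O[atTop] fun N : ℕ => (N : ℝ) ^ (-K) := by
      intro u hu
      obtain ⟨f, hf, hf'⟩ := hu K
      obtain ⟨P, hP, hP'⟩ := exists_antidifference_of_span (K := K)
        (T' := {p | ∃ j i : ℕ, p = (α + 1 - j, i)}) (fun p hp => by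
          obtain ⟨j, i, rfl⟩ := hp
          obtain ⟨P, hP, hP'⟩ := ih (α - 1 - j) (by
            push_cast at hα
            simp
            have : (0 : ℝ) ≤ j := Nat.cast_nonneg j
            linarith) i
          refine ⟨P, Submodule.span_mono (Set.image_mono ?_) hP, hP'⟩
          rintro _ ⟨j', i', rfl⟩
          exact ⟨j + 1 + j', i', by push_cast; ring_nf⟩) hf
      refine ⟨P, hP, (hf'.add hP').congr_left fun N => ?_⟩
      ring
    have hmem : ∀ k, powLog (α + 1, k) ∈
        Submodule.span ℂ (powLog '' {p | ∃ j i : ℕ, p = (α + 1 - j, i)}) := fun k =>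
      Submodule.subset_span ⟨_, ⟨0, k, by simp⟩, rfl⟩
    -- At `α = -1` the leading coefficient `α + 1` vanishes and the antidifference starts with `(log
    -- N) ^ (k+1) / (k+1)`. Otherwise it starts with `N ^ (α+1) * (log N) ^ k / (α+1)`, and the term
    -- with one logarithm less is removed by induction on `k`.
    by_cases hα1 : α + 1 = 0
    · intro k
      obtain ⟨P, hP, hP'⟩ := hlow _ (powLog_difference_mem_expansions α (k + 1))
      have hk : (k : ℂ) + 1 ≠ 0 := Nat.cast_add_one_ne_zero k
      refine ⟨((k : ℂ) + 1)⁻¹ • (powLog (α + 1, k + 1) - P), Submodule.smul_mem _ _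
        (Submodule.sub_mem _ (hmem _) hP), (hP'.const_mul_left (-((k : ℂ) + 1)⁻¹)).congr_left
        fun N => ?_⟩
      simp only [Pi.smul_apply, Pi.sub_apply, smul_eq_mul, Nat.add_sub_cancel]
      push_cast
      linear_combination powLog (α, k) N * (mul_inv_cancel₀ hk) +
        ((k : ℂ) + 1)⁻¹ * powLog (α, k + 1) N * hα1
    · intro k
      induction k with
      | zero =>
        obtain ⟨P, hP, hP'⟩ := hlow _ (powLog_difference_mem_expansions α 0)
        refine ⟨(α + 1)⁻¹ • (powLog (α + 1, 0) - P), Submodule.smul_mem _ _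
          (Submodule.sub_mem _ (hmem _) hP), (hP'.const_mul_left (-(α + 1)⁻¹)).congr_left
          fun N => ?_⟩
        simp only [Pi.smul_apply, Pi.sub_apply, smul_eq_mul]
        push_cast
        linear_combination powLog (α, 0) N * (mul_inv_cancel₀ hα1)
      | succ k ihk =>
        obtain ⟨P, hP, hP'⟩ := hlow _ (powLog_difference_mem_expansions α (k + 1))
        obtain ⟨Q, hQ, hQ'⟩ := ihk
        refine ⟨(α + 1)⁻¹ • (powLog (α + 1, k + 1) - P - ((k : ℂ) + 1) • Q),
          Submodule.smul_mem _ _ (Submodule.sub_mem _ (Submodule.sub_mem _ (hmem _) hP)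
            (Submodule.smul_mem _ _ hQ)),
          ((hP'.add (hQ'.const_mul_left ((k : ℂ) + 1))).const_mul_left (-(α + 1)⁻¹)).congr_left
          fun N => ?_⟩
        simp only [Pi.smul_apply, Pi.sub_apply, smul_eq_mul, Nat.add_sub_cancel]
        push_cast
        linear_combination powLog (α, k + 1) N * (mul_inv_cancel₀ hα1)

/-- Up to any order, `N ^ α * (log N) ^ k` is a difference of terms `N ^ (α + 1 - j) (log N) ^ i`. -/
theorem exists_antidifference (p : ℂ × ℕ) (K : ℝ) :
    ∃ P ∈ Submodule.span ℂ (powLog '' {q | ∃ j i : ℕ, q = (p.1 + 1 - j, i)}),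
      (fun N => powLog p N - (P (N + 1) - P N)) =O[atTop] fun N : ℕ => (N : ℝ) ^ (-K) :=
  let ⟨M, hM⟩ := exists_nat_gt (p.1.re + K)
  exists_antidifference_aux K M p.1 hM p.2

/-- The constant is the sum of the series. Its tail is controlled by `(i+N) ^ (-K-2) ≤ N ^ (-K) *
(i+1) ^ (-2)` for `N ≥ 1`. -/
theorem exists_sum_range_sub_isBigO {r : ℕ → ℂ} {K : ℝ} (hK : 0 ≤ K)
    (hr : r =O[atTop] fun N : ℕ => (N : ℝ) ^ (-(K + 2))) :
    ∃ c, (fun N => ∑ m ∈ Finset.range N, r m - c) =O[atTop] fun N : ℕ => (N : ℝ) ^ (-K) := by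
  have hs : Summable r := summable_of_isBigO_nat (Real.summable_nat_rpow.2 (by linarith)) hr
  obtain ⟨c, hc, hb⟩ := hr.exists_pos
  rw [IsBigOWith, eventually_atTop] at hb
  obtain ⟨N₀, hb⟩ := hb
  have hs2 : Summable fun i : ℕ => ((i : ℝ) + 1) ^ (-2 : ℝ) := by
    have := (summable_nat_add_iff 1).2 (Real.summable_nat_rpow.2 (by norm_num : (-2 : ℝ) < -1))
    simpa using this
  refine ⟨∑' m, r m, IsBigO.of_bound (c * ∑' i : ℕ, ((i : ℝ) + 1) ^ (-2 : ℝ))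
    ((eventually_ge_atTop (max N₀ 1)).mono fun N hN => ?_)⟩
  have hN1 : 1 ≤ N := le_of_max_le_right hN
  have hN1' : (1 : ℝ) ≤ N := by exact_mod_cast hN1
  have e : ∑ m ∈ Finset.range N, r m - ∑' m, r m = -∑' i, r (i + N) := by
    rw [← hs.sum_add_tsum_nat_add N]; ring
  rw [e, norm_neg, Real.norm_of_nonneg (by positivity), mul_right_comm, ← tsum_mul_left]
  refine tsum_of_norm_bounded (hs2.mul_left _).hasSum fun i => ?_
  refine (hb (i + N) (le_trans (le_of_max_le_left hN) (Nat.le_add_left _ _))).trans ?_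
  have hiN : (0 : ℝ) < ((i + N : ℕ) : ℝ) := by positivity
  rw [Real.norm_of_nonneg (by positivity), mul_assoc]
  refine mul_le_mul_of_nonneg_left ?_ hc.le
  rw [neg_add, Real.rpow_add hiN]
  refine mul_le_mul ?_ ?_ (by positivity) (by positivity)
  · exact Real.rpow_le_rpow_of_nonpos (by linarith) (by push_cast; linarith [Nat.cast_nonneg (α := ℝ) i])
      (by linarith)
  · exact Real.rpow_le_rpow_of_nonpos (by positivity) (by push_cast; linarith) (by norm_num)

/-- The approximate antidifference telescopes to `P N - P 0`, and the error terms have a convergent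
sum. That sum and `-P 0` form the new constant, whence the inserted pair `(0, 0)`. -/
theorem sum_range_mem_expansions {T T' : Set (ℂ × ℕ)} {u : ℕ → ℂ} (hu : u ∈ expansions T)
    (hT : ∀ p ∈ T, ∀ j i : ℕ, (p.1 + 1 - j, i) ∈ T') :
    (fun N => ∑ m ∈ Finset.range N, u m) ∈ expansions (insert (0, 0) T') := by
  intro K
  obtain ⟨f, hf, hf'⟩ := hu (max K 0 + 2)
  obtain ⟨P, hP, hP'⟩ := exists_antidifference_of_span (K := max K 0 + 2) (T' := T')
    (fun p hp => by
      obtain ⟨P, hP, hP'⟩ := exists_antidifference p (max K 0 + 2)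
      refine ⟨P, Submodule.span_mono (Set.image_mono ?_) hP, hP'⟩
      rintro _ ⟨j, i, rfl⟩
      exact hT p hp j i) hf
  obtain ⟨c, hc⟩ := exists_sum_range_sub_isBigO (le_max_right K 0) (hf'.add hP')
  refine ⟨P + (c - P 0) • powLog (0, 0), Submodule.add_mem _
    (Submodule.span_mono (Set.image_mono (Set.subset_insert _ _)) hP)
    (Submodule.smul_mem _ _ (Submodule.subset_span ⟨_, Set.mem_insert _ _, rfl⟩)), ?_⟩
  refine (hc.trans (isBigO_rpow_natCast (neg_le_neg (le_max_left K 0)))).congr_left fun N => ?_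
  have e : ∑ m ∈ Finset.range N, (u m - f m + (f m - (P (m + 1) - P m))) =
      ∑ m ∈ Finset.range N, u m - (P N - P 0) := by
    rw [← Finset.sum_range_sub, ← Finset.sum_sub_distrib]
    exact Finset.sum_congr rfl fun m _ => by ring
  simp only [Pi.add_apply, Pi.smul_apply, smul_eq_mul, powLog]
  rw [e]
  simp only [Complex.cpow_zero, pow_zero, mul_one]
  ring

/-- The truncated nested sum, for a list of pairs (shift, exponent), outermost summation first. -/
noncomputable def nsum : List (ℝ × ℂ) → ℕ → ℂ
  | [], _ => 1
  | (v, s) :: L, N => ∑ m ∈ Finset.range N, ((m : ℂ) + ((1 + v : ℝ) : ℂ)) ^ s * nsum L m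

/-- The exponents occurring in the asymptotic expansion of a nested sum. -/
def sumExponents : List (ℝ × ℂ) → Set ℂ
  | [] => ∅
  | (_, s) :: L => {α | ∃ k : ℕ, α = s + 1 - k ∨ ∃ β ∈ sumExponents L, α = β + s + 1 - k}

theorem nsum_mem_expansions (L : List (ℝ × ℂ)) (hL : ∀ p ∈ L, 0 ≤ p.1) :
    nsum L ∈ expansions (insert (0, 0) {p | p.1 ∈ sumExponents L}) := by
  induction L with
  | nil =>
    refine expansions_congr (powLog_mem_expansions (p := (0, 0)) (Set.mem_insert _ _))
      (Eventually.of_forall fun N => ?_)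
    simp [powLog, nsum]
  | cons a L ih =>
    obtain ⟨v, s⟩ := a
    have hv : 0 ≤ v := hL (v, s) List.mem_cons_self
    refine sum_range_mem_expansions (cpow_mul_mem_expansions
      (ih fun p hp => hL p (List.mem_cons_of_mem _ hp)) (w := 1 + v) (by linarith) s) ?_
    rintro _ ⟨q, hq, j, rfl⟩ j' i
    simp only [Set.mem_ofPred_eq, sumExponents]
    refine ⟨j + j', ?_⟩
    rcases hq with rfl | hq
    · left; push_cast; ring
    · right; exact ⟨q.1, hq, by push_cast; ring⟩

/-- Off the polar hyperplanes the finite part of a nested sum exists. -/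
theorem exists_hasFinitePart_nsum (L : List (ℝ × ℂ)) (hL : ∀ p ∈ L, 0 ≤ p.1)
    (h0 : (0 : ℂ) ∉ sumExponents L) : ∃ c, HasFinitePart (nsum L) c := by
  obtain ⟨f, hf, hf'⟩ := nsum_mem_expansions L hL 1
  have hlim : Tendsto (fun N => nsum L N - f N) atTop (𝓝 0) :=
    hf'.trans_tendsto ((tendsto_rpow_neg_atTop one_pos).comp tendsto_natCast_atTop_atTop)
  rw [Set.image_insert_eq, Submodule.mem_span_insert] at hf
  obtain ⟨c, g, hg, rfl⟩ := hf
  refine ⟨c, hasFinitePart_iff.2 ⟨g, Submodule.span_mono (Set.image_mono ?_) hg, ?_⟩⟩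
  · rintro p hp rfl
    exact h0 hp
  · have := hlim.add_const c
    rw [zero_add] at this
    refine this.congr fun N => ?_
    simp only [Pi.add_apply, Pi.smul_apply, smul_eq_mul, powLog]
    simp only [Complex.cpow_zero, pow_zero, mul_one]
    ring

/-- The finite part of `(N + w) ^ s` times a nested sum is zero off the polar hyperplanes. -/
theorem hasFinitePart_cpow_mul_nsum (L : List (ℝ × ℂ)) (hL : ∀ p ∈ L, 0 ≤ p.1) {w v : ℝ}
    (hw : 0 ≤ w) (s : ℂ) (n : ℕ) (h0 : (0 : ℂ) ∉ sumExponents ((v, s) :: L)) :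
    HasFinitePart (fun N : ℕ => ((N : ℂ) + (w : ℂ)) ^ (s + 1 - n) * nsum L N) 0 := by
  refine hasFinitePart_zero_of_mem_expansions ?_
    (cpow_mul_mem_expansions (nsum_mem_expansions L hL) hw (s + 1 - n))
  rintro ⟨q, hq, j, h⟩
  simp only [Prod.mk.injEq] at h
  refine h0 ?_
  simp only [Set.mem_ofPred_eq, sumExponents]
  refine ⟨n + j, ?_⟩
  rcases hq with rfl | hq
  · left; rw [h.1]; push_cast; ring
  · right; exact ⟨q.1, hq, by rw [h.1]; push_cast; ring⟩

/-! ### Binomial coefficients and uniform remainders of the binomial series -/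

/-- The binomial coefficient `s (s - 1) ⋯ (s - k + 1) / k!`. -/
noncomputable def binom (s : ℂ) (k : ℕ) : ℂ := (∏ i ∈ Finset.range k, (s - i)) / (k.factorial : ℂ)

theorem binom_zero_right (s : ℂ) : binom s 0 = 1 := by simp [binom]

theorem binom_natCast (n k : ℕ) : binom (n : ℂ) k = (n.choose k : ℂ) := by
  have h : ∏ i ∈ Finset.range k, ((n : ℂ) - i) = (n.descFactorial k : ℂ) := by
    rw [← descPochhammer_eval_eq_prod_range, descPochhammer_eval_eq_descFactorial]
  rw [binom, h, Nat.choose_eq_descFactorial_div_factorial,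
    Nat.cast_div (Nat.factorial_dvd_descFactorial n k) (by exact_mod_cast k.factorial_ne_zero)]

theorem binom_eq_choose (s : ℂ) (k : ℕ) : binom s k = Ring.choose s k := by
  have h : (descPochhammer ℤ k).smeval s = ∏ i ∈ Finset.range k, (s - i) := by
    induction k with
    | zero => simp
    | succ k ih =>
      rw [Finset.prod_range_succ, ← ih]
      simp [descPochhammer_succ_right, Polynomial.smeval_mul, Polynomial.smeval_natCast]
  rw [Ring.choose_eq_smul, binom, h, smul_eq_mul, div_eq_inv_mul]

theorem binom_mul_choose (s : ℂ) (j i : ℕ) :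
    binom s (j + i) * ((j + i).choose j : ℂ) = binom s j * binom (s - j) i := by
  have h := Nat.choose_mul_factorial_mul_factorial (Nat.le_add_right j i)
  rw [Nat.add_sub_cancel_left] at h
  have h' : ((j + i).choose j : ℂ) * (j.factorial : ℂ) * (i.factorial : ℂ) =
    ((j + i).factorial : ℂ) := by exact_mod_cast h
  have h1 : (j.factorial : ℂ) ≠ 0 := by exact_mod_cast j.factorial_ne_zero
  have h2 : (i.factorial : ℂ) ≠ 0 := by exact_mod_cast i.factorial_ne_zero
  have h3 : ((j + i).factorial : ℂ) ≠ 0 := by exact_mod_cast (j + i).factorial_ne_zero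
  simp only [binom]
  rw [Finset.prod_range_add, div_mul_div_comm, div_mul_eq_mul_div, div_eq_div_iff h3
    (mul_ne_zero h1 h2), ← h']
  have : ∀ x ∈ Finset.range i, s - ((j + x : ℕ) : ℂ) = s - j - x := fun x _ => by push_cast; ring
  rw [Finset.prod_congr rfl this]
  ring

theorem binom_succ_mul (s : ℂ) (k : ℕ) : binom (s + 1) (k + 1) * (k + 1) = (s + 1) * binom s k := by
  have := binom_mul_choose (s + 1) 1 k
  rw [Nat.choose_one_right, add_comm 1 k] at this
  push_cast at this
  rw [this]
  simp [binom]

/-- A bound for `binom s k`, uniform in `‖s‖ ≤ M`. -/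
noncomputable def binomBound (M k : ℕ) : ℝ :=
  (∏ i ∈ Finset.range k, ((M : ℝ) + i)) / (k.factorial : ℝ)

theorem binomBound_nonneg (M k : ℕ) : 0 ≤ binomBound M k := by unfold binomBound; positivity

theorem norm_binom_le {s : ℂ} {M : ℕ} (hs : ‖s‖ ≤ M) (k : ℕ) : ‖binom s k‖ ≤ binomBound M k := by
  rw [binom, binomBound, norm_div, Complex.norm_natCast, norm_prod]
  gcongr with i
  refine (norm_sub_le _ _).trans ?_
  rw [Complex.norm_natCast]
  gcongr

theorem hasSum_binom (s : ℂ) {t : ℂ} (ht : ‖t‖ < 1) :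
    HasSum (fun k => binom s k * t ^ k) ((1 + t) ^ s) := by
  have h := (Complex.one_add_cpow_hasFPowerSeriesOnBall_zero (a := s)).hasSum (y := t)
    (by simpa [Metric.mem_eball, edist_zero_right, ← ofReal_norm] using ht)
  rw [zero_add] at h
  refine h.congr_fun fun k => ?_
  rw [binomialSeries_apply, binom_eq_choose]
  simp

theorem summable_binomBound (M : ℕ) : Summable fun k => binomBound M k * (1 / 2 : ℝ) ^ k := by
  have h := (hasSum_binom (-(M : ℂ)) (t := (-(1 / 2 : ℝ) : ℝ)) (by
    rw [Complex.norm_real]; norm_num)).summable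
  have e : ∀ k, binom (-(M : ℂ)) k * (((-(1 / 2 : ℝ) : ℝ)) : ℂ) ^ k =
      ((binomBound M k * (1 / 2 : ℝ) ^ k : ℝ) : ℂ) := by
    intro k
    have h1 : ∏ i ∈ Finset.range k, (-(M : ℂ) - i) = (-1) ^ k * ∏ i ∈ Finset.range k, ((M : ℂ) + i) := by
      rw [← Finset.card_range k, ← Finset.prod_const, Finset.card_range, ← Finset.prod_mul_distrib]
      exact Finset.prod_congr rfl fun i _ => by ring
    rw [binom, binomBound, h1]
    push_cast
    rw [neg_pow (1 / 2 : ℂ) k]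
    have : ((-1 : ℂ)) ^ k * (-1) ^ k = 1 := by rw [← mul_pow]; simp
    linear_combination ((∏ i ∈ Finset.range k, ((M : ℂ) + i)) / (k.factorial : ℂ) * (1 / 2) ^ k) * this
  simp only [e] at h
  exact Complex.summable_ofReal.1 h

/-- The remainder of the binomial series. -/
noncomputable def binomRem (K : ℕ) (s t : ℂ) : ℂ :=
  (1 + t) ^ s - ∑ k ∈ Finset.range K, binom s k * t ^ k

/-- The bound is uniform in `s` because `binom s k` is dominated by the coefficients of `(1 - t) ^
(-M)`, a series still convergent at `t = 1/2`. -/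
theorem exists_norm_binomRem_le (M K : ℕ) : ∃ C : ℝ, 0 ≤ C ∧ ∀ s t : ℂ, ‖s‖ ≤ M → ‖t‖ ≤ 1 / 2 →
    ‖binomRem K s t‖ ≤ C * ‖t‖ ^ K := by
  have hs := (summable_nat_add_iff K).2 (summable_binomBound M)
  have hs' : Summable fun k => binomBound M (k + K) * (1 / 2 : ℝ) ^ k := by
    refine (hs.mul_left (2 ^ K)).congr fun k => ?_
    rw [pow_add]
    have : (2 : ℝ) ^ K * (1 / 2) ^ K = 1 := by rw [← mul_pow]; norm_num
    linear_combination (binomBound M (k + K) * (1 / 2) ^ k) * this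
  refine ⟨∑' k, binomBound M (k + K) * (1 / 2 : ℝ) ^ k,
    tsum_nonneg fun k => mul_nonneg (binomBound_nonneg _ _) (by positivity), fun s t h1 h2 => ?_⟩
  have h := hasSum_binom s (t := t) (lt_of_le_of_lt h2 (by norm_num))
  have e : binomRem K s t = ∑' k, binom s (k + K) * t ^ (k + K) := by
    rw [binomRem, ← h.tsum_eq, ← h.summable.sum_add_tsum_nat_add K]; ring
  rw [e, ← tsum_mul_right]
  refine tsum_of_norm_bounded (hs'.mul_right _).hasSum fun k => ?_
  rw [norm_mul, norm_pow, pow_add, ← mul_assoc]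
  gcongr
  · exact binomBound_nonneg _ _
  · exact norm_binom_le h1 _

theorem binomRem_natCast {n K : ℕ} (h : n < K) (t : ℂ) : binomRem K n t = 0 := by
  have h1 : ∑ k ∈ Finset.range K, binom n k * t ^ k = ∑ k ∈ Finset.range (n + 1), binom n k * t ^ k := by
    refine (Finset.sum_subset (Finset.range_mono h) fun k _ hk => ?_).symm
    rw [binom_natCast, Nat.choose_eq_zero_of_lt (by simpa using hk)]; simp
  rw [binomRem, h1, Complex.cpow_natCast, add_comm 1 t, add_pow, sub_eq_zero]
  exact Finset.sum_congr rfl fun k _ => by rw [binom_natCast]; ring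

/-! ### Bernoulli polynomials and the Euler–Maclaurin defect -/

/-- The value of the `j`-th Bernoulli polynomial at a real number. -/
noncomputable def bernVal (j : ℕ) (w : ℝ) : ℂ := Polynomial.aeval (w : ℂ) (Polynomial.bernoulli j)

/-- This identity cancels the term of order `x ^ (s-k)` in the Euler–Maclaurin defect, for each `k <
J`. -/
theorem sum_choose_mul_bernVal (k : ℕ) (w : ℝ) :
    ∑ j ∈ Finset.range (k + 1), ((k + 1).choose j : ℂ) * bernVal j w = (k + 1) * (w : ℂ) ^ k := by
  have := congrArg (Polynomial.aeval (w : ℂ)) (Polynomial.sum_bernoulli k)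
  rw [map_sum, Polynomial.aeval_monomial] at this
  simpa [bernVal, Algebra.smul_def] using this

/-- The defect of the Euler–Maclaurin approximate antidifference of `x ↦ (s + 1) (x + w) ^ s`. -/
noncomputable def emRem (J : ℕ) (s : ℂ) (w x : ℝ) : ℂ :=
  (s + 1) * ((x + w : ℝ) : ℂ) ^ s - ∑ j ∈ Finset.range J, binom (s + 1) j * bernVal j w *
    (((x + 1 : ℝ) : ℂ) ^ (s + 1 - j) - (x : ℂ) ^ (s + 1 - j))

theorem ofReal_add_cpow {x w : ℝ} (hx : 0 < x) (hw : 0 ≤ x + w) (s : ℂ) :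
    ((x + w : ℝ) : ℂ) ^ s = (x : ℂ) ^ s * (1 + (w / x : ℝ)) ^ s := by
  have e : x + w = x * (1 + w / x) := by field_simp
  have h : 0 ≤ 1 + w / x := by
    rw [e] at hw
    exact nonneg_of_mul_nonneg_right hw hx
  rw [e, Complex.ofReal_mul, Complex.mul_cpow_ofReal_nonneg hx.le h]
  push_cast
  rfl

/-- Expanding in `1/x`, the terms of order `x ^ (s-k)` with `k < J` cancel by the Bernoulli identity
and only binomial remainders are left. The order is `J - j + 1` in the `j`-th one, since its zeroth
binomial term is the subtracted `x ^ (s+1-j)`. -/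
theorem emRem_eq (J : ℕ) (s : ℂ) {w x : ℝ} (hx : 0 < x) (hw : 0 ≤ x + w) :
    emRem J s w x = (s + 1) * (x : ℂ) ^ s * binomRem J s (w / x : ℝ) -
      ∑ j ∈ Finset.range J, binom (s + 1) j * bernVal j w * (x : ℂ) ^ (s + 1 - j) *
        binomRem (J - j + 1) (s + 1 - j) (1 / x : ℝ) := by
  have hx0 : (x : ℂ) ≠ 0 := by exact_mod_cast hx.ne'
  have key : ∑ k ∈ Finset.range J, (s + 1) * (x : ℂ) ^ s * (binom s k * ((w / x : ℝ) : ℂ) ^ k) =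
      ∑ j ∈ Finset.range J, ∑ i ∈ Finset.range (J - j), binom (s + 1) j * bernVal j w *
        (x : ℂ) ^ (s + 1 - j) * (binom (s + 1 - j) (i + 1) * ((1 / x : ℝ) : ℂ) ^ (i + 1)) := by
    rw [← Finset.sum_range_diag_flip J fun j i => binom (s + 1) j * bernVal j w *
        (x : ℂ) ^ (s + 1 - j) * (binom (s + 1 - j) (i + 1) * ((1 / x : ℝ) : ℂ) ^ (i + 1))]
    refine Finset.sum_congr rfl fun k _ => ?_
    have h1 : ∀ j ∈ Finset.range (k + 1), binom (s + 1) j * bernVal j w *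
        (x : ℂ) ^ (s + 1 - j) * (binom (s + 1 - j) (k - j + 1) * ((1 / x : ℝ) : ℂ) ^ (k - j + 1)) =
        binom (s + 1) (k + 1) * (x : ℂ) ^ s * ((1 / x : ℝ) : ℂ) ^ k *
          (((k + 1).choose j : ℂ) * bernVal j w) := by
      intro j hj
      have hj : j ≤ k := by have := Finset.mem_range.1 hj; omega
      have h2 := binom_mul_choose (s + 1) j (k - j + 1)
      have e : j + (k - j + 1) = k + 1 := by omega
      rw [e] at h2
      have h3 : (x : ℂ) ^ (s + 1 - j) * ((1 / x : ℝ) : ℂ) ^ (k - j + 1) =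
          (x : ℂ) ^ s * ((1 / x : ℝ) : ℂ) ^ k := by
        rw [Complex.cpow_sub _ _ hx0, Complex.cpow_add _ _ hx0, Complex.cpow_one,
          Complex.cpow_natCast]
        push_cast
        rw [one_div, inv_pow, inv_pow]
        have : (x : ℂ) ^ (k - j + 1) * (x : ℂ) ^ j = (x : ℂ) ^ k * x := by
          rw [← pow_add, ← pow_succ]; congr 1; omega
        field_simp
        linear_combination (-(x : ℂ) ^ s) * this
      linear_combination (bernVal j w * (binom (s + 1 - j) (k - j + 1)) * binom (s + 1) j) * h3 -
        (bernVal j w * (x : ℂ) ^ s * ((1 / x : ℝ) : ℂ) ^ k) * h2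
    rw [Finset.sum_congr rfl h1, ← Finset.mul_sum, sum_choose_mul_bernVal]
    have h4 := binom_succ_mul s k
    have h5 : ((w / x : ℝ) : ℂ) ^ k = (w : ℂ) ^ k * ((1 / x : ℝ) : ℂ) ^ k := by
      rw [← mul_pow]; congr 1; push_cast; ring
    rw [h5]
    linear_combination (-(x : ℂ) ^ s * (w : ℂ) ^ k * ((1 / x : ℝ) : ℂ) ^ k) * h4
  have h6 : ∀ j ∈ Finset.range J, binom (s + 1) j * bernVal j w * (x : ℂ) ^ (s + 1 - j) *
        binomRem (J - j + 1) (s + 1 - j) (1 / x : ℝ) =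
      binom (s + 1) j * bernVal j w *
        (((x + 1 : ℝ) : ℂ) ^ (s + 1 - j) - (x : ℂ) ^ (s + 1 - j)) -
      ∑ i ∈ Finset.range (J - j), binom (s + 1) j * bernVal j w *
        (x : ℂ) ^ (s + 1 - j) * (binom (s + 1 - j) (i + 1) * ((1 / x : ℝ) : ℂ) ^ (i + 1)) := by
    intro j _
    rw [← Finset.mul_sum, ofReal_add_cpow hx (by linarith), binomRem, Finset.sum_range_succ',
      binom_zero_right]
    ring
  rw [Finset.sum_congr rfl h6, Finset.sum_sub_distrib, ← key, emRem, ofReal_add_cpow hx hw,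
    binomRem, ← Finset.mul_sum]
  ring

/-- The Euler–Maclaurin approximation is exact for polynomials. -/
theorem emRem_natCast_sub_one {J b : ℕ} (hJ : b < J) {w x : ℝ} (hx : 0 < x) (hw : 0 ≤ x + w) :
    emRem J ((b : ℂ) - 1) w x = 0 := by
  rw [emRem_eq J _ hx hw, sub_add_cancel]
  have h1 : (b : ℂ) * (x : ℂ) ^ ((b : ℂ) - 1) * binomRem J ((b : ℂ) - 1) (w / x : ℝ) = 0 := by
    rcases Nat.eq_zero_or_pos b with rfl | hb
    · simp
    · have : (b : ℂ) - 1 = ((b - 1 : ℕ) : ℂ) := by push_cast [Nat.cast_sub hb]; ring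
      rw [this, binomRem_natCast (by omega), mul_zero]
  rw [h1, zero_sub, neg_eq_zero]
  refine Finset.sum_eq_zero fun j _ => ?_
  rcases le_or_gt j b with hj | hj
  · have : (b : ℂ) - j = ((b - j : ℕ) : ℂ) := by push_cast [Nat.cast_sub hj]; ring
    rw [this, binomRem_natCast (by omega), mul_zero]
  · rw [binom_natCast, Nat.choose_eq_zero_of_lt hj]
    simp

/-- Each remainder in `emRem_eq`, with its prefactor, has order `x ^ (s-J)`. The condition on `x`
brings `w/x` and `1/x` into the disc of radius `1/2`. -/
theorem exists_norm_emRem_le (M J : ℕ) (w : ℝ) : ∃ C : ℝ, 0 ≤ C ∧ ∀ s : ℂ, ‖s‖ ≤ M →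
    ∀ x : ℝ, 2 * |w| + 2 ≤ x → ‖emRem J s w x‖ ≤ C * x ^ (s.re - J) := by
  obtain ⟨C₀, hC₀, h₀⟩ := exists_norm_binomRem_le M J
  choose C hC h using fun j => exists_norm_binomRem_le (M + 1 + J) (J - j + 1)
  refine ⟨(M + 1) * C₀ * |w| ^ J +
    ∑ j ∈ Finset.range J, binomBound (M + 1) j * ‖bernVal j w‖ * C j, ?_, fun s hs x hx => ?_⟩
  · have := fun j => binomBound_nonneg (M + 1) j
    have : 0 ≤ ∑ j ∈ Finset.range J, binomBound (M + 1) j * ‖bernVal j w‖ * C j :=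
      Finset.sum_nonneg fun j _ => mul_nonneg (mul_nonneg (this j) (norm_nonneg _)) (hC j)
    positivity
  have hw0 := abs_nonneg w
  have hx0 : 0 < x := by linarith
  have hxw : 0 ≤ x + w := by linarith [neg_abs_le w]
  have hs1 : ‖s + 1‖ ≤ M + 1 := (norm_add_le _ _).trans (by simpa using hs)
  have hpow : ∀ a : ℂ, ∀ k : ℕ, a.re - k = s.re - J → ‖(x : ℂ) ^ a‖ * (1 / x) ^ k =
      x ^ (s.re - J) := by
    intro a k hak
    rw [Complex.norm_cpow_eq_rpow_re_of_pos hx0, ← hak, Real.rpow_sub hx0, Real.rpow_natCast,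
      one_div, inv_pow, div_eq_mul_inv]
  rw [emRem_eq J s hx0 hxw, add_mul (_ * |w| ^ J), Finset.sum_mul]
  refine (norm_sub_le _ _).trans (add_le_add ?_ ((norm_sum_le _ _).trans
    (Finset.sum_le_sum fun j hj => ?_)))
  · have h1 := h₀ s (w / x : ℝ) hs (by
      rw [Complex.norm_real, Real.norm_eq_abs, abs_div, abs_of_pos hx0, div_le_iff₀ hx0]
      linarith)
    rw [Complex.norm_real, Real.norm_eq_abs, abs_div, abs_of_pos hx0, div_eq_mul_one_div |w| x,
      mul_pow] at h1
    rw [norm_mul, norm_mul, ← hpow s J rfl]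
    calc ‖s + 1‖ * ‖(x : ℂ) ^ s‖ * ‖binomRem J s (w / x : ℝ)‖
        ≤ (M + 1) * ‖(x : ℂ) ^ s‖ * (C₀ * (|w| ^ J * (1 / x) ^ J)) := by gcongr
      _ = _ := by ring
  · have hj := Finset.mem_range.1 hj
    have h1 := h j (s + 1 - j) (1 / x : ℝ) (by
        refine (norm_sub_le _ _).trans ?_
        rw [Complex.norm_natCast]
        push_cast
        have : (j : ℝ) ≤ J := by exact_mod_cast hj.le
        linarith) (by
      rw [Complex.norm_real, Real.norm_of_nonneg (by positivity), div_le_div_iff₀ hx0 two_pos]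
      linarith)
    rw [Complex.norm_real, Real.norm_of_nonneg (by positivity)] at h1
    have h2 : ‖binom (s + 1) j‖ ≤ binomBound (M + 1) j := norm_binom_le (by push_cast; exact hs1) j
    rw [norm_mul, norm_mul, norm_mul, ← hpow (s + 1 - j) (J - j + 1) (by
      push_cast [Nat.cast_sub hj.le]
      simp
      ring)]
    have h3 := binomBound_nonneg (M + 1) j
    calc ‖binom (s + 1) j‖ * ‖bernVal j w‖ * ‖(x : ℂ) ^ (s + 1 - j)‖ *
          ‖binomRem (J - j + 1) (s + 1 - j) (1 / x : ℝ)‖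
        ≤ binomBound (M + 1) j * ‖bernVal j w‖ * ‖(x : ℂ) ^ (s + 1 - j)‖ *
          (C j * (1 / x) ^ (J - j + 1)) := by gcongr
      _ = _ := by ring

/-! ### Analytic maps into the space of bounded sequences -/

open BoundedContinuousFunction

/-- The bounded sequence with given values. -/
noncomputable def boundedSeq (φ : ℕ → ℂ) (C : ℝ) (h : ∀ n, ‖φ n‖ ≤ C) : ℕ →ᵇ ℂ :=
  BoundedContinuousFunction.ofNormedAddCommGroup φ continuous_of_discreteTopology C h

theorem boundedSeq_apply (φ : ℕ → ℂ) (C : ℝ) (h : ∀ n, ‖φ n‖ ≤ C) (n : ℕ) :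
    boundedSeq φ C h n = φ n := rfl

/-- Cauchy's estimate on discs of radius `r/2` bounds the derivative. The Lipschitz constant depends
only on `C` and `r`, hence serves a whole sequence of functions at once. -/
theorem norm_sub_le_of_norm_le_on_ball {f : ℂ → ℂ} {s₀ : ℂ} {r C : ℝ} (hr : 0 < r)
    (hf : DifferentiableOn ℂ f (Metric.ball s₀ (2 * r)))
    (hC : ∀ s ∈ Metric.ball s₀ (2 * r), ‖f s‖ ≤ C) {x y : ℂ} (hx : x ∈ Metric.ball s₀ r)
    (hy : y ∈ Metric.ball s₀ r) : ‖f y - f x‖ ≤ C / (r / 2) * ‖y - x‖ := by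
  have hsub : ∀ z ∈ Metric.ball s₀ r, Metric.closedBall z (r / 2) ⊆ Metric.ball s₀ (2 * r) := by
    intro z hz w hw
    rw [Metric.mem_ball] at *
    rw [Metric.mem_closedBall] at hw
    linarith [dist_triangle w z s₀]
  refine Convex.norm_image_sub_le_of_norm_deriv_le (s := Metric.ball s₀ r) (fun z hz => ?_)
    (fun z hz => ?_) (convex_ball _ _) hx hy
  · exact hf.differentiableAt (Metric.isOpen_ball.mem_nhds
      (hsub z hz (Metric.mem_closedBall_self (by linarith))))
  · refine Complex.norm_deriv_le_of_forall_mem_sphere_norm_le (by linarith) ?_ fun w hw => ?_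
    · refine DifferentiableOn.diffContOnCl_ball (U := Metric.ball s₀ (2 * r)) hf (hsub z hz)
    · exact hC w (hsub z hz (Metric.sphere_subset_closedBall hw))

/-- A uniformly bounded sequence of holomorphic functions is holomorphic as a function with values
in the space of bounded sequences. -/
theorem exists_analyticAt_boundedSeq {f : ℕ → ℂ → ℂ} {s₀ : ℂ} {r C : ℝ} (hr : 0 < r)
    (hf : ∀ n, DifferentiableOn ℂ (f n) (Metric.ball s₀ (2 * r)))
    (hC : ∀ n, ∀ s ∈ Metric.ball s₀ (2 * r), ‖f n s‖ ≤ C) :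
    ∃ Φ : ℂ → (ℕ →ᵇ ℂ), AnalyticAt ℂ Φ s₀ ∧ ∀ᶠ s in 𝓝 s₀, ∀ n, Φ s n = f n s := by
  classical
  have hC0 : 0 ≤ C := (norm_nonneg _).trans (hC 0 s₀ (Metric.mem_ball_self (by linarith)))
  let Ψ : ℂ → (ℕ →ᵇ ℂ) := fun s => if h : s ∈ Metric.ball s₀ (2 * r) then
    boundedSeq (fun n => f n s) C (fun n => hC n s h) else 0
  have hΨ : ∀ s ∈ Metric.ball s₀ (2 * r), ∀ n, Ψ s n = f n s := by
    intro s hs n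
    simp only [Ψ, dif_pos hs, boundedSeq_apply]
  have hsub : Metric.ball s₀ r ⊆ Metric.ball s₀ (2 * r) := Metric.ball_subset_ball (by linarith)
  have hcont : ContinuousOn Ψ (Metric.ball s₀ r) := by
    have : LipschitzOnWith (C / (r / 2)).toNNReal Ψ (Metric.ball s₀ r) := by
      refine LipschitzOnWith.of_dist_le_mul fun x hx y hy => ?_
      rw [Real.coe_toNNReal _ (by positivity), BoundedContinuousFunction.dist_le (by positivity)]
      intro n
      rw [hΨ x (hsub hx), hΨ y (hsub hy), dist_eq_norm, dist_eq_norm]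
      exact norm_sub_le_of_norm_le_on_ball hr (hf n) (hC n) hy hx
    exact this.continuousOn
  let R : NNReal := (r / 2).toNNReal
  have hR : (R : ℝ) = r / 2 := Real.coe_toNNReal _ (by linarith)
  have hR0 : 0 < R := by rw [← NNReal.coe_pos, hR]; linarith
  have hball : Metric.closedBall s₀ R ⊆ Metric.ball s₀ r :=
    Metric.closedBall_subset_ball (by rw [hR]; linarith)
  have hci : CircleIntegrable Ψ s₀ R :=
    (hcont.mono (Metric.sphere_subset_closedBall.trans hball)).circleIntegrable R.2
  -- The Cauchy integral of `Ψ` is analytic. Evaluation at `n` is continuous and linear, so it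
  -- passes under the integral, where the scalar Cauchy formula recovers `f n`.
  refine ⟨_, (hasFPowerSeriesOn_cauchy_integral hci hR0).analyticAt, ?_⟩
  filter_upwards [Metric.ball_mem_nhds s₀ (NNReal.coe_pos.2 hR0)] with w hw n
  have hint : CircleIntegrable (fun z => (z - w)⁻¹ • Ψ z) s₀ R := by
    refine ContinuousOn.circleIntegrable R.2 (ContinuousOn.fun_smul ?_
      (hcont.mono (Metric.sphere_subset_closedBall.trans hball)))
    refine ContinuousOn.inv₀ (by fun_prop) fun z hz hzw => ?_
    rw [sub_eq_zero] at hzw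
    rw [hzw, Metric.mem_sphere] at hz
    exact absurd hz (ne_of_lt (Metric.mem_ball.1 hw))
  have h1 := ContinuousLinearMap.intervalIntegral_comp_comm
    (BoundedContinuousFunction.evalCLM ℂ n : (ℕ →ᵇ ℂ) →L[ℂ] ℂ) hint.out
  have h2 := Complex.two_pi_I_inv_smul_circleIntegral_sub_inv_smul_of_differentiable_on_off_countable
    (f := f n) (s := ∅) Set.countable_empty hw
    ((hf n).continuousOn.mono (hball.trans hsub)) (fun x hx => (hf n).differentiableAt
      (Metric.isOpen_ball.mem_nhds (hsub (hball (Metric.ball_subset_closedBall hx.1)))))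
  rw [← h2, BoundedContinuousFunction.smul_apply]
  congr 1
  have h3 : (∮ z in C(s₀, R), (z - w)⁻¹ • Ψ z) n = ∮ z in C(s₀, R), ((z - w)⁻¹ • Ψ z) n :=
    h1.symm
  rw [h3]
  refine circleIntegral.integral_congr R.2 fun z hz => ?_
  simp only [BoundedContinuousFunction.smul_apply]
  rw [hΨ z (hsub (hball (Metric.sphere_subset_closedBall hz)))]

/-- A linear operator on sequences preserving bounds acts on bounded sequences. -/
theorem exists_clm_of_bound (T : (ℕ → ℂ) →ₗ[ℂ] (ℕ → ℂ)) (B : ℝ)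
    (hT : ∀ φ : ℕ → ℂ, ∀ C : ℝ, (∀ n, ‖φ n‖ ≤ C) → ∀ n, ‖T φ n‖ ≤ B * C) :
    ∃ T' : (ℕ →ᵇ ℂ) →L[ℂ] (ℕ →ᵇ ℂ), ∀ φ : ℕ →ᵇ ℂ, ∀ n, T' φ n = T φ n := by
  have h : ∀ φ : ℕ →ᵇ ℂ, ∀ n, ‖T φ n‖ ≤ B * ‖φ‖ := fun φ => hT φ ‖φ‖ fun n => φ.norm_coe_le_norm n
  refine ⟨LinearMap.mkContinuous
    { toFun := fun φ => boundedSeq (T φ) (B * ‖φ‖) (h φ)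
      map_add' := fun φ ψ => by
        ext n
        simp [boundedSeq_apply]
      map_smul' := fun a φ => by
        ext n
        exact congrFun (T.map_smul a φ) n } B fun φ => ?_, fun φ n => rfl⟩
  have hB : 0 ≤ B * ‖φ‖ := (norm_nonneg _).trans (h φ 0)
  exact (BoundedContinuousFunction.norm_le hB).2 fun n => h φ n

/-! ### Analytic families of sequences of polynomial growth -/

section Families

variable {E : Type*} [NormedAddCommGroup E] [NormedSpace ℂ E]

/-- `Y q n` depends analytically on `q` near `p`, with growth at most `n ^ R`, uniformly in `n`. -/
def AnalyticFamily (R : ℕ) (Y : E → ℕ → ℂ) (p : E) : Prop :=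
  ∃ Φ : E → (ℕ →ᵇ ℂ), AnalyticAt ℂ Φ p ∧ ∀ᶠ q in 𝓝 p, ∀ n, Y q n = ((n : ℂ) + 1) ^ R * Φ q n

theorem AnalyticFamily.analyticAt {R : ℕ} {Y : E → ℕ → ℂ} {p : E} (h : AnalyticFamily R Y p)
    (n : ℕ) : AnalyticAt ℂ (fun q => Y q n) p := by
  obtain ⟨Φ, hΦ, h⟩ := h
  have h1 : AnalyticAt ℂ (fun q => ((n : ℂ) + 1) ^ R *
      (BoundedContinuousFunction.evalCLM ℂ n : (ℕ →ᵇ ℂ) →L[ℂ] ℂ) (Φ q)) p :=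
    analyticAt_const.mul ((ContinuousLinearMap.analyticAt _ _).comp hΦ)
  exact h1.congr (h.mono fun q hq => (hq n).symm)

theorem AnalyticFamily.mul {R R' : ℕ} {Y Y' : E → ℕ → ℂ} {p : E} (h : AnalyticFamily R Y p)
    (h' : AnalyticFamily R' Y' p) : AnalyticFamily (R + R') (fun q n => Y q n * Y' q n) p := by
  obtain ⟨Φ, hΦ, h⟩ := h
  obtain ⟨Φ', hΦ', h'⟩ := h'
  refine ⟨fun q => Φ q * Φ' q, hΦ.mul hΦ', ?_⟩
  filter_upwards [h, h'] with q hq hq' n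
  rw [hq, hq', BoundedContinuousFunction.mul_apply, pow_add]
  ring

theorem analyticFamily_one (p : E) : AnalyticFamily 0 (fun _ _ => 1) p :=
  ⟨fun _ => 1, analyticAt_const, Eventually.of_forall fun q n => by simp⟩

/-- Conjugating by the weights `(n+1) ^ R` and `(n+1) ^ R'` turns `T` into a bounded operator on
bounded sequences, and continuous linear maps preserve analyticity. -/
theorem AnalyticFamily.map {R R' : ℕ} {Y Y' : E → ℕ → ℂ} {p : E} (h : AnalyticFamily R Y p)
    (T : (ℕ → ℂ) →ₗ[ℂ] (ℕ → ℂ)) (B : ℝ)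
    (hT : ∀ φ : ℕ → ℂ, ∀ C : ℝ, (∀ n, ‖φ n‖ ≤ C * ((n : ℝ) + 1) ^ R) →
      ∀ n, ‖T φ n‖ ≤ B * C * ((n : ℝ) + 1) ^ R')
    (hY : ∀ᶠ q in 𝓝 p, Y' q = T (Y q)) : AnalyticFamily R' Y' p := by
  have hn : ∀ n : ℕ, ((n : ℂ) + 1) ≠ 0 := fun n => Nat.cast_add_one_ne_zero n
  have hnorm : ∀ n : ℕ, ‖((n : ℂ) + 1)‖ = (n : ℝ) + 1 := fun n => by
    rw [← Nat.cast_add_one, Complex.norm_natCast]; push_cast; rfl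
  obtain ⟨Φ, hΦ, h⟩ := h
  let D : (ℕ → ℂ) →ₗ[ℂ] (ℕ → ℂ) :=
    { toFun := fun φ n => ((n : ℂ) + 1) ^ R * φ n
      map_add' := fun φ ψ => by funext n; simp [mul_add]
      map_smul' := fun a φ => by funext n; simp; ring }
  let D' : (ℕ → ℂ) →ₗ[ℂ] (ℕ → ℂ) :=
    { toFun := fun φ n => (((n : ℂ) + 1) ^ R')⁻¹ * φ n
      map_add' := fun φ ψ => by funext n; simp [mul_add]
      map_smul' := fun a φ => by funext n; simp; ring }
  obtain ⟨T', hT'⟩ := exists_clm_of_bound (D' ∘ₗ T ∘ₗ D) B (by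
    intro φ C hC n
    have h1 := hT (D φ) C (fun n => by
      simp only [D, LinearMap.coe_mk, AddHom.coe_mk, norm_mul, norm_pow, hnorm]
      rw [mul_comm]
      gcongr
      exact hC n) n
    simp only [LinearMap.comp_apply, D', LinearMap.coe_mk, AddHom.coe_mk, norm_mul, norm_pow,
      norm_inv, hnorm]
    rw [inv_mul_le_iff₀ (by positivity)]
    linarith)
  refine ⟨fun q => T' (Φ q), (ContinuousLinearMap.analyticAt _ _).comp hΦ, ?_⟩
  filter_upwards [h, hY] with q hq hq' n
  rw [hq', hT']
  have e : Y q = D (Φ q) := funext hq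
  simp only [e, LinearMap.comp_apply, D', LinearMap.coe_mk, AddHom.coe_mk]
  rw [mul_inv_cancel_left₀ (pow_ne_zero _ (hn n))]

theorem AnalyticFamily.shift {R : ℕ} {Y : E → ℕ → ℂ} {p : E} (h : AnalyticFamily R Y p) (k : ℕ) :
    AnalyticFamily R (fun q n => Y q (n + k)) p := by
  refine h.map (LinearMap.funLeft ℂ ℂ fun n => n + k) (((k : ℝ) + 1) ^ R) (fun φ C hC n => ?_)
    (Eventually.of_forall fun q => rfl)
  have h0 : 0 ≤ C := by
    have := (norm_nonneg _).trans (hC 0)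
    simpa using this
  refine (hC (n + k)).trans ?_
  rw [mul_comm _ C, mul_assoc, ← mul_pow]
  gcongr
  push_cast
  nlinarith [Nat.cast_nonneg (α := ℝ) n, Nat.cast_nonneg (α := ℝ) k,
    mul_nonneg (Nat.cast_nonneg (α := ℝ) n) (Nat.cast_nonneg (α := ℝ) k)]

theorem AnalyticFamily.sum_range {R : ℕ} {Y : E → ℕ → ℂ} {p : E} (h : AnalyticFamily R Y p) :
    AnalyticFamily (R + 1) (fun q N => ∑ n ∈ Finset.range N, Y q n) p := by
  refine h.map { toFun := fun φ N => ∑ n ∈ Finset.range N, φ n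
                 map_add' := fun φ ψ => by funext n; simp [Finset.sum_add_distrib]
                 map_smul' := fun a φ => by funext n; simp [Finset.mul_sum] } 1
    (fun φ C hC N => ?_) (Eventually.of_forall fun q => rfl)
  have h0 : 0 ≤ C := by
    have := (norm_nonneg _).trans (hC 0)
    simpa using this
  simp only [LinearMap.coe_mk, AddHom.coe_mk]
  refine (norm_sum_le_of_le (Finset.range N) (f := φ) (n := fun _ => C * ((N : ℝ) + 1) ^ R)
    fun n hn => (hC n).trans ?_).trans ?_
  · have : (n : ℝ) ≤ N := by exact_mod_cast (Finset.mem_range.1 hn).le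
    gcongr
  · rw [Finset.sum_const, Finset.card_range, nsmul_eq_mul, pow_succ]
    have : 0 ≤ C * ((N : ℝ) + 1) ^ R := by positivity
    nlinarith

theorem analyticFamily_of_bound {R : ℕ} {f : ℕ → ℂ → ℂ} {σ : E → ℂ} {p : E}
    (hσ : AnalyticAt ℂ σ p) {r C : ℝ} (hr : 0 < r)
    (hf : ∀ n, Differentiable ℂ (f n))
    (hC : ∀ n, ∀ s ∈ Metric.ball (σ p) (2 * r), ‖f n s‖ ≤ C * ((n : ℝ) + 1) ^ R) :
    AnalyticFamily R (fun q n => f n (σ q)) p := by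
  have hn : ∀ n : ℕ, ((n : ℂ) + 1) ≠ 0 := fun n => Nat.cast_add_one_ne_zero n
  have hnorm : ∀ n : ℕ, ‖((n : ℂ) + 1)‖ = (n : ℝ) + 1 := fun n => by
    rw [← Nat.cast_add_one, Complex.norm_natCast]; push_cast; rfl
  obtain ⟨Φ, hΦ, h⟩ := exists_analyticAt_boundedSeq (f := fun n s => (((n : ℂ) + 1) ^ R)⁻¹ * f n s)
    (C := C) hr (fun n => ((hf n).const_mul _).differentiableOn) (fun n s hs => by
      rw [norm_mul, norm_inv, norm_pow, hnorm, inv_mul_le_iff₀ (by positivity)]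
      linarith [hC n s hs])
  refine ⟨fun q => Φ (σ q), hΦ.comp hσ, ?_⟩
  filter_upwards [hσ.continuousAt.eventually h] with q hq n
  rw [hq n, mul_inv_cancel_left₀ (pow_ne_zero _ (hn n))]

/-- The integer `⌊‖s₀‖⌋ + 1` exceeds `‖s₀‖` strictly, so it bounds nearby exponents too; one growth
order then works in a whole neighbourhood. -/
theorem norm_le_floor_add_one {s₀ s : ℂ} {r : ℝ} (hr : r ≤ (⌊‖s₀‖⌋₊ + 1 : ℕ) - ‖s₀‖)
    (hs : s ∈ Metric.ball s₀ r) : ‖s‖ ≤ (⌊‖s₀‖⌋₊ + 1 : ℕ) := by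
  have h1 := norm_le_norm_add_norm_sub' s s₀
  rw [Metric.mem_ball, dist_eq_norm] at hs
  linarith

theorem differentiable_const_cpow {x : ℝ} (hx : 0 < x) :
    Differentiable ℂ fun s : ℂ => (x : ℂ) ^ s := by
  have hx0 : (x : ℂ) ≠ 0 := by exact_mod_cast hx.ne'
  intro s
  exact DifferentiableAt.const_cpow (by fun_prop) (Or.inl hx0)

theorem analyticFamily_cpow {σ : E → ℂ} {p : E} (hσ : AnalyticAt ℂ σ p) {u : ℝ} (hu : 1 ≤ u) :
    AnalyticFamily (⌊‖σ p‖⌋₊ + 1) (fun q n => ((n : ℂ) + (u : ℂ)) ^ σ q) p := by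
  have hr : 0 < ((⌊‖σ p‖⌋₊ + 1 : ℕ) - ‖σ p‖) / 2 := by
    have := Nat.lt_floor_add_one ‖σ p‖
    push_cast
    linarith
  have hcast : ∀ n : ℕ, ((n : ℂ) + (u : ℂ)) = ((n + u : ℝ) : ℂ) := fun n => by push_cast; rfl
  refine analyticFamily_of_bound (f := fun n s => ((n : ℂ) + (u : ℂ)) ^ s)
    (C := u ^ (⌊‖σ p‖⌋₊ + 1)) hσ hr (fun n => ?_) (fun n s hs => ?_)
  · have := differentiable_const_cpow (x := n + u) (by positivity)
    rwa [← hcast] at this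
  · have h1 : ‖s‖ ≤ (⌊‖σ p‖⌋₊ + 1 : ℕ) := norm_le_floor_add_one (by linarith) hs
    have h2 : s.re ≤ (⌊‖σ p‖⌋₊ + 1 : ℕ) := (Complex.re_le_norm s).trans h1
    have hn : (0 : ℝ) ≤ n := Nat.cast_nonneg n
    rw [hcast, Complex.norm_cpow_eq_rpow_re_of_pos (by positivity), ← mul_pow]
    calc ((n : ℝ) + u) ^ s.re ≤ ((n : ℝ) + u) ^ ((⌊‖σ p‖⌋₊ + 1 : ℕ) : ℝ) :=
          Real.rpow_le_rpow_of_exponent_le (by linarith) h2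
      _ = ((n : ℝ) + u) ^ (⌊‖σ p‖⌋₊ + 1) := Real.rpow_natCast _ _
      _ ≤ _ := by
          gcongr
          nlinarith

/-- Values at `q` of a list of pairs (shift, exponent depending on a parameter). -/
def evalAt (L : List (ℝ × (E → ℂ))) (q : E) : List (ℝ × ℂ) := L.map fun a => (a.1, a.2 q)

/-- An exponent bounding the growth of a nested sum. -/
noncomputable def growth : List (ℝ × ℂ) → ℕ
  | [] => 0
  | (_, s) :: L => ⌊‖s‖⌋₊ + 1 + growth L + 1

theorem analyticFamily_nsum {p : E} (L : List (ℝ × (E → ℂ))) (hv : ∀ a ∈ L, 0 ≤ a.1)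
    (hL : ∀ a ∈ L, AnalyticAt ℂ a.2 p) :
    AnalyticFamily (growth (evalAt L p)) (fun q n => nsum (evalAt L q) n) p := by
  induction L with
  | nil => exact analyticFamily_one p
  | cons a L ih =>
    have h1 := ih (fun b hb => hv b (List.mem_cons_of_mem _ hb))
      (fun b hb => hL b (List.mem_cons_of_mem _ hb))
    exact ((analyticFamily_cpow (hL a List.mem_cons_self) (u := 1 + a.1)
      (by linarith [hv a List.mem_cons_self])).mul h1).sum_range

theorem analyticAt_ofReal_cpow {σ : E → ℂ} {p : E} (hσ : AnalyticAt ℂ σ p) {x : ℝ} (hx : 0 < x) :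
    AnalyticAt ℂ (fun q => (x : ℂ) ^ σ q) p :=
  AnalyticAt.cpow analyticAt_const hσ (Complex.ofReal_mem_slitPlane.2 hx)

theorem analyticAt_binom {σ : E → ℂ} {p : E} (hσ : AnalyticAt ℂ σ p) (k : ℕ) :
    AnalyticAt ℂ (fun q => binom (σ q) k) p := by
  simp only [binom, div_eq_mul_inv]
  refine AnalyticAt.mul ?_ analyticAt_const
  exact Finset.analyticAt_fun_prod _ fun i _ => hσ.sub analyticAt_const

theorem analyticAt_emRem {σ : E → ℂ} {p : E} (hσ : AnalyticAt ℂ σ p) (J : ℕ) {w x : ℝ}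
    (hx : 0 < x) (hw : 0 < x + w) : AnalyticAt ℂ (fun q => emRem J (σ q) w x) p := by
  have h1 : AnalyticAt ℂ (fun q => σ q + 1) p := hσ.add analyticAt_const
  unfold emRem
  refine (h1.mul (analyticAt_ofReal_cpow hσ hw)).sub (Finset.analyticAt_fun_sum _ fun j _ => ?_)
  have h2 : AnalyticAt ℂ (fun q => σ q + 1 - j) p := h1.sub analyticAt_const
  exact ((analyticAt_binom h1 j).mul analyticAt_const).mul
    ((analyticAt_ofReal_cpow h2 (by linarith)).sub (analyticAt_ofReal_cpow h2 hx))

theorem summable_inv_sq_mul (φ : ℕ →ᵇ ℂ) :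
    Summable fun n : ℕ => ‖(((n : ℂ) + 1) ^ 2)⁻¹ * φ n‖ := by
  have hs : Summable fun n : ℕ => (((n : ℝ) + 1) ^ 2)⁻¹ := by
    have := (summable_nat_add_iff 1).2 (Real.summable_nat_pow_inv.2 one_lt_two)
    simpa using this
  refine Summable.of_nonneg_of_le (fun n => norm_nonneg _) (fun n => ?_) (hs.mul_right ‖φ‖)
  rw [norm_mul, norm_inv, norm_pow, ← Nat.cast_add_one, Complex.norm_natCast]
  push_cast
  gcongr
  exact φ.norm_coe_le_norm n

/-- Summation against `(n + 1) ^ (-2)`. -/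
theorem exists_clm_tsum_inv_sq : ∃ T : (ℕ →ᵇ ℂ) →L[ℂ] ℂ, ∀ φ : ℕ →ᵇ ℂ,
    HasSum (fun n : ℕ => (((n : ℂ) + 1) ^ 2)⁻¹ * φ n) (T φ) := by
  have hs := fun φ => (summable_inv_sq_mul φ).of_norm
  have hs1 : Summable fun n : ℕ => ‖(((n : ℂ) + 1) ^ 2)⁻¹‖ := by
    simpa using summable_inv_sq_mul 1
  refine ⟨LinearMap.mkContinuous
    { toFun := fun φ => ∑' n : ℕ, (((n : ℂ) + 1) ^ 2)⁻¹ * φ n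
      map_add' := fun φ ψ => by
        rw [← (hs φ).tsum_add (hs ψ)]
        exact tsum_congr fun n => by simp [mul_add]
      map_smul' := fun a φ => by
        rw [RingHom.id_apply, smul_eq_mul, ← tsum_mul_left]
        exact tsum_congr fun n => by simp; ring }
    (∑' n : ℕ, ‖(((n : ℂ) + 1) ^ 2)⁻¹‖) fun φ => ?_, fun φ => (hs φ).hasSum⟩
  rw [← tsum_mul_right]
  refine tsum_of_norm_bounded (hs1.mul_right _).hasSum fun n => ?_
  rw [norm_mul]
  gcongr
  exact φ.norm_coe_le_norm n

/-- The threshold for `J` is `(R + 2) + (⌊‖σ p‖⌋ + 1)`: the defect absorbs a partner of growth `R`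
and leaves a factor `(n+1) ^ (-2)` for summability. -/
theorem analyticFamily_emRem {σ : E → ℂ} {p : E} (hσ : AnalyticAt ℂ σ p) {R J : ℕ} {u w : ℝ}
    (hu : 2 * |w| + 2 ≤ u) (hJ : R + ⌊‖σ p‖⌋₊ + 3 ≤ J) :
    AnalyticFamily 0 (fun q n => ((n : ℂ) + 1) ^ (R + 2) * emRem J (σ q) w (n + u)) p := by
  have hr : 0 < ((⌊‖σ p‖⌋₊ + 1 : ℕ) - ‖σ p‖) / 2 := by
    have := Nat.lt_floor_add_one ‖σ p‖
    push_cast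
    linarith
  obtain ⟨C, hC0, hC⟩ := exists_norm_emRem_le (⌊‖σ p‖⌋₊ + 1) J w
  have hw := abs_nonneg w
  refine analyticFamily_of_bound
    (f := fun n s => ((n : ℂ) + 1) ^ (R + 2) * emRem J s w (n + u))
    (C := C) hσ hr (fun n => ?_) (fun n s hs => ?_)
  · have hn : (0 : ℝ) ≤ n := Nat.cast_nonneg n
    refine Differentiable.const_mul (fun s => ?_) _
    exact (analyticAt_emRem (σ := fun s => s) analyticAt_id J (by linarith)
      (by linarith [neg_abs_le w])).differentiableAt
  · have h1 : ‖s‖ ≤ (⌊‖σ p‖⌋₊ + 1 : ℕ) := norm_le_floor_add_one (by linarith) hs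
    have h2 : s.re ≤ (⌊‖σ p‖⌋₊ + 1 : ℕ) := (Complex.re_le_norm s).trans h1
    have hn : (0 : ℝ) ≤ n := Nat.cast_nonneg n
    have h3 := hC s h1 (n + u) (by linarith)
    rw [pow_zero, mul_one, norm_mul, norm_pow, ← Nat.cast_add_one, Complex.norm_natCast]
    have hJ' : ((R + 2 : ℕ) : ℝ) + ((⌊‖σ p‖⌋₊ + 1 : ℕ) : ℝ) ≤ J := by exact_mod_cast (by omega)
    have hnu : 0 < (n : ℝ) + u := by linarith
    calc ((n + 1 : ℕ) : ℝ) ^ (R + 2) * ‖emRem J s w (n + u)‖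
        ≤ ((n : ℝ) + u) ^ (R + 2) * (C * ((n : ℝ) + u) ^ (s.re - J)) := by
          gcongr
          push_cast
          linarith
      _ = C * ((n : ℝ) + u) ^ (((R + 2 : ℕ) : ℝ) + (s.re - J)) := by
          rw [Real.rpow_add hnu, Real.rpow_natCast]; ring
      _ ≤ C * 1 := by
          gcongr
          exact Real.rpow_le_one_of_one_le_of_nonpos (by linarith) (by linarith)
      _ = C := mul_one C

/-- The series of Euler–Maclaurin defects against a family of polynomial growth is analytic. -/
theorem exists_analyticAt_hasSum_emRem {σ : E → ℂ} {p : E} (hσ : AnalyticAt ℂ σ p) {R J : ℕ}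
    {u w : ℝ} (hu : 0 < u) (huw : 0 < u + w) (hJ : R + ⌊‖σ p‖⌋₊ + 3 ≤ J) {Y : E → ℕ → ℂ}
    (hY : AnalyticFamily R Y p) : ∃ G : E → ℂ, AnalyticAt ℂ G p ∧
      ∀ᶠ q in 𝓝 p, HasSum (fun n : ℕ => emRem J (σ q) w (n + u) * Y q n) (G q) := by
  -- The uniform estimate of the defect needs a large argument; the first `k` terms are a finite
  -- analytic sum and are added back separately.
  obtain ⟨k, hk⟩ := exists_nat_gt (2 * |w| + 2)
  obtain ⟨Φ, hΦ, h⟩ := (analyticFamily_emRem hσ (R := R) (J := J) (u := k + u) (w := w)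
    (by linarith) hJ).mul (hY.shift k)
  obtain ⟨T, hT⟩ := exists_clm_tsum_inv_sq
  refine ⟨fun q => T (Φ q) + ∑ n ∈ Finset.range k, emRem J (σ q) w (n + u) * Y q n, ?_, ?_⟩
  · refine ((ContinuousLinearMap.analyticAt _ _).comp hΦ).add
      (Finset.analyticAt_fun_sum _ fun n _ => ?_)
    have hn : (0 : ℝ) ≤ n := Nat.cast_nonneg n
    exact (analyticAt_emRem hσ J (by linarith) (by linarith)).mul (hY.analyticAt n)
  · filter_upwards [h] with q hq
    rw [← hasSum_nat_add_iff]
    refine (hT (Φ q)).congr_fun fun n => ?_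
    have h1 := hq n
    have hn : ((n : ℂ) + 1) ≠ 0 := Nat.cast_add_one_ne_zero n
    rw [zero_add] at h1
    have e : ((n + k : ℕ) : ℝ) + u = n + (k + u) := by push_cast; ring
    rw [e]
    have h2 : ((n : ℂ) + 1) ^ R * (((n : ℂ) + 1) ^ 2 *
      (emRem J (σ q) w (n + (k + u)) * Y q (n + k))) = ((n : ℂ) + 1) ^ R * Φ q n := by
      rw [← h1]; ring
    rw [← mul_left_cancel₀ (pow_ne_zero _ hn) h2, inv_mul_cancel_left₀ (pow_ne_zero _ hn)]

end Families

/-! ### Regularized nested sums and their recursion in depth -/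

open Classical in
/-- The finite part of a nested sum (`0` if there is none). -/
noncomputable def regSum (L : List (ℝ × ℂ)) : ℂ :=
  if h : ∃ c, HasFinitePart (nsum L) c then h.choose else 0

theorem regSum_eq {L : List (ℝ × ℂ)} {c : ℂ} (h : HasFinitePart (nsum L) c) : regSum L = c := by
  have h' : ∃ c, HasFinitePart (nsum L) c := ⟨c, h⟩
  rw [regSum, dif_pos h']
  exact h'.choose_spec.unique h

theorem hasFinitePart_regSum {L : List (ℝ × ℂ)} (hL : ∀ a ∈ L, 0 ≤ a.1)
    (h0 : (0 : ℂ) ∉ sumExponents L) : HasFinitePart (nsum L) (regSum L) := by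
  obtain ⟨c, hc⟩ := exists_hasFinitePart_nsum L hL h0
  rwa [regSum_eq hc]

/-- The exponents after merging are among the original ones that involve at least two leading
variables. So off the polar set of a sum, all merged sums have finite parts as well. -/
theorem sumExponents_merge_subset (v₁ v₂ : ℝ) (s₁ s₂ : ℂ) (j : ℕ) (L : List (ℝ × ℂ)) :
    sumExponents ((v₂, s₁ + s₂ + 1 - j) :: L) ⊆ sumExponents ((v₁, s₁) :: (v₂, s₂) :: L) := by
  rintro α ⟨k, rfl | ⟨β, hβ, rfl⟩⟩
  · exact ⟨j + k, Or.inr ⟨s₂ + 1 - (0 : ℕ), ⟨0, Or.inl rfl⟩, by push_cast; ring⟩⟩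
  · exact ⟨j + k, Or.inr ⟨β + s₂ + 1 - (0 : ℕ), ⟨0, Or.inr ⟨β, hβ, rfl⟩⟩, by push_cast; ring⟩⟩

theorem sum_range_sub_mul (X Y : ℕ → ℂ) (N : ℕ) :
    ∑ m ∈ Finset.range N, (X (m + 1) - X m) * Y m =
      X N * Y N - X 0 * Y 0 - ∑ m ∈ Finset.range N, X (m + 1) * (Y (m + 1) - Y m) := by
  rw [← Finset.sum_range_sub (fun m => X m * Y m), ← Finset.sum_sub_distrib]
  exact Finset.sum_congr rfl fun m _ => by ring

/-- Euler–Maclaurin summation in the outermost variable of a nested sum. -/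
theorem nsum_cons_cons (J : ℕ) {v₁ v₂ : ℝ} (hv₂ : 0 ≤ v₂) (s₁ s₂ : ℂ)
    (L : List (ℝ × ℂ)) (N : ℕ) :
    (s₁ + 1) * nsum ((v₁, s₁) :: (v₂, s₂) :: L) N =
      ∑ m ∈ Finset.range N, emRem J s₁ (1 + v₁ - v₂) (m + v₂) * nsum ((v₂, s₂) :: L) m +
      ∑ j ∈ Finset.range J, binom (s₁ + 1) j * bernVal j (1 + v₁ - v₂) *
        (((N : ℂ) + (v₂ : ℂ)) ^ (s₁ + 1 - j) * nsum ((v₂, s₂) :: L) N +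
          -1 * nsum ((v₂, s₁ + s₂ + 1 - j) :: L) N) := by
  set Y := nsum ((v₂, s₂) :: L) with hY
  have hY0 : Y 0 = 0 := by simp [hY, nsum]
  have hYs : ∀ m, Y (m + 1) - Y m = ((m : ℂ) + ((1 + v₂ : ℝ) : ℂ)) ^ s₂ * nsum L m := fun m => by
    simp [hY, nsum, Finset.sum_range_succ]
  -- Abel summation; the lower boundary term drops out because `Y 0 = 0`. The jump of `Y` at `m`
  -- carries `(m+1+v₂) ^ s₂`, and basing Euler–Maclaurin at `x = m + v₂` makes the other factor a
  -- power of the same number, so the exponents add.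
  have h1 : ∀ j : ℕ, ((N : ℂ) + (v₂ : ℂ)) ^ (s₁ + 1 - j) * Y N +
      -1 * nsum ((v₂, s₁ + s₂ + 1 - j) :: L) N =
      ∑ m ∈ Finset.range N, ((((m + v₂ + 1 : ℝ) : ℂ)) ^ (s₁ + 1 - j) -
        ((m + v₂ : ℝ) : ℂ) ^ (s₁ + 1 - j)) * Y m := by
    intro j
    have h2 := sum_range_sub_mul (fun m => ((m : ℂ) + (v₂ : ℂ)) ^ (s₁ + 1 - j)) Y N
    have h3 : nsum ((v₂, s₁ + s₂ + 1 - j) :: L) N =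
        ∑ m ∈ Finset.range N, (((m + 1 : ℕ) : ℂ) + (v₂ : ℂ)) ^ (s₁ + 1 - j) *
          (Y (m + 1) - Y m) := by
      refine Finset.sum_congr rfl fun m _ => ?_
      have e : ((m + 1 : ℕ) : ℂ) + (v₂ : ℂ) = (m : ℂ) + ((1 + v₂ : ℝ) : ℂ) := by push_cast; ring
      have hne : (m : ℂ) + ((1 + v₂ : ℝ) : ℂ) ≠ 0 := by
        have : ((m + (1 + v₂) : ℝ) : ℂ) ≠ 0 := by
          rw [Complex.ofReal_ne_zero]; positivity
        simpa using this
      rw [hYs, e, ← mul_assoc, ← Complex.cpow_add _ _ hne]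
      ring_nf
    rw [h3]
    simp only [hY0, mul_zero, sub_zero] at h2
    rw [neg_one_mul, ← sub_eq_add_neg, ← h2]
    refine Finset.sum_congr rfl fun m _ => ?_
    push_cast
    ring_nf
  simp only [h1, Finset.mul_sum]
  rw [Finset.sum_comm, ← Finset.sum_add_distrib]
  have e : nsum ((v₁, s₁) :: (v₂, s₂) :: L) N =
    ∑ m ∈ Finset.range N, ((m : ℂ) + ((1 + v₁ : ℝ) : ℂ)) ^ s₁ * Y m := rfl
  rw [e, Finset.mul_sum]
  refine Finset.sum_congr rfl fun m _ => ?_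
  have e2 : ((m + v₂ + (1 + v₁ - v₂) : ℝ) : ℂ) = (m : ℂ) + ((1 + v₁ : ℝ) : ℂ) := by push_cast; ring
  rw [emRem, e2]
  simp only [← mul_assoc]
  rw [← Finset.sum_mul]
  ring

/-- With no inner sum, plain telescoping based at `m + 1 + v` with `w = 0` replaces Abel summation,
and the lower boundary terms `(1+v) ^ (s+1-j)` survive. -/
theorem nsum_singleton (J : ℕ) (v : ℝ) (s : ℂ) (N : ℕ) :
    (s + 1) * nsum [(v, s)] N =
      ∑ m ∈ Finset.range N, emRem J s 0 (m + (1 + v)) +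
      ∑ j ∈ Finset.range J, binom (s + 1) j * bernVal j 0 *
        (((N : ℂ) + ((1 + v : ℝ) : ℂ)) ^ (s + 1 - j) * nsum [] N +
          -1 * (((1 + v : ℝ) : ℂ)) ^ (s + 1 - j)) := by
  have h1 : ∀ j : ℕ, ((N : ℂ) + ((1 + v : ℝ) : ℂ)) ^ (s + 1 - j) * nsum [] N +
      -1 * (((1 + v : ℝ) : ℂ)) ^ (s + 1 - j) =
      ∑ m ∈ Finset.range N, ((((m + (1 + v) + 1 : ℝ) : ℂ)) ^ (s + 1 - j) -
        ((m + (1 + v) : ℝ) : ℂ) ^ (s + 1 - j)) := by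
    intro j
    have h2 := Finset.sum_range_sub (fun m : ℕ => ((m + (1 + v) : ℝ) : ℂ) ^ (s + 1 - j)) N
    have e : ∀ m : ℕ, ((m + 1 : ℕ) : ℝ) + (1 + v) = m + (1 + v) + 1 := fun m => by push_cast; ring
    simp only [e] at h2
    rw [h2]
    simp [nsum, sub_eq_add_neg]
  simp only [h1, Finset.mul_sum]
  rw [Finset.sum_comm, ← Finset.sum_add_distrib]
  simp only [nsum, Finset.mul_sum, mul_one]
  refine Finset.sum_congr rfl fun m _ => ?_
  rw [emRem, add_zero, Complex.ofReal_add (m : ℝ), Complex.ofReal_natCast]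
  ring

section Families

variable {E : Type*} [NormedAddCommGroup E] [NormedSpace ℂ E]

/-- The recursion for finite parts of nested sums, with an analytic error term. -/
theorem exists_regSum_cons_cons {p : E} {v₁ v₂ : ℝ} {σ₁ σ₂ : E → ℂ} {L : List (ℝ × (E → ℂ))}
    (hv : ∀ a ∈ (v₁, σ₁) :: (v₂, σ₂) :: L, 0 ≤ a.1)
    (hL : ∀ a ∈ (v₁, σ₁) :: (v₂, σ₂) :: L, AnalyticAt ℂ a.2 p) {J : ℕ}
    (hJ : growth (evalAt ((v₁, σ₁) :: (v₂, σ₂) :: L) p) < J) :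
    ∃ G : E → ℂ, AnalyticAt ℂ G p ∧ (∀ b : ℕ, σ₁ p = b - 1 → b < J → G p = 0) ∧
      ∀ᶠ q in 𝓝 p, (0 : ℂ) ∉ sumExponents (evalAt ((v₁, σ₁) :: (v₂, σ₂) :: L) q) →
        (σ₁ q + 1) * regSum (evalAt ((v₁, σ₁) :: (v₂, σ₂) :: L) q) =
          G q - ∑ j ∈ Finset.range J, binom (σ₁ q + 1) j * bernVal j (1 + v₁ - v₂) *
            regSum (evalAt ((v₂, fun q => σ₁ q + σ₂ q + 1 - j) :: L) q) := by
  have hv₁ : 0 ≤ v₁ := hv (v₁, σ₁) List.mem_cons_self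
  have hv' : ∀ a ∈ (v₂, σ₂) :: L, 0 ≤ a.1 := fun a ha => hv a (List.mem_cons_of_mem _ ha)
  have hv₂ : 0 ≤ v₂ := hv' (v₂, σ₂) List.mem_cons_self
  have hL' : ∀ a ∈ (v₂, σ₂) :: L, AnalyticAt ℂ a.2 p := fun a ha => hL a (List.mem_cons_of_mem _ ha)
  have hgrow : growth (evalAt ((v₁, σ₁) :: (v₂, σ₂) :: L) p) =
    ⌊‖σ₁ p‖⌋₊ + 1 + growth (evalAt ((v₂, σ₂) :: L) p) + 1 := rfl
  -- The series starts at `m = 1`, whence `u = 1 + v₂`: the inner sum is empty at `m = 0`, where the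
  -- base `m + v₂` may be 0.
  obtain ⟨G, hG, hsum⟩ := exists_analyticAt_hasSum_emRem (hL (v₁, σ₁) List.mem_cons_self)
    (R := growth (evalAt ((v₂, σ₂) :: L) p)) (J := J) (u := 1 + v₂) (w := 1 + v₁ - v₂)
    (by linarith) (by linarith) (by simp only; omega) ((analyticFamily_nsum _ hv' hL').shift 1)
  refine ⟨G, hG, fun b hb hbJ => ?_, ?_⟩
  · refine hsum.self_of_nhds.unique ?_
    have : ∀ n : ℕ, emRem J (σ₁ p) (1 + v₁ - v₂) (n + (1 + v₂)) = 0 := fun n => by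
      have hn : (0 : ℝ) ≤ n := Nat.cast_nonneg n
      rw [hb, emRem_natCast_sub_one hbJ (by linarith) (by linarith)]
    simp only [this, zero_mul]
    exact hasSum_zero
  · filter_upwards [hsum] with q hq h0
    have hvq : ∀ a ∈ evalAt ((v₁, σ₁) :: (v₂, σ₂) :: L) q, 0 ≤ a.1 := by
      intro a ha
      obtain ⟨b, hb, rfl⟩ := List.mem_map.1 ha
      exact hv b hb
    have hvq' : ∀ a ∈ evalAt ((v₂, σ₂) :: L) q, 0 ≤ a.1 := fun a ha =>
      hvq a (List.mem_cons_of_mem _ ha)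
    have hq' : HasSum (fun m : ℕ => emRem J (σ₁ q) (1 + v₁ - v₂) (m + v₂) *
        nsum (evalAt ((v₂, σ₂) :: L) q) m) (G q) := by
      have h1 : nsum (evalAt ((v₂, σ₂) :: L) q) 0 = 0 := by simp [evalAt, nsum]
      have h2 := (hasSum_nat_add_iff (f := fun m : ℕ => emRem J (σ₁ q) (1 + v₁ - v₂) (m + v₂) *
        nsum (evalAt ((v₂, σ₂) :: L) q) m) 1 (g := G q)).1 (hq.congr_fun fun n => by
          rw [Nat.cast_add_one, add_assoc])
      rwa [Finset.sum_range_one, h1, mul_zero, add_zero] at h2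
    have hfp := (hasFinitePart_regSum hvq h0).const_mul (σ₁ q + 1)
    have hmerge : ∀ j : ℕ, HasFinitePart (nsum ((v₂, σ₁ q + σ₂ q + 1 - j) :: evalAt L q))
        (regSum ((v₂, σ₁ q + σ₂ q + 1 - j) :: evalAt L q)) := fun j =>
      hasFinitePart_regSum (fun a ha => by
        rcases List.mem_cons.1 ha with rfl | ha
        · exact hv₂
        · exact hvq' a (List.mem_cons_of_mem _ ha))
        fun h => h0 (sumExponents_merge_subset v₁ v₂ (σ₁ q) (σ₂ q) j _ h)
    -- Finite parts on the right: the defect series converges to `G q`, and the boundary terms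
    -- contribute 0.
    have hfp' := (HasFinitePart.of_tendsto hq'.tendsto_sum_nat).add
      (HasFinitePart.sum (Finset.range J) fun j _ =>
        ((hasFinitePart_cpow_mul_nsum (evalAt ((v₂, σ₂) :: L) q) hvq' hv₂ (σ₁ q) j h0).add
          ((hmerge j).const_mul (-1))).const_mul (binom (σ₁ q + 1) j * bernVal j (1 + v₁ - v₂)))
    have heq := hfp.unique (hfp'.congr (Eventually.of_forall fun N =>
      (nsum_cons_cons J (v₁ := v₁) hv₂ (σ₁ q) (σ₂ q) (evalAt L q) N).symm))
    rw [heq, sub_eq_add_neg (G q), ← Finset.sum_neg_distrib]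
    congr 1
    refine Finset.sum_congr rfl fun j _ => ?_
    simp only [evalAt, List.map_cons]
    ring

theorem exists_regSum_singleton {p : E} {v : ℝ} (hv : 0 ≤ v) {σ : E → ℂ} (hσ : AnalyticAt ℂ σ p)
    {J : ℕ} (hJ : growth (evalAt [(v, σ)] p) < J) :
    ∃ G : E → ℂ, AnalyticAt ℂ G p ∧ (∀ b : ℕ, σ p = b - 1 → b < J → G p = 0) ∧
      ∀ᶠ q in 𝓝 p, (0 : ℂ) ∉ sumExponents (evalAt [(v, σ)] q) →
        (σ q + 1) * regSum (evalAt [(v, σ)] q) =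
          G q - ∑ j ∈ Finset.range J, binom (σ q + 1) j * bernVal j 0 *
            ((1 + v : ℝ) : ℂ) ^ (σ q + 1 - j) := by
  have hgrow : growth (evalAt [(v, σ)] p) = ⌊‖σ p‖⌋₊ + 1 + 0 + 1 := rfl
  obtain ⟨G, hG, hsum⟩ := exists_analyticAt_hasSum_emRem hσ
    (R := 0) (J := J) (u := 1 + v) (w := 0) (by linarith) (by linarith) (by omega)
    (analyticFamily_one p)
  refine ⟨G, hG, fun b hb hbJ => ?_, ?_⟩
  · refine hsum.self_of_nhds.unique ?_
    have : ∀ n : ℕ, emRem J (σ p) 0 (n + (1 + v)) = 0 := fun n => by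
      have hn : (0 : ℝ) ≤ n := Nat.cast_nonneg n
      rw [hb, emRem_natCast_sub_one hbJ (by linarith) (by linarith)]
    simp only [this, zero_mul]
    exact hasSum_zero
  · filter_upwards [hsum] with q hq h0
    simp only [mul_one] at hq
    have hvq : ∀ a ∈ evalAt [(v, σ)] q, 0 ≤ a.1 := by
      intro a ha
      obtain ⟨b, hb, rfl⟩ := List.mem_map.1 ha
      rw [List.mem_singleton.1 hb]
      exact hv
    have hfp := (hasFinitePart_regSum hvq h0).const_mul (σ q + 1)
    have hconst : ∀ c : ℂ, HasFinitePart (fun _ => c) c := fun c =>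
      HasFinitePart.of_tendsto tendsto_const_nhds
    have hfp' := (HasFinitePart.of_tendsto hq.tendsto_sum_nat).add
      (HasFinitePart.sum (Finset.range J) fun j _ =>
        ((hasFinitePart_cpow_mul_nsum [] (by simp) (w := 1 + v) (v := v) (by linarith)
          (σ q) j h0).add ((hconst (((1 + v : ℝ) : ℂ) ^ (σ q + 1 - j))).const_mul (-1))).const_mul
            (binom (σ q + 1) j * bernVal j 0))
    have heq := hfp.unique (hfp'.congr (Eventually.of_forall fun N =>
      (nsum_singleton J v (σ q) N).symm))
    rw [heq, sub_eq_add_neg (G q), ← Finset.sum_neg_distrib]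
    congr 1
    refine Finset.sum_congr rfl fun j _ => ?_
    ring

end Families

/-! ### Quotients of analytic functions and the poles in depth two -/

section Quotients

variable {E : Type*} [NormedAddCommGroup E] [NormedSpace ℂ E]

/-- Near `p` and on the set where `good` holds, `f` is a quotient of analytic functions with
non-vanishing denominator. -/
def QuotientAt (good : E → Prop) (f : E → ℂ) (p : E) : Prop :=
  ∃ g h : E → ℂ, AnalyticAt ℂ g p ∧ AnalyticAt ℂ h p ∧
    ∀ᶠ q in 𝓝 p, good q → h q ≠ 0 ∧ f q = g q / h q

theorem QuotientAt.of_analyticAt {good : E → Prop} {f : E → ℂ} {p : E} (hf : AnalyticAt ℂ f p) :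
    QuotientAt good f p :=
  ⟨f, fun _ => 1, hf, analyticAt_const, Eventually.of_forall fun q _ => by simp⟩

theorem QuotientAt.mono {good good' : E → Prop} {f : E → ℂ} {p : E} (h : QuotientAt good f p)
    (hg : ∀ q, good' q → good q) : QuotientAt good' f p := by
  obtain ⟨g, k, hg', hk, h⟩ := h
  exact ⟨g, k, hg', hk, h.mono fun q hq hq' => hq (hg q hq')⟩

theorem QuotientAt.congr {good : E → Prop} {f f' : E → ℂ} {p : E} (h : QuotientAt good f p)
    (hf : ∀ᶠ q in 𝓝 p, good q → f' q = f q) : QuotientAt good f' p := by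
  obtain ⟨g, k, hg, hk, h⟩ := h
  refine ⟨g, k, hg, hk, ?_⟩
  filter_upwards [h, hf] with q hq hq' hgood
  exact ⟨(hq hgood).1, (hq' hgood).trans (hq hgood).2⟩

theorem QuotientAt.add {good : E → Prop} {f f' : E → ℂ} {p : E} (h : QuotientAt good f p)
    (h' : QuotientAt good f' p) : QuotientAt good (fun q => f q + f' q) p := by
  obtain ⟨g, k, hg, hk, h⟩ := h
  obtain ⟨g', k', hg', hk', h'⟩ := h'
  refine ⟨fun q => g q * k' q + k q * g' q, fun q => k q * k' q, (hg.mul hk').add (hk.mul hg'),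
    hk.mul hk', ?_⟩
  filter_upwards [h, h'] with q hq hq' hgood
  obtain ⟨h1, h2⟩ := hq hgood
  obtain ⟨h1', h2'⟩ := hq' hgood
  exact ⟨mul_ne_zero h1 h1', by rw [h2, h2', div_add_div _ _ h1 h1']⟩

theorem QuotientAt.mul {good : E → Prop} {f f' : E → ℂ} {p : E} (h : QuotientAt good f p)
    (h' : QuotientAt good f' p) : QuotientAt good (fun q => f q * f' q) p := by
  obtain ⟨g, k, hg, hk, h⟩ := h
  obtain ⟨g', k', hg', hk', h'⟩ := h'
  refine ⟨fun q => g q * g' q, fun q => k q * k' q, hg.mul hg', hk.mul hk', ?_⟩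
  filter_upwards [h, h'] with q hq hq' hgood
  obtain ⟨h1, h2⟩ := hq hgood
  obtain ⟨h1', h2'⟩ := hq' hgood
  exact ⟨mul_ne_zero h1 h1', by rw [h2, h2', div_mul_div_comm]⟩

theorem QuotientAt.sum {ι : Type*} {good : E → Prop} (s : Finset ι) {f : ι → E → ℂ} {p : E}
    (h : ∀ i ∈ s, QuotientAt good (f i) p) : QuotientAt good (fun q => ∑ i ∈ s, f i q) p := by
  classical
  induction s using Finset.induction_on with
  | empty => simpa using QuotientAt.of_analyticAt analyticAt_const
  | insert i s hi ih =>
    simp only [Finset.sum_insert hi]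
    exact (h i (Finset.mem_insert_self _ _)).add
      (ih fun j hj => h j (Finset.mem_insert_of_mem hj))

theorem QuotientAt.div {good : E → Prop} {f f' : E → ℂ} {p : E} (h : QuotientAt good f p)
    (h' : AnalyticAt ℂ f' p) (h0 : ∀ q, good q → f' q ≠ 0) :
    QuotientAt good (fun q => f q / f' q) p := by
  obtain ⟨g, k, hg, hk, h⟩ := h
  refine ⟨g, fun q => k q * f' q, hg, hk.mul h', ?_⟩
  filter_upwards [h] with q hq hgood
  obtain ⟨h1, h2⟩ := hq hgood
  exact ⟨mul_ne_zero h1 (h0 q hgood), by rw [h2, div_div]⟩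

theorem add_one_ne_zero_of_not_mem_sumExponents {v : ℝ} {s : ℂ} {L : List (ℝ × ℂ)}
    (h : (0 : ℂ) ∉ sumExponents ((v, s) :: L)) : s + 1 ≠ 0 := fun h0 =>
  h ⟨0, Or.inl (by push_cast; rw [h0, sub_zero])⟩

/-- Induction on depth by the recursion: merged sums are shorter, and the only new denominator is
the head exponent plus one, nonzero off the polar set. -/
theorem quotientAt_regSum {p : E} (n : ℕ) : ∀ L : List (ℝ × (E → ℂ)), L.length = n →
    (∀ a ∈ L, 0 ≤ a.1) → (∀ a ∈ L, AnalyticAt ℂ a.2 p) →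
    QuotientAt (fun q => (0 : ℂ) ∉ sumExponents (evalAt L q)) (fun q => regSum (evalAt L q)) p := by
  induction n with
  | zero =>
    intro L hn _ _
    rw [List.length_eq_zero_iff.1 hn]
    exact QuotientAt.of_analyticAt (analyticAt_const (v := regSum []))
  | succ n ih =>
    intro L hn hv hL
    match L, hn, hv, hL with
    | [(v, σ)], _, hv, hL =>
      have hσ : AnalyticAt ℂ σ p := hL (v, σ) List.mem_cons_self
      have hv0 : 0 ≤ v := hv (v, σ) List.mem_cons_self
      have hσ1 : AnalyticAt ℂ (fun q => σ q + 1) p := hσ.add analyticAt_const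
      obtain ⟨G, hG, -, h⟩ := exists_regSum_singleton hv0 hσ (Nat.lt_succ_self _)
      refine QuotientAt.congr (QuotientAt.div (QuotientAt.of_analyticAt (hG.sub
        (Finset.analyticAt_fun_sum (Finset.range (growth (evalAt [(v, σ)] p) + 1)) fun j _ =>
          ((analyticAt_binom hσ1 j).mul (analyticAt_const (v := bernVal j 0))).mul
            (analyticAt_ofReal_cpow (hσ1.sub (analyticAt_const (v := (j : ℂ))))
              (by linarith : 0 < 1 + v))))) hσ1
        fun q hq => add_one_ne_zero_of_not_mem_sumExponents hq) (h.mono fun q hq hgood => ?_)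
      rw [eq_div_iff (add_one_ne_zero_of_not_mem_sumExponents hgood), mul_comm]
      exact hq hgood
    | (v₁, σ₁) :: (v₂, σ₂) :: L, hn, hv, hL =>
      have hσ₁ : AnalyticAt ℂ σ₁ p := hL (v₁, σ₁) List.mem_cons_self
      have hσ₂ : AnalyticAt ℂ σ₂ p := hL (v₂, σ₂) (List.mem_cons_of_mem _ List.mem_cons_self)
      have hv₂ : 0 ≤ v₂ := hv (v₂, σ₂) (List.mem_cons_of_mem _ List.mem_cons_self)
      have hσ1 : AnalyticAt ℂ (fun q => σ₁ q + 1) p := hσ₁.add analyticAt_const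
      obtain ⟨G, hG, -, h⟩ := exists_regSum_cons_cons hv hL (Nat.lt_succ_self _)
      have hmerge : ∀ j : ℕ, QuotientAt
          (fun q => (0 : ℂ) ∉ sumExponents (evalAt ((v₁, σ₁) :: (v₂, σ₂) :: L) q))
          (fun q => regSum (evalAt ((v₂, fun q => σ₁ q + σ₂ q + 1 - j) :: L) q)) p := by
        intro j
        refine QuotientAt.mono (ih _ (by simpa using hn) ?_ ?_) fun q hq h0 =>
          hq (sumExponents_merge_subset v₁ v₂ (σ₁ q) (σ₂ q) j _ h0)
        · intro a ha
          rcases List.mem_cons.1 ha with rfl | ha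
          · exact hv₂
          · exact hv a (List.mem_cons_of_mem _ (List.mem_cons_of_mem _ ha))
        · intro a ha
          rcases List.mem_cons.1 ha with rfl | ha
          · exact ((hσ₁.add hσ₂).add analyticAt_const).sub analyticAt_const
          · exact hL a (List.mem_cons_of_mem _ (List.mem_cons_of_mem _ ha))
      refine QuotientAt.congr (QuotientAt.div ((QuotientAt.of_analyticAt hG).add
        ((QuotientAt.of_analyticAt (analyticAt_const (v := (-1 : ℂ)))).mul
        (QuotientAt.sum (Finset.range (growth (evalAt ((v₁, σ₁) :: (v₂, σ₂) :: L) p) + 1)) fun j _ =>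
          (QuotientAt.of_analyticAt ((analyticAt_binom hσ1 j).mul
            (analyticAt_const (v := bernVal j (1 + v₁ - v₂))))).mul (hmerge j)))) hσ1
        fun q hq => add_one_ne_zero_of_not_mem_sumExponents hq) (h.mono fun q hq hgood => ?_)
      rw [eq_div_iff (add_one_ne_zero_of_not_mem_sumExponents hgood), mul_comm, neg_one_mul,
        ← sub_eq_add_neg]
      exact hq hgood

/-- With equal shifts `w = 1`, so the terms `j = 3, 5, …` of the recursion disappear, and with them
the possible poles at `b₁ + b₂ = 1, 3, …`. -/
theorem bernVal_one_of_odd {j : ℕ} (hj : Odd j) (h1 : 1 < j) : bernVal j 1 = 0 := by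
  rw [bernVal, Complex.ofReal_one, ← map_one (algebraMap ℚ ℂ), Polynomial.aeval_algebraMap_apply]
  simp [bernoulli'_eq_zero_of_odd hj h1]

theorem exists_analyticAt_regSum_singleton {p : E} {v : ℝ} (hv : 0 ≤ v) {σ : E → ℂ}
    (hσ : AnalyticAt ℂ σ p) (h0 : σ p + 1 ≠ 0) :
    ∃ G : E → ℂ, AnalyticAt ℂ G p ∧ ∀ᶠ q in 𝓝 p, (0 : ℂ) ∉ sumExponents (evalAt [(v, σ)] q) →
      regSum (evalAt [(v, σ)] q) = G q := by
  have hσ1 : AnalyticAt ℂ (fun q => σ q + 1) p := hσ.add analyticAt_const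
  obtain ⟨G, hG, -, h⟩ := exists_regSum_singleton hv hσ (Nat.lt_succ_self _)
  refine ⟨_, (hG.sub (Finset.analyticAt_fun_sum (Finset.range (growth (evalAt [(v, σ)] p) + 1))
    fun j _ => ((analyticAt_binom hσ1 j).mul (analyticAt_const (v := bernVal j 0))).mul
      (analyticAt_ofReal_cpow (hσ1.sub (analyticAt_const (v := (j : ℂ))))
        (by linarith : 0 < 1 + v)))).div hσ1 h0, h.mono fun q hq hgood => ?_⟩
  rw [Pi.div_apply, eq_div_iff (add_one_ne_zero_of_not_mem_sumExponents hgood), mul_comm]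
  exact hq hgood

/-- In depth two with equal shifts most of the poles are absent. -/
theorem exists_analyticAt_regSum_pair {p : E} {v : ℝ} (hv : 0 ≤ v) {σ₁ σ₂ : E → ℂ}
    (hσ₁ : AnalyticAt ℂ σ₁ p) (hσ₂ : AnalyticAt ℂ σ₂ p) (h1 : σ₁ p ≠ -1)
    (h2 : σ₁ p + σ₂ p ≠ -2) (h3 : σ₁ p + σ₂ p ≠ -1) (h4 : ∀ k : ℕ, σ₁ p + σ₂ p ≠ 2 * (k : ℂ)) :
    ∃ G : E → ℂ, AnalyticAt ℂ G p ∧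
      ∀ᶠ q in 𝓝 p, (0 : ℂ) ∉ sumExponents (evalAt [(v, σ₁), (v, σ₂)] q) →
        regSum (evalAt [(v, σ₁), (v, σ₂)] q) = G q := by
  have hσ1 : AnalyticAt ℂ (fun q => σ₁ q + 1) p := hσ₁.add analyticAt_const
  have hne : σ₁ p + 1 ≠ 0 := fun h => h1 (eq_neg_of_add_eq_zero_left h)
  obtain ⟨G, hG, -, h⟩ := exists_regSum_cons_cons (v₁ := v) (v₂ := v) (σ₁ := σ₁) (σ₂ := σ₂)
    (L := []) (p := p) (by simpa using hv) (by simpa using ⟨hσ₁, hσ₂⟩) (Nat.lt_succ_self _)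
  have hterm : ∀ j : ℕ, ∃ H : E → ℂ, AnalyticAt ℂ H p ∧
      ∀ᶠ q in 𝓝 p, (0 : ℂ) ∉ sumExponents (evalAt [(v, σ₁), (v, σ₂)] q) →
        bernVal j (1 + v - v) * regSum (evalAt [(v, fun q => σ₁ q + σ₂ q + 1 - j)] q) = H q := by
    intro j
    by_cases hj : Odd j ∧ 1 < j
    · refine ⟨fun _ => 0, analyticAt_const, Eventually.of_forall fun q _ => ?_⟩
      rw [add_sub_cancel_right, bernVal_one_of_odd hj.1 hj.2, zero_mul]
    · obtain ⟨H, hH, hH'⟩ := exists_analyticAt_regSum_singleton (p := p) hv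
        (σ := fun q => σ₁ q + σ₂ q + 1 - j)
        (((hσ₁.add hσ₂).add analyticAt_const).sub analyticAt_const) (by
          intro h0
          -- A pole of the `j`-th merged sum forces this equality; the surviving `j = 0`, `j = 1`
          -- and even `j ≥ 2` yield precisely the excluded values.
          have h5 : σ₁ p + σ₂ p = j - 2 := by linear_combination h0
          rcases Nat.even_or_odd' j with ⟨i, rfl | rfl⟩
          · rcases Nat.eq_zero_or_pos i with rfl | hi
            · exact h2 (by rw [h5]; simp)
            · refine h4 (i - 1) ?_
              rw [h5]
              push_cast [Nat.cast_sub hi]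
              ring
          · have hi : i = 0 := by
              by_contra hi
              exact hj ⟨⟨i, rfl⟩, by omega⟩
            subst hi
            exact h3 (by rw [h5]; norm_num))
      refine ⟨fun q => bernVal j (1 + v - v) * H q, analyticAt_const.mul hH,
        hH'.mono fun q hq hgood => ?_⟩
      rw [hq fun h0 => hgood (sumExponents_merge_subset v v (σ₁ q) (σ₂ q) j _ h0)]
  choose H hH hH' using hterm
  refine ⟨_, (hG.sub (Finset.analyticAt_fun_sum
    (Finset.range (growth (evalAt [(v, σ₁), (v, σ₂)] p) + 1)) fun j _ =>
      (analyticAt_binom hσ1 j).mul (hH j))).div hσ1 hne, ?_⟩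
  filter_upwards [h, (Finset.eventually_all
    (Finset.range (growth (evalAt [(v, σ₁), (v, σ₂)] p) + 1))).2 fun j _ => hH' j] with q hq hq' hgood
  rw [Pi.div_apply, eq_div_iff (add_one_ne_zero_of_not_mem_sumExponents hgood), mul_comm,
    hq hgood]
  refine congrArg (G q - ·) (Finset.sum_congr rfl fun j hj => ?_)
  rw [mul_assoc, hq' j hj hgood]
  rfl

end Quotients

/-! Translation between families indexed by `Fin l` and lists. -/

/-- Splitting off the largest index as `m + 1` confines the others to `1, …, m`, so the inner sum
has cut-off `m`. -/
theorem nestedSum_eq_nsum {l : ℕ} (v : Fin l → ℝ) (s : Fin l → ℂ) (N : ℕ) :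
    nestedSum v s N = nsum (List.ofFn fun i => (v i, s i)) N := by
  induction l generalizing N with
  | zero => simp [nestedSum, nsum]
  | succ l ih =>
    rw [List.ofFn_succ, nsum]
    simp only [← ih (fun i => v i.succ) (fun i => s i.succ)]
    simp only [nestedSum, Finset.mul_sum]
    rw [Finset.sum_sigma']
    symm
    refine Finset.sum_bij' (fun x _ => Fin.cons (x.1 + 1) x.2)
      (fun n _ => ⟨n 0 - 1, Fin.tail n⟩) ?_ ?_ ?_ ?_ ?_
    · rintro ⟨m, n⟩ h
      simp only [Finset.mem_sigma, Finset.mem_range, Finset.mem_filter, Fintype.mem_piFinset,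
        Finset.mem_Icc] at h ⊢
      obtain ⟨hm, h1, h2⟩ := h
      refine ⟨fun i => ?_, fun i j => ?_⟩
      · refine Fin.cases ?_ (fun i => ?_) i
        · simp; omega
        · simp only [Fin.cons_succ]
          have := h1 i
          omega
      · refine Fin.cases ?_ (fun i => ?_) i <;> refine Fin.cases ?_ (fun j => ?_) j
        · simp
        · intro _
          simp only [Fin.cons_succ, Fin.cons_zero]
          have := h1 j
          omega
        · simp
        · simp only [Fin.cons_succ, Fin.succ_lt_succ_iff]
          exact h2 i j
    · intro n h
      simp only [Finset.mem_sigma, Finset.mem_range, Finset.mem_filter, Fintype.mem_piFinset,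
        Finset.mem_Icc] at h ⊢
      obtain ⟨h1, h2⟩ := h
      refine ⟨by have := h1 0; omega, fun i => ⟨(h1 i.succ).1, ?_⟩, fun i j hij => ?_⟩
      · have := h2 0 i.succ (Fin.succ_pos i)
        simp only [Fin.tail]
        omega
      · exact h2 i.succ j.succ (Fin.succ_lt_succ_iff.2 hij)
    · rintro ⟨m, n⟩ _
      simp
    · intro n h
      simp only [Finset.mem_filter, Fintype.mem_piFinset, Finset.mem_Icc] at h
      have := h.1 0
      simp only
      rw [Nat.sub_add_cancel this.1, Fin.cons_self_tail]
    · rintro ⟨m, n⟩ _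
      rw [Fin.prod_univ_succ]
      simp only [Fin.cons_zero, Fin.cons_succ]
      push_cast
      ring_nf

theorem mem_sumExponents_ofFn {l : ℕ} (v : Fin l → ℝ) (s : Fin l → ℂ) (α : ℂ) :
    α ∈ sumExponents (List.ofFn fun i => (v i, s i)) ↔
      ∃ m : ℕ, 1 ≤ m ∧ m ≤ l ∧ ∃ k : ℕ, α = ∑ i : Fin l with i.val < m, s i + m - k := by
  induction l generalizing α with
  | zero =>
    simp only [List.ofFn_zero, sumExponents, Set.mem_empty_iff_false, false_iff]
    rintro ⟨m, h1, h2, -⟩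
    omega
  | succ l ih =>
    have hsum : ∀ m : ℕ, ∑ i : Fin (l + 1) with i.val < m + 1, s i =
        s 0 + ∑ i : Fin l with i.val < m, s i.succ := by
      intro m
      rw [Finset.sum_filter, Fin.sum_univ_succ, Finset.sum_filter]
      simp
    rw [List.ofFn_succ]
    constructor
    · rintro ⟨k, rfl | ⟨β, hβ, rfl⟩⟩
      · refine ⟨0 + 1, le_rfl, by omega, k, ?_⟩
        rw [hsum]
        simp
      · obtain ⟨m, h1, h2, k', rfl⟩ := (ih (fun i => v i.succ) (fun i => s i.succ) β).1 hβ
        refine ⟨m + 1, by omega, by omega, k' + k, ?_⟩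
        rw [hsum]
        push_cast
        ring
    · rintro ⟨m, h1, h2, k, rfl⟩
      obtain ⟨m, rfl⟩ : ∃ m', m = m' + 1 := ⟨m - 1, by omega⟩
      rw [hsum]
      refine ⟨k, ?_⟩
      rcases Nat.eq_zero_or_pos m with rfl | hm
      · left; simp
      · right
        exact ⟨_, (ih (fun i => v i.succ) (fun i => s i.succ) _).2
          ⟨m, hm, by omega, 0, rfl⟩, by push_cast; ring⟩

theorem mem_polarSet_iff {l : ℕ} (v : Fin l → ℝ) (b c : Fin l → ℂ) (γ : ℂ → ℂ) (z : Fin l → ℂ) :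
    z ∈ polarSet b c γ ↔
      (0 : ℂ) ∈ sumExponents (List.ofFn fun i => (v i, exponents b c γ z i)) := by
  rw [mem_sumExponents_ofFn]
  simp only [polarSet, Set.mem_ofPred_eq, exponents, Finset.sum_sub_distrib]
  refine exists_congr fun m => and_congr_right fun _ => and_congr_right fun _ =>
    exists_congr fun k => ⟨fun h => ?_, fun h => ?_⟩
  · linear_combination h
  · linear_combination h

theorem isCutoffNestedSum_regSum {l : ℕ} {v : Fin l → ℝ} (hv : ∀ i, 0 ≤ v i) {s : Fin l → ℂ}
    (h : (0 : ℂ) ∉ sumExponents (List.ofFn fun i => (v i, s i))) :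
    IsCutoffNestedSum v s (regSum (List.ofFn fun i => (v i, s i))) := by
  have e : nestedSum v s = nsum (List.ofFn fun i => (v i, s i)) :=
    funext (nestedSum_eq_nsum v s)
  rw [IsCutoffNestedSum, e]
  refine hasFinitePart_regSum (fun a ha => ?_) h
  obtain ⟨i, rfl⟩ := (List.mem_ofFn' _ _).1 ha
  exact hv i

theorem evalAt_ofFn {l : ℕ} {E : Type*} (v : Fin l → ℝ) (σ : Fin l → E → ℂ) (q : E) :
    evalAt (List.ofFn fun i => (v i, σ i)) q = List.ofFn fun i => (v i, σ i q) := by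
  simp [evalAt, List.map_ofFn, Function.comp_def]

/-! ### The polar set near the origin and meromorphy in several variables -/

theorem isClosed_range_natCast_complex : IsClosed (Set.range ((↑) : ℕ → ℂ)) := by
  have h := (Complex.isUniformEmbedding_ofReal.isClosedEmbedding.comp Nat.isClosedEmbedding_coe_real).isClosed_range
  simpa [Function.comp_def] using h

/-- At the origin the finitely many sums `∑ β_i + m` avoid the closed set `ℕ`, and by continuity
they do so nearby. -/
theorem eventually_notMem_polarSet {l : ℕ} {b c : Fin l → ℂ} {γ : ℂ → ℂ} {W : Set ℂ}
    (hγ : IsRegulator W γ)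
    (h : ∀ m : ℕ, 1 ≤ m → m ≤ l → ∀ k : ℕ,
      (∑ i : Fin l with i.val < m, b i) ≠ -(m : ℂ) + (k : ℂ)) :
    ∀ᶠ z in 𝓝 (0 : Fin l → ℂ), z ∉ polarSet b c γ := by
  have hcont : ContinuousAt γ 0 := hγ.hasDerivAt.continuousAt
  have key : ∀ m ∈ Finset.Icc 1 l, ∀ᶠ z in 𝓝 (0 : Fin l → ℂ),
      (∑ i : Fin l with i.val < m, (b i - c i * γ (z i))) + m ∉ Set.range ((↑) : ℕ → ℂ) := by
    intro m hm
    have hc : ContinuousAt (fun z : Fin l → ℂ =>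
        (∑ i : Fin l with i.val < m, (b i - c i * γ (z i))) + m) 0 := by
      refine ContinuousAt.add (tendsto_finsetSum _ fun i _ => ?_) continuousAt_const
      refine ContinuousAt.sub continuousAt_const (continuousAt_const.mul ?_)
      exact ContinuousAt.comp (f := fun z : Fin l → ℂ => z i) hcont (continuous_apply i).continuousAt
    refine hc.eventually (isClosed_range_natCast_complex.isOpen_compl.mem_nhds ?_)
    rintro ⟨k, hk⟩
    refine h m (Finset.mem_Icc.1 hm).1 (Finset.mem_Icc.1 hm).2 k ?_
    simp only [Pi.zero_apply, hγ.map_zero, mul_zero, sub_zero] at hk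
    linear_combination -hk
  filter_upwards [(Finset.eventually_all _).2 key] with z hz
  rintro ⟨m, h1, h2, k, hk⟩
  refine hz m (Finset.mem_Icc.2 ⟨h1, h2⟩) ⟨k, ?_⟩
  rw [Finset.sum_sub_distrib]
  linear_combination hk

theorem IsRegulator.analyticAt {W : Set ℂ} {γ : ℂ → ℂ} (hγ : IsRegulator W γ) {z : ℂ} (hz : z ∈ W) :
    AnalyticAt ℂ γ z := hγ.holo.analyticAt (hγ.isOpen.mem_nhds hz)

theorem analyticAt_exponents {l : ℕ} {W : Set ℂ} {γ : ℂ → ℂ} (hγ : IsRegulator W γ)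
    (b c : Fin l → ℂ) {z : Fin l → ℂ} (i : Fin l) (hz : z i ∈ W) :
    AnalyticAt ℂ (fun z => exponents b c γ z i) z :=
  analyticAt_const.sub (analyticAt_const.mul (AnalyticAt.comp (f := fun z : Fin l → ℂ => z i)
    (hγ.analyticAt hz)
    ((ContinuousLinearMap.proj (R := ℂ) (φ := fun _ : Fin l => ℂ) i).analyticAt z)))

theorem meromorphic_cutoffNestedSum {l : ℕ} {W : Set ℂ} {γ : ℂ → ℂ} (hγ : IsRegulator W γ)
    (b c : Fin l → ℂ) {v : Fin l → ℝ} (hv : ∀ j, 0 ≤ v j) :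
    ∃ F : (Fin l → ℂ) → ℂ,
      MeromorphicWithPolesOn F {z | ∀ i, z i ∈ W} (polarSet b c γ) ∧
      (∀ z : Fin l → ℂ, (∀ i, z i ∈ W) → z ∉ polarSet b c γ →
        IsCutoffNestedSum v (exponents b c γ z) (F z)) ∧
      ((∀ m : ℕ, 1 ≤ m → m ≤ l → ∀ k : ℕ,
          (∑ i : Fin l with i.val < m, b i) ≠ -(m : ℂ) + (k : ℂ)) →
        AnalyticAt ℂ F 0) := by
  have hquot : ∀ p : Fin l → ℂ, (∀ i, p i ∈ W) → QuotientAt (fun z => z ∉ polarSet b c γ)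
      (fun z => regSum (List.ofFn fun i => (v i, exponents b c γ z i))) p := by
    intro p hp
    have := quotientAt_regSum (p := p) l
      (List.ofFn fun i : Fin l => (v i, fun z => exponents b c γ z i)) (by simp)
      (fun a ha => by obtain ⟨i, rfl⟩ := (List.mem_ofFn' _ _).1 ha; exact hv i)
      (fun a ha => by
        obtain ⟨i, rfl⟩ := (List.mem_ofFn' _ _).1 ha
        exact analyticAt_exponents hγ b c i (hp i))
    simp only [evalAt_ofFn] at this
    exact this.mono fun q hq h => hq ((mem_polarSet_iff v b c γ q).2 h)
  refine ⟨fun z => regSum (List.ofFn fun i => (v i, exponents b c γ z i)), ?_, ?_, ?_⟩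
  · intro p hp
    obtain ⟨g, h, hg, hh, hgh⟩ := hquot p hp
    -- If `h` vanished identically near `p`, every nearby point would lie on the polar set, since `h
    -- ≠ 0` off it; then `0 / 1` is a valid quotient.
    by_cases hfreq : ∃ᶠ q in 𝓝 p, h q ≠ 0
    · refine ⟨g, h, hg, hh, hfreq, hgh.mono fun q hq => ⟨fun h0 => ?_, fun hP => (hq hP).2⟩⟩
      by_contra hP
      exact (hq hP).1 h0
    · refine ⟨fun _ => 0, fun _ => 1, analyticAt_const, analyticAt_const,
        Eventually.frequently (Eventually.of_forall fun _ => one_ne_zero), ?_⟩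
      filter_upwards [not_frequently.1 hfreq, hgh] with q hq hq'
      exact ⟨fun h0 => absurd h0 one_ne_zero, fun hP => absurd (hq' hP).1 hq⟩
  · intro z _ hz
    exact isCutoffNestedSum_regSum hv fun h => hz ((mem_polarSet_iff v b c γ z).2 h)
  · intro hb
    obtain ⟨g, h, hg, hh, hgh⟩ := hquot 0 fun _ => hγ.zero_mem
    have hP := eventually_notMem_polarSet (c := c) hγ hb
    have h0 := hgh.self_of_nhds hP.self_of_nhds
    refine (hg.div hh h0.1).congr ?_
    filter_upwards [hgh, hP] with z hz hz'
    exact (hz hz').2.symm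

theorem analytic_cutoffNestedSum_pair {W : Set ℂ} {γ : ℂ → ℂ} (hγ : IsRegulator W γ)
    (b c : Fin 2 → ℂ) {v : ℝ} (hv : 0 ≤ v) (h1 : b 0 ≠ -1) (h2 : b 0 + b 1 ≠ -2)
    (h3 : b 0 + b 1 ≠ -1) (h4 : ∀ k : ℕ, b 0 + b 1 ≠ 2 * (k : ℂ)) :
    ∃ G : (Fin 2 → ℂ) → ℂ, AnalyticAt ℂ G 0 ∧
      ∀ᶠ z in 𝓝 (0 : Fin 2 → ℂ), z ∉ polarSet b c γ →
        IsCutoffNestedSum (fun _ => v) (exponents b c γ z) (G z) := by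
  have he : ∀ i, exponents b c γ 0 i = b i := fun i => by simp [exponents, hγ.map_zero]
  obtain ⟨G, hG, h⟩ := exists_analyticAt_regSum_pair (p := (0 : Fin 2 → ℂ)) hv
    (analyticAt_exponents hγ b c 0 hγ.zero_mem) (analyticAt_exponents hγ b c 1 hγ.zero_mem)
    (by rwa [he]) (by rwa [he, he]) (by rwa [he, he]) (fun k => by rw [he, he]; exact h4 k)
  refine ⟨G, hG, h.mono fun z hz hP => ?_⟩
  have e : evalAt [(v, fun z => exponents b c γ z 0), (v, fun z => exponents b c γ z 1)] z =
      List.ofFn fun i : Fin 2 => (v, exponents b c γ z i) := by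
    simp [evalAt]
  have hP' : (0 : ℂ) ∉ sumExponents (List.ofFn fun i : Fin 2 => (v, exponents b c γ z i)) :=
    fun h0 => hP ((mem_polarSet_iff (fun _ => v) b c γ z).2 h0)
  rw [e] at hz
  rw [← hz hP']
  exact isCutoffNestedSum_regSum (fun _ => hv) hP'

/-! ### Rational values at zero along the diagonal -/

section Diagonal

variable {l : ℕ}

/-- `f c v` is a polynomial in `v` over a common denominator in `c`. -/
def IsRatPoly (f : (Fin l → ℂ) → ℝ → ℂ) : Prop :=
  ∃ (P : Polynomial (MvPolynomial (Fin l) ℚ)) (D : MvPolynomial (Fin l) ℚ),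
    ∀ c : Fin l → ℂ, (∀ j, 0 < (c j).re) → MvPolynomial.aeval c D ≠ 0 ∧ ∀ v : ℝ, 0 ≤ v →
      f c v = P.eval₂ (MvPolynomial.aeval c : MvPolynomial (Fin l) ℚ →ₐ[ℚ] ℂ).toRingHom (v : ℂ) /
        MvPolynomial.aeval c D

theorem IsRatPoly.isPolynomialWithRationalCoeffs {f : (Fin l → ℂ) → ℝ → ℂ} (hf : IsRatPoly f) :
    IsPolynomialWithRationalCoeffs f := by
  obtain ⟨P, D, h⟩ := hf
  refine ⟨P.natDegree + 1, P.coeff, fun _ => D, fun c hc => ⟨fun _ => (h c hc).1, fun v hv => ?_⟩⟩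
  rw [(h c hc).2 v hv, Polynomial.eval₂_eq_sum_range, Finset.sum_div]
  exact Finset.sum_congr rfl fun k _ => by simp; ring

theorem IsRatPoly.add {f g : (Fin l → ℂ) → ℝ → ℂ} (hf : IsRatPoly f) (hg : IsRatPoly g) :
    IsRatPoly fun c v => f c v + g c v := by
  obtain ⟨P, D, h⟩ := hf
  obtain ⟨Q, D', h'⟩ := hg
  refine ⟨P * Polynomial.C D' + Polynomial.C D * Q, D * D', fun c hc => ?_⟩
  obtain ⟨h1, h2⟩ := h c hc
  obtain ⟨h1', h2'⟩ := h' c hc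
  refine ⟨by rw [map_mul]; exact mul_ne_zero h1 h1', fun v hv => ?_⟩
  beta_reduce
  rw [h2 v hv, h2' v hv, div_add_div _ _ h1 h1', Polynomial.eval₂_add, Polynomial.eval₂_mul,
    Polynomial.eval₂_mul, Polynomial.eval₂_C, Polynomial.eval₂_C, map_mul]
  rfl

theorem IsRatPoly.mul {f g : (Fin l → ℂ) → ℝ → ℂ} (hf : IsRatPoly f) (hg : IsRatPoly g) :
    IsRatPoly fun c v => f c v * g c v := by
  obtain ⟨P, D, h⟩ := hf
  obtain ⟨Q, D', h'⟩ := hg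
  refine ⟨P * Q, D * D', fun c hc => ?_⟩
  obtain ⟨h1, h2⟩ := h c hc
  obtain ⟨h1', h2'⟩ := h' c hc
  refine ⟨by rw [map_mul]; exact mul_ne_zero h1 h1', fun v hv => ?_⟩
  beta_reduce
  rw [h2 v hv, h2' v hv, div_mul_div_comm, Polynomial.eval₂_mul, map_mul]

theorem isRatPoly_const (a : ℚ) : IsRatPoly fun (_ : Fin l → ℂ) _ => (a : ℂ) :=
  ⟨Polynomial.C (MvPolynomial.C a), 1, fun c _ => ⟨by simp, fun v _ => by simp⟩⟩

theorem isRatPoly_aeval (κ : MvPolynomial (Fin l) ℚ) :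
    IsRatPoly fun c _ => MvPolynomial.aeval c κ :=
  ⟨Polynomial.C κ, 1, fun c _ => ⟨by simp, fun v _ => by simp⟩⟩

theorem isRatPoly_inv_aeval {κ : MvPolynomial (Fin l) ℚ}
    (hκ : ∀ c : Fin l → ℂ, (∀ j, 0 < (c j).re) → 0 < (MvPolynomial.aeval c κ : ℂ).re) :
    IsRatPoly fun c _ => (MvPolynomial.aeval c κ : ℂ)⁻¹ :=
  ⟨1, κ, fun c hc => ⟨fun h => by have := hκ c hc; simp [h] at this, fun v _ => by simp⟩⟩

theorem isRatPoly_one_add_pow (n : ℕ) : IsRatPoly fun (_ : Fin l → ℂ) v => ((1 + v : ℝ) : ℂ) ^ n :=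
  ⟨(1 + Polynomial.X) ^ n, 1, fun c _ => ⟨by simp, fun v _ => by
    simp [Polynomial.eval₂_pow, Polynomial.eval₂_add]⟩⟩

/-- Admissible parameters: a regulator, coefficients with positive real parts, a shift. -/
def Admissible (γ : ℂ → ℂ) (c : Fin l → ℂ) (v : ℝ) : Prop :=
  (∃ W, IsRegulator W γ) ∧ (∀ j, 0 < (c j).re) ∧ 0 ≤ v

/-- `f γ c v` extends analytically to `0`, where its value is a polynomial in `v` with coefficients
rational in `c`, independent of `γ`. -/
def RationalAtZero (f : (ℂ → ℂ) → (Fin l → ℂ) → ℝ → ℂ → ℂ) : Prop :=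
  ∃ val : (Fin l → ℂ) → ℝ → ℂ, IsRatPoly val ∧ ∀ γ c v, Admissible γ c v →
    ∃ G : ℂ → ℂ, AnalyticAt ℂ G 0 ∧ G 0 = val c v ∧ ∀ᶠ z in 𝓝[≠] (0 : ℂ), f γ c v z = G z

theorem RationalAtZero.of_analyticAt {f : (ℂ → ℂ) → (Fin l → ℂ) → ℝ → ℂ → ℂ}
    {val : (Fin l → ℂ) → ℝ → ℂ} (hval : IsRatPoly val)
    (hf : ∀ γ c v, Admissible γ c v → AnalyticAt ℂ (f γ c v) 0)
    (h0 : ∀ γ c v, Admissible γ c v → f γ c v 0 = val c v) : RationalAtZero f :=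
  ⟨val, hval, fun γ c v h => ⟨f γ c v, hf γ c v h, h0 γ c v h, Eventually.of_forall fun _ => rfl⟩⟩

theorem RationalAtZero.congr {f g : (ℂ → ℂ) → (Fin l → ℂ) → ℝ → ℂ → ℂ} (hf : RationalAtZero f)
    (h : ∀ γ c v, Admissible γ c v → ∀ᶠ z in 𝓝[≠] (0 : ℂ), g γ c v z = f γ c v z) :
    RationalAtZero g := by
  obtain ⟨val, hval, hf⟩ := hf
  refine ⟨val, hval, fun γ c v hp => ?_⟩
  obtain ⟨G, hG, hG0, h'⟩ := hf γ c v hp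
  refine ⟨G, hG, hG0, ?_⟩
  filter_upwards [h γ c v hp, h'] with z h1 h2
  rw [h1, h2]

theorem RationalAtZero.add {f g : (ℂ → ℂ) → (Fin l → ℂ) → ℝ → ℂ → ℂ} (hf : RationalAtZero f)
    (hg : RationalAtZero g) : RationalAtZero fun γ c v z => f γ c v z + g γ c v z := by
  obtain ⟨val, hval, hf⟩ := hf
  obtain ⟨val', hval', hg⟩ := hg
  refine ⟨_, hval.add hval', fun γ c v hp => ?_⟩
  obtain ⟨G, hG, hG0, h⟩ := hf γ c v hp
  obtain ⟨G', hG', hG0', h'⟩ := hg γ c v hp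
  refine ⟨fun z => G z + G' z, hG.add hG', by simp only [hG0, hG0'], ?_⟩
  filter_upwards [h, h'] with z h1 h2
  rw [h1, h2]

theorem RationalAtZero.mul {f g : (ℂ → ℂ) → (Fin l → ℂ) → ℝ → ℂ → ℂ} (hf : RationalAtZero f)
    (hg : RationalAtZero g) : RationalAtZero fun γ c v z => f γ c v z * g γ c v z := by
  obtain ⟨val, hval, hf⟩ := hf
  obtain ⟨val', hval', hg⟩ := hg
  refine ⟨_, hval.mul hval', fun γ c v hp => ?_⟩
  obtain ⟨G, hG, hG0, h⟩ := hf γ c v hp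
  obtain ⟨G', hG', hG0', h'⟩ := hg γ c v hp
  refine ⟨fun z => G z * G' z, hG.mul hG', by simp only [hG0, hG0'], ?_⟩
  filter_upwards [h, h'] with z h1 h2
  rw [h1, h2]

theorem rationalAtZero_const (a : ℚ) :
    RationalAtZero fun (_ : ℂ → ℂ) (_ : Fin l → ℂ) _ _ => (a : ℂ) :=
  .of_analyticAt (isRatPoly_const a) (fun _ _ _ _ => analyticAt_const) fun _ _ _ _ => rfl

theorem RationalAtZero.sum {ι : Type*} (s : Finset ι)
    {f : ι → (ℂ → ℂ) → (Fin l → ℂ) → ℝ → ℂ → ℂ} (hf : ∀ i ∈ s, RationalAtZero (f i)) :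
    RationalAtZero fun γ c v z => ∑ i ∈ s, f i γ c v z := by
  classical
  induction s using Finset.induction_on with
  | empty => simpa using rationalAtZero_const (l := l) 0
  | insert i s hi ih =>
    simp only [Finset.sum_insert hi]
    exact (hf i (Finset.mem_insert_self _ _)).add
      (ih fun j hj => hf j (Finset.mem_insert_of_mem hj))

/-- Serves for the analytic error terms of the recursion: nothing is known of them except that they
vanish at 0, and 0 is a rational value. -/
theorem rationalAtZero_of_eq_zero {f : (ℂ → ℂ) → (Fin l → ℂ) → ℝ → ℂ → ℂ}
    (h : ∀ γ c v, Admissible γ c v → ∃ G : ℂ → ℂ, AnalyticAt ℂ G 0 ∧ G 0 = 0 ∧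
      ∀ᶠ z in 𝓝[≠] (0 : ℂ), f γ c v z = G z) : RationalAtZero f := by
  refine ⟨fun _ _ => ((0 : ℚ) : ℂ), isRatPoly_const 0, fun γ c v hp => ?_⟩
  simpa using h γ c v hp

theorem rationalAtZero_id : RationalAtZero fun (_ : ℂ → ℂ) (_ : Fin l → ℂ) _ z => z :=
  rationalAtZero_of_eq_zero fun _ _ _ _ =>
    ⟨fun z => z, analyticAt_id, rfl, Eventually.of_forall fun _ => rfl⟩

theorem RationalAtZero.pow_succ_mul {f : (ℂ → ℂ) → (Fin l → ℂ) → ℝ → ℂ → ℂ} {e : ℕ}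
    (hf : RationalAtZero fun γ c v z => z ^ e * f γ c v z) :
    RationalAtZero fun γ c v z => z ^ (e + 1) * f γ c v z :=
  (rationalAtZero_id.mul hf).congr fun _ _ _ _ => Eventually.of_forall fun z => by ring

theorem Admissible.analyticAt {γ : ℂ → ℂ} {c : Fin l → ℂ} {v : ℝ} (h : Admissible γ c v) :
    AnalyticAt ℂ γ 0 := let ⟨_, hW⟩ := h.1; hW.analyticAt hW.zero_mem

theorem Admissible.map_zero {γ : ℂ → ℂ} {c : Fin l → ℂ} {v : ℝ} (h : Admissible γ c v) :
    γ 0 = 0 := let ⟨_, hW⟩ := h.1; hW.map_zero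

/-- Leading values see only `F 0 = 1`, which is why they do not depend on the regulator. -/
theorem Admissible.exists_eq_mul {γ : ℂ → ℂ} {c : Fin l → ℂ} {v : ℝ} (h : Admissible γ c v) :
    ∃ F : ℂ → ℂ, AnalyticAt ℂ F 0 ∧ F 0 = 1 ∧ ∀ z, γ z = z * F z := by
  obtain ⟨F, hF, h'⟩ := h.analyticAt.exists_eq_sum_add_pow_mul 1
  have h2 : ∀ z, γ z = z * F z := fun z => by
    rw [h' z]
    simp [h.map_zero]
  refine ⟨F, hF, ?_, h2⟩
  obtain ⟨W, hW⟩ := h.1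
  have h3 := (hasDerivAt_id (0 : ℂ)).mul hF.differentiableAt.hasDerivAt
  have h4 : id * F = γ := by
    funext z
    simp [h2]
  rw [h4] at h3
  have := h3.unique hW.hasDerivAt
  simpa using this

/-- The exponent `b - κ(c) γ(z)`. -/
noncomputable def diagExp (a : ℤ × MvPolynomial (Fin l) ℚ) (γ : ℂ → ℂ) (c : Fin l → ℂ) (z : ℂ) : ℂ :=
  (a.1 : ℂ) - MvPolynomial.aeval c a.2 * γ z

theorem Admissible.analyticAt_diagExp {γ : ℂ → ℂ} {c : Fin l → ℂ} {v : ℝ} (h : Admissible γ c v)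
    (a : ℤ × MvPolynomial (Fin l) ℚ) : AnalyticAt ℂ (diagExp a γ c) 0 :=
  analyticAt_const.sub (analyticAt_const.mul h.analyticAt)

theorem Admissible.diagExp_zero {γ : ℂ → ℂ} {c : Fin l → ℂ} {v : ℝ} (h : Admissible γ c v)
    (a : ℤ × MvPolynomial (Fin l) ℚ) : diagExp a γ c 0 = a.1 := by
  simp [diagExp, h.map_zero]

theorem rationalAtZero_binom (a : ℤ × MvPolynomial (Fin l) ℚ) (j : ℕ) :
    RationalAtZero fun γ c _ z => binom (diagExp a γ c z + 1) j := by
  refine .of_analyticAt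
    (isRatPoly_const ((∏ i ∈ Finset.range j, ((a.1 : ℚ) + 1 - i)) / (j.factorial : ℚ)))
    (fun γ c v h => analyticAt_binom ((h.analyticAt_diagExp a).add analyticAt_const) j)
    fun γ c v h => ?_
  rw [h.diagExp_zero, binom]
  push_cast
  rfl

/-- For `j > d` the product contains the factor `i = d`, which equals `-κ(c) γ(z)` and supplies the
division by `z`. -/
theorem rationalAtZero_binom_div (a : ℤ × MvPolynomial (Fin l) ℚ) {d j : ℕ} (hd : a.1 + 1 = d)
    (hj : d < j) : RationalAtZero fun γ c _ z => binom (diagExp a γ c z + 1) j / z := by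
  have h1 : RationalAtZero (l := l) fun γ _ _ z => γ z / z := by
    refine ⟨_, isRatPoly_const 1, fun γ c v h => ?_⟩
    obtain ⟨F, hF, hF0, hγ⟩ := h.exists_eq_mul
    refine ⟨F, hF, by simpa using hF0, ?_⟩
    filter_upwards [self_mem_nhdsWithin] with z hz
    rw [hγ, mul_div_cancel_left₀ _ hz]
  have h2 : RationalAtZero (l := l) fun _ c _ _ => MvPolynomial.aeval c a.2 :=
    .of_analyticAt (isRatPoly_aeval a.2) (fun _ _ _ _ => analyticAt_const) fun _ _ _ _ => rfl
  have h3 : RationalAtZero (l := l) fun γ c _ z => (∏ i ∈ (Finset.range j).erase d,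
      (diagExp a γ c z + 1 - i)) * ((j.factorial : ℂ))⁻¹ := by
    refine .of_analyticAt (isRatPoly_const ((∏ i ∈ (Finset.range j).erase d,
      ((a.1 : ℚ) + 1 - i)) * (j.factorial : ℚ)⁻¹)) (fun γ c v h => ?_) fun γ c v h => ?_
    · refine AnalyticAt.mul (Finset.analyticAt_fun_prod _ fun i _ => ?_) analyticAt_const
      exact ((h.analyticAt_diagExp a).add analyticAt_const).sub analyticAt_const
    · rw [h.diagExp_zero]
      push_cast
      rfl
  refine (((rationalAtZero_const (-1)).mul h2).mul (h1.mul h3)).congr fun γ c v _ =>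
    Eventually.of_forall fun z => ?_
  have hd' : (a.1 : ℂ) + 1 = d := by exact_mod_cast hd
  rw [binom, ← Finset.mul_prod_erase _ _ (Finset.mem_range.2 hj)]
  have : diagExp a γ c z + 1 - d = -(MvPolynomial.aeval c a.2 * γ z) := by
    rw [diagExp, ← hd']; ring
  rw [this]
  push_cast
  ring

theorem rationalAtZero_inv {a : ℤ × MvPolynomial (Fin l) ℚ} (ha : a.1 ≠ -1) :
    RationalAtZero fun γ c _ z => (diagExp a γ c z + 1)⁻¹ := by
  have h0 : (a.1 : ℂ) + 1 ≠ 0 := by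
    intro h
    have : a.1 + 1 = 0 := by exact_mod_cast h
    omega
  refine .of_analyticAt (isRatPoly_const ((a.1 : ℚ) + 1)⁻¹) (fun γ c v h => ?_) fun γ c v h => ?_
  · exact ((h.analyticAt_diagExp a).add analyticAt_const).inv (by
      rw [Pi.add_apply, h.diagExp_zero]; exact h0)
  · rw [h.diagExp_zero]
    push_cast
    rfl

/-- At exponent `-1` the divisor is `-κ(c) z F(z)`, with a simple zero; positivity of `Re κ(c)`
keeps the value `-1/κ(c)` free of poles. -/
theorem rationalAtZero_mul_inv {a : ℤ × MvPolynomial (Fin l) ℚ} (ha : a.1 = -1)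
    (hκ : ∀ c : Fin l → ℂ, (∀ j, 0 < (c j).re) → 0 < (MvPolynomial.aeval c a.2 : ℂ).re) :
    RationalAtZero fun γ c _ z => z * (diagExp a γ c z + 1)⁻¹ := by
  refine ⟨_, (isRatPoly_const (-1)).mul (isRatPoly_inv_aeval hκ), fun γ c v h => ?_⟩
  obtain ⟨F, hF, hF0, hγ⟩ := h.exists_eq_mul
  refine ⟨fun z => ((-1 : ℚ) : ℂ) * (MvPolynomial.aeval c a.2)⁻¹ * (F z)⁻¹,
    (analyticAt_const.mul analyticAt_const).mul (hF.inv (by rw [hF0]; exact one_ne_zero)), by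
      simp [hF0], ?_⟩
  filter_upwards [self_mem_nhdsWithin] with z hz
  have e : diagExp a γ c z + 1 = -(MvPolynomial.aeval c a.2 * (z * F z)) := by
    rw [diagExp, hγ, ha]; push_cast; ring
  have hz' : z ≠ 0 := hz
  rw [e, inv_neg, mul_inv, mul_inv]
  push_cast
  field_simp

/-- The families of exponents along the diagonal. -/
noncomputable def diagFamily (B : List (ℤ × MvPolynomial (Fin l) ℚ)) (γ : ℂ → ℂ) (c : Fin l → ℂ)
    (v : ℝ) : List (ℝ × (ℂ → ℂ)) := B.map fun a => (v, diagExp a γ c)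

/-- All coefficients have positive real part when the `c j` have. -/
def PositiveCoeffs (B : List (ℤ × MvPolynomial (Fin l) ℚ)) : Prop :=
  ∀ a ∈ B, ∀ c : Fin l → ℂ, (∀ j, 0 < (c j).re) → 0 < (MvPolynomial.aeval c a.2 : ℂ).re

theorem Admissible.diagFamily_analyticAt {γ : ℂ → ℂ} {c : Fin l → ℂ} {v : ℝ}
    (h : Admissible γ c v) (B : List (ℤ × MvPolynomial (Fin l) ℚ)) :
    ∀ a ∈ diagFamily B γ c v, AnalyticAt ℂ a.2 0 := by
  intro a ha
  obtain ⟨b, -, rfl⟩ := List.mem_map.1 ha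
  exact h.analyticAt_diagExp b

theorem Admissible.diagFamily_nonneg {γ : ℂ → ℂ} {c : Fin l → ℂ} {v : ℝ}
    (h : Admissible γ c v) (B : List (ℤ × MvPolynomial (Fin l) ℚ)) :
    ∀ a ∈ diagFamily B γ c v, 0 ≤ a.1 := by
  intro a ha
  obtain ⟨b, -, rfl⟩ := List.mem_map.1 ha
  exact h.2.2

/-- The growth order depends only on the integers in `B`, so the number of Euler–Maclaurin terms can
be fixed independently of `γ`, `c` and `v`. -/
theorem Admissible.growth_diagFamily {γ : ℂ → ℂ} {c : Fin l → ℂ} {v : ℝ} (h : Admissible γ c v)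
    (B : List (ℤ × MvPolynomial (Fin l) ℚ)) :
    growth (evalAt (diagFamily B γ c v) 0) = growth (B.map fun a => (0, (a.1 : ℂ))) := by
  induction B with
  | nil => rfl
  | cons a B ih =>
    have e : growth (evalAt (diagFamily (a :: B) γ c v) 0) =
      ⌊‖diagExp a γ c 0‖⌋₊ + 1 + growth (evalAt (diagFamily B γ c v) 0) + 1 := rfl
    rw [e, ih, h.diagExp_zero]
    rfl

/-- Here `κ` is a partial sum of the coefficients, so positivity of real parts excludes
cancellation. -/
theorem exists_mem_sumExponents_diagFamily {γ : ℂ → ℂ} {c : Fin l → ℂ} {v : ℝ}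
    (hc : ∀ j, 0 < (c j).re) (B : List (ℤ × MvPolynomial (Fin l) ℚ)) (hB : PositiveCoeffs B) :
    ∃ M : ℝ, 0 ≤ M ∧ ∀ z, ∀ α ∈ sumExponents (evalAt (diagFamily B γ c v) z),
      ∃ (n : ℤ) (κ : ℂ), 0 < κ.re ∧ ‖κ‖ ≤ M ∧ α = n - κ * γ z := by
  induction B with
  | nil => exact ⟨0, le_rfl, fun z α hα => hα.elim⟩
  | cons a B ih =>
    obtain ⟨M, hM, h⟩ := ih fun b hb => hB b (List.mem_cons_of_mem _ hb)
    have ha := hB a List.mem_cons_self c hc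
    refine ⟨M + ‖(MvPolynomial.aeval c a.2 : ℂ)‖, by positivity, fun z α hα => ?_⟩
    obtain ⟨k, rfl | ⟨β, hβ, rfl⟩⟩ := hα
    · refine ⟨a.1 + 1 - k, MvPolynomial.aeval c a.2, ha, by linarith, ?_⟩
      simp only [diagExp]
      push_cast
      ring
    · obtain ⟨n, κ, hκ, hκM, rfl⟩ := h z β hβ
      refine ⟨n + a.1 + 1 - k, κ + MvPolynomial.aeval c a.2, ?_, ?_, ?_⟩
      · rw [Complex.add_re]; linarith
      · exact (norm_add_le _ _).trans (by linarith)
      · simp only [diagExp]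
        push_cast
        ring

/-- For small `z ≠ 0` the number `κ γ(z)` is nonzero of norm below 1, hence not an integer. -/
theorem Admissible.eventually_notMem_sumExponents {γ : ℂ → ℂ} {c : Fin l → ℂ} {v : ℝ}
    (h : Admissible γ c v) (B : List (ℤ × MvPolynomial (Fin l) ℚ)) (hB : PositiveCoeffs B) :
    ∀ᶠ z in 𝓝[≠] (0 : ℂ), (0 : ℂ) ∉ sumExponents (evalAt (diagFamily B γ c v) z) := by
  obtain ⟨W, hW⟩ := h.1
  obtain ⟨M, hM, h'⟩ := exists_mem_sumExponents_diagFamily (γ := γ) (v := v) h.2.1 B hB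
  have h1 : ∀ᶠ z in 𝓝[≠] (0 : ℂ), γ z ≠ 0 := hW.hasDerivAt.eventually_ne one_ne_zero
  have h2 : ∀ᶠ z in 𝓝 (0 : ℂ), M * ‖γ z‖ < 1 := by
    have hc : ContinuousAt (fun z => M * ‖γ z‖) 0 :=
      continuousAt_const.mul hW.hasDerivAt.continuousAt.norm
    refine hc.eventually_lt continuousAt_const ?_
    simp [hW.map_zero]
  filter_upwards [h1, h2.filter_mono nhdsWithin_le_nhds] with z hz1 hz2 h0
  obtain ⟨n, κ, hκ, hκM, he⟩ := h' z 0 h0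
  have hκ0 : κ ≠ 0 := fun h => by simp [h] at hκ
  have e : (n : ℂ) = κ * γ z := by linear_combination -he
  have hn : ‖(n : ℂ)‖ < 1 := by
    rw [e, norm_mul]
    exact (mul_le_mul_of_nonneg_right hκM (norm_nonneg _)).trans_lt hz2
  have hn0 : n = 0 := by
    rw [Complex.norm_intCast] at hn
    have : |n| < 1 := by exact_mod_cast hn
    exact Int.abs_lt_one_iff.1 this
  rw [hn0, Int.cast_zero] at e
  exact mul_ne_zero hκ0 hz1 e.symm

/-- The regularized nested sum along the diagonal. -/
noncomputable def diagSum (B : List (ℤ × MvPolynomial (Fin l) ℚ)) (γ : ℂ → ℂ) (c : Fin l → ℂ)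
    (v : ℝ) (z : ℂ) : ℂ := regSum (evalAt (diagFamily B γ c v) z)

/-- Equal shifts give `w = 1`, so these Bernoulli values are rational numbers; `v` enters the final
values only through sums of depth one. -/
theorem rationalAtZero_bernVal_one (j : ℕ) :
    RationalAtZero fun (_ : ℂ → ℂ) (_ : Fin l → ℂ) v _ => bernVal j (1 + v - v) := by
  refine (rationalAtZero_const ((Polynomial.bernoulli j).eval 1)).congr fun γ c v _ =>
    Eventually.of_forall fun z => ?_
  rw [add_sub_cancel_right, bernVal, Complex.ofReal_one, ← map_one (algebraMap ℚ ℂ),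
    Polynomial.aeval_algebraMap_apply]
  simp

theorem rationalAtZero_bernVal_zero (j : ℕ) :
    RationalAtZero fun (_ : ℂ → ℂ) (_ : Fin l → ℂ) (_ : ℝ) _ => bernVal j 0 := by
  refine (rationalAtZero_const ((Polynomial.bernoulli j).eval 0)).congr fun γ c v _ =>
    Eventually.of_forall fun z => ?_
  rw [bernVal, Complex.ofReal_zero, ← map_zero (algebraMap ℚ ℂ), Polynomial.aeval_algebraMap_apply]
  simp

theorem add_one_ne_zero_of_diagFamily {a : ℤ × MvPolynomial (Fin l) ℚ}
    {B : List (ℤ × MvPolynomial (Fin l) ℚ)} {γ : ℂ → ℂ} {c : Fin l → ℂ} {v : ℝ} {z : ℂ}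
    (h : (0 : ℂ) ∉ sumExponents (evalAt (diagFamily (a :: B) γ c v) z)) :
    diagExp a γ c z + 1 ≠ 0 := add_one_ne_zero_of_not_mem_sumExponents h

/-- The recursion for nested sums along the diagonal, with a uniform number of terms. -/
theorem exists_diagSum_cons_cons (a b : ℤ × MvPolynomial (Fin l) ℚ)
    (B : List (ℤ × MvPolynomial (Fin l) ℚ)) (hB : PositiveCoeffs (a :: b :: B)) :
    ∃ J : ℕ, ∀ γ c v, Admissible γ c v → ∃ G : ℂ → ℂ, AnalyticAt ℂ G 0 ∧
      (-1 ≤ a.1 → G 0 = 0) ∧ ∀ᶠ z in 𝓝[≠] (0 : ℂ), diagExp a γ c z + 1 ≠ 0 ∧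
        (diagExp a γ c z + 1) * diagSum (a :: b :: B) γ c v z =
          G z - ∑ j ∈ Finset.range J, binom (diagExp a γ c z + 1) j * bernVal j (1 + v - v) *
            diagSum ((a.1 + b.1 + 1 - j, a.2 + b.2) :: B) γ c v z := by
  -- The last summand makes `J` exceed `a.1 + 1`, as exactness of Euler–Maclaurin at `z = 0`
  -- requires.
  set J := growth ((a :: b :: B).map fun a => (0, (a.1 : ℂ))) + 1 + (a.1 + 1).toNat with hJ
  refine ⟨J, fun γ c v h => ?_⟩
  obtain ⟨G, hG, hG0, h'⟩ := exists_regSum_cons_cons (J := J) (h.diagFamily_nonneg (a :: b :: B))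
    (h.diagFamily_analyticAt (a :: b :: B)) (by
      have := h.growth_diagFamily (a :: b :: B)
      change growth (evalAt (diagFamily (a :: b :: B) γ c v) 0) < J
      omega)
  refine ⟨G, hG, fun ha => hG0 (a.1 + 1).toNat ?_ (by omega), ?_⟩
  · rw [h.diagExp_zero]
    have : (((a.1 + 1).toNat : ℤ) : ℂ) = ((a.1 + 1 : ℤ) : ℂ) := by
      rw [Int.toNat_of_nonneg (by omega)]
    rw [Int.cast_natCast] at this
    rw [this]
    push_cast
    ring
  · filter_upwards [h'.filter_mono nhdsWithin_le_nhds,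
      h.eventually_notMem_sumExponents (a :: b :: B) hB] with z hz hgood
    refine ⟨add_one_ne_zero_of_diagFamily hgood, (hz hgood).trans ?_⟩
    congr 1
    refine Finset.sum_congr rfl fun j _ => ?_
    congr 1
    simp only [diagSum, diagFamily, evalAt, List.map_cons]
    have e : diagExp a γ c z + diagExp b γ c z + 1 - j =
        diagExp (a.1 + b.1 + 1 - j, a.2 + b.2) γ c z := by
      simp only [diagExp, map_add]
      push_cast
      ring
    rw [e]

theorem exists_diagSum_singleton (a : ℤ × MvPolynomial (Fin l) ℚ) (hB : PositiveCoeffs [a]) :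
    ∃ J : ℕ, ∀ γ c v, Admissible γ c v → ∃ G : ℂ → ℂ, AnalyticAt ℂ G 0 ∧
      (-1 ≤ a.1 → G 0 = 0) ∧ ∀ᶠ z in 𝓝[≠] (0 : ℂ), diagExp a γ c z + 1 ≠ 0 ∧
        (diagExp a γ c z + 1) * diagSum [a] γ c v z =
          G z - ∑ j ∈ Finset.range J, binom (diagExp a γ c z + 1) j * bernVal j 0 *
            ((1 + v : ℝ) : ℂ) ^ (diagExp a γ c z + 1 - j) := by
  set J := growth ([a].map fun a => (0, (a.1 : ℂ))) + 1 + (a.1 + 1).toNat with hJ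
  refine ⟨J, fun γ c v h => ?_⟩
  obtain ⟨G, hG, hG0, h'⟩ := exists_regSum_singleton (J := J) h.2.2 (h.analyticAt_diagExp a) (by
      have := h.growth_diagFamily [a]
      change growth (evalAt (diagFamily [a] γ c v) 0) < J
      omega)
  refine ⟨G, hG, fun ha => hG0 (a.1 + 1).toNat ?_ (by omega), ?_⟩
  · rw [h.diagExp_zero]
    have : (((a.1 + 1).toNat : ℤ) : ℂ) = ((a.1 + 1 : ℤ) : ℂ) := by
      rw [Int.toNat_of_nonneg (by omega)]
    rw [Int.cast_natCast] at this
    rw [this]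
    push_cast
    ring
  · filter_upwards [h'.filter_mono nhdsWithin_le_nhds,
      h.eventually_notMem_sumExponents [a] hB] with z hz hgood
    exact ⟨add_one_ne_zero_of_diagFamily hgood, hz hgood⟩

/-! ### Pole orders along the diagonal -/

/-- The exponents are nonnegative, except possibly the last one when `ε = 1`. -/
def NonnegExps (ε : ℕ) : List (ℤ × MvPolynomial (Fin l) ℚ) → Prop
  | [] => True
  | [a] => ε = 1 ∨ 0 ≤ a.1
  | a :: b :: B => 0 ≤ a.1 ∧ NonnegExps ε (b :: B)

theorem NonnegExps.mono_head {ε : ℕ} {a b : ℤ × MvPolynomial (Fin l) ℚ}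
    {B : List (ℤ × MvPolynomial (Fin l) ℚ)} (h : NonnegExps ε (a :: B)) (hab : a.1 ≤ b.1) :
    NonnegExps ε (b :: B) := by
  cases B with
  | nil => exact h.imp_right fun h => h.trans hab
  | cons d B => exact ⟨h.1.trans hab, h.2⟩

theorem NonnegExps.tail {ε : ℕ} {a : ℤ × MvPolynomial (Fin l) ℚ}
    {B : List (ℤ × MvPolynomial (Fin l) ℚ)} (h : NonnegExps ε (a :: B)) : NonnegExps ε B := by
  cases B with
  | nil => trivial
  | cons d B => exact h.2

/-- Solving the recursion divides by `diagExp + 1`, which is invertible at 0 unless `a.1 = -1` and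
then costs one pole order. -/
theorem rationalAtZero_diagSum_of_head {a : ℤ × MvPolynomial (Fin l) ℚ} (e : ℕ)
    {B : List (ℤ × MvPolynomial (Fin l) ℚ)}
    (hB : PositiveCoeffs (a :: B))
    {R : (ℂ → ℂ) → (Fin l → ℂ) → ℝ → ℂ → ℂ}
    (h : ∀ γ c v, Admissible γ c v → ∀ᶠ z in 𝓝[≠] (0 : ℂ), diagExp a γ c z + 1 ≠ 0 ∧
      (diagExp a γ c z + 1) * diagSum (a :: B) γ c v z = R γ c v z)
    (hR : RationalAtZero fun γ c v z => z ^ e * R γ c v z) :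
    (a.1 ≠ -1 → RationalAtZero fun γ c v z => z ^ e * diagSum (a :: B) γ c v z) ∧
    (a.1 = -1 → RationalAtZero fun γ c v z => z ^ (e + 1) * diagSum (a :: B) γ c v z) := by
  have key : ∀ γ c v, Admissible γ c v → ∀ᶠ z in 𝓝[≠] (0 : ℂ),
      diagSum (a :: B) γ c v z = R γ c v z * (diagExp a γ c z + 1)⁻¹ := fun γ c v hp => by
    filter_upwards [h γ c v hp] with z hz
    rw [← hz.2, mul_comm, inv_mul_cancel_left₀ hz.1]
  constructor
  · intro ha
    refine (hR.mul (rationalAtZero_inv ha)).congr fun γ c v hp => ?_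
    filter_upwards [key γ c v hp] with z hz
    rw [hz]; ring
  · intro ha
    refine (hR.mul (rationalAtZero_mul_inv ha (hB a List.mem_cons_self))).congr fun γ c v hp => ?_
    filter_upwards [key γ c v hp] with z hz
    rw [hz]; ring

/-- With `d = a.1 + 1`, the exponent at 0 is the natural number `d - j` if `j ≤ d`, giving a
polynomial in `v`. If `j > d` the power is not polynomial, but the binomial coefficient vanishes. -/
theorem rationalAtZero_cpow_term (a : ℤ × MvPolynomial (Fin l) ℚ) (ha : -1 ≤ a.1) (j : ℕ) :
    RationalAtZero fun γ c v z => binom (diagExp a γ c z + 1) j * bernVal j 0 *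
      ((1 + v : ℝ) : ℂ) ^ (diagExp a γ c z + 1 - j) := by
  obtain ⟨d, hd⟩ : ∃ d : ℕ, a.1 + 1 = d := ⟨(a.1 + 1).toNat, by omega⟩
  have hd' : (a.1 : ℂ) + 1 = d := by exact_mod_cast hd
  have hpow : ∀ γ c v, Admissible (l := l) γ c v →
      AnalyticAt ℂ (fun z => ((1 + v : ℝ) : ℂ) ^ (diagExp a γ c z + 1 - j)) 0 := fun γ c v h =>
    analyticAt_ofReal_cpow (((h.analyticAt_diagExp a).add analyticAt_const).sub analyticAt_const)
      (by linarith [h.2.2])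
  rcases le_or_gt j d with hj | hj
  · refine ((rationalAtZero_binom a j).mul (rationalAtZero_bernVal_zero j)).mul
      (.of_analyticAt (isRatPoly_one_add_pow (d - j)) hpow fun γ c v h => ?_)
    rw [h.diagExp_zero, hd', ← Nat.cast_sub hj, Complex.cpow_natCast]
  · refine rationalAtZero_of_eq_zero fun γ c v h => ⟨_, ((analyticAt_binom
      ((h.analyticAt_diagExp a).add (analyticAt_const (v := (1 : ℂ)))) j).mul
      (analyticAt_const (v := bernVal j 0))).mul (hpow γ c v h), ?_,
      Eventually.of_forall fun _ => rfl⟩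
    simp only [Pi.mul_apply, Pi.add_apply]
    rw [h.diagExp_zero, hd', binom_natCast, Nat.choose_eq_zero_of_lt hj]
    simp

theorem rationalAtZero_diagSum_singleton (a : ℤ × MvPolynomial (Fin l) ℚ)
    (hB : PositiveCoeffs [a]) :
    (0 ≤ a.1 → RationalAtZero fun γ c v z => z ^ 0 * diagSum [a] γ c v z) ∧
      RationalAtZero fun γ c v z => z ^ 1 * diagSum [a] γ c v z := by
  obtain ⟨J, hJ⟩ := exists_diagSum_singleton a hB
  let R : (ℂ → ℂ) → (Fin l → ℂ) → ℝ → ℂ → ℂ := fun γ c v z =>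
    (diagExp a γ c z + 1) * diagSum [a] γ c v z
  have h0 : ∀ γ c v, Admissible γ c v → ∀ᶠ z in 𝓝[≠] (0 : ℂ), diagExp a γ c z + 1 ≠ 0 ∧
      (diagExp a γ c z + 1) * diagSum [a] γ c v z = R γ c v z := fun γ c v hp => by
    obtain ⟨G, -, -, h⟩ := hJ γ c v hp
    exact h.mono fun z hz => ⟨hz.1, rfl⟩
  have hR0 : -1 ≤ a.1 → RationalAtZero fun γ c v z => z ^ 0 * R γ c v z := by
    intro ha
    have hsum := RationalAtZero.sum (Finset.range J) fun j _ => rationalAtZero_cpow_term a ha j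
    have hG : RationalAtZero fun γ c v z => R γ c v z + ∑ j ∈ Finset.range J,
        binom (diagExp a γ c z + 1) j * bernVal j 0 *
          ((1 + v : ℝ) : ℂ) ^ (diagExp a γ c z + 1 - j) := by
      refine rationalAtZero_of_eq_zero fun γ c v hp => ?_
      obtain ⟨G, hG, hG0, h⟩ := hJ γ c v hp
      refine ⟨G, hG, hG0 ha, h.mono fun z hz => ?_⟩
      simp only [R]
      rw [hz.2]; ring
    refine (hG.add ((rationalAtZero_const (-1)).mul hsum)).congr fun γ c v _ =>
      Eventually.of_forall fun z => ?_
    push_cast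
    ring
  -- For `a.1 < -1` the value of `R` at 0 is not controlled; after multiplication by `z` the value
  -- is simply 0.
  have hR1 : RationalAtZero fun γ c v z => z ^ 1 * R γ c v z := by
    refine rationalAtZero_of_eq_zero fun γ c v hp => ?_
    obtain ⟨G, hG, hG0, h⟩ := hJ γ c v hp
    have hσ := (hp.analyticAt_diagExp a).add (analyticAt_const (v := (1 : ℂ)))
    refine ⟨_, analyticAt_id.mul (hG.sub (Finset.analyticAt_fun_sum (Finset.range J) fun j _ =>
      ((analyticAt_binom hσ j).mul (analyticAt_const (v := bernVal j 0))).mul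
        (analyticAt_ofReal_cpow (hσ.sub (analyticAt_const (v := (j : ℂ))))
          (by linarith [hp.2.2] : 0 < 1 + v)))), by simp, h.mono fun z hz => ?_⟩
    simp only [R]
    rw [hz.2, pow_one]
    rfl
  have h00 : 0 ≤ a.1 → RationalAtZero fun γ c v z => z ^ 0 * diagSum [a] γ c v z := fun ha =>
    (rationalAtZero_diagSum_of_head 0 hB h0 (hR0 (by omega))).1 (by omega)
  refine ⟨h00, ?_⟩
  rcases lt_trichotomy a.1 (-1) with ha | ha | ha
  · exact (rationalAtZero_diagSum_of_head 1 hB h0 hR1).1 (by omega)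
  · exact (rationalAtZero_diagSum_of_head 0 hB h0 (hR0 ha.ge)).2 ha
  · exact (h00 (by omega)).pow_succ_mul

/-- The second claim, allowing any integer head at the price of one pole order, is what makes the
induction close. Let `d = a.1 + 1 ≥ 0`. If `j ≤ d`, the merged head is at least `b.1`, so the first
claim applies to the merged sum. If `j > d`, the merged head may be arbitrarily negative, but the
binomial coefficient is divisible by `z`, which offsets the additional order in the second claim. -/
theorem rationalAtZero_diagSum {ε : ℕ} (hε : ε = 0 ∨ ε = 1) (n : ℕ) :
    ∀ (a : ℤ × MvPolynomial (Fin l) ℚ) (B : List (ℤ × MvPolynomial (Fin l) ℚ)), B.length = n →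
      PositiveCoeffs (a :: B) →
      (NonnegExps ε (a :: B) → RationalAtZero fun γ c v z => z ^ ε * diagSum (a :: B) γ c v z) ∧
      (NonnegExps ε B → RationalAtZero fun γ c v z => z ^ (ε + 1) * diagSum (a :: B) γ c v z) := by
  induction n with
  | zero =>
    intro a B hn hB
    obtain rfl := List.length_eq_zero_iff.1 hn
    obtain ⟨h0, h1⟩ := rationalAtZero_diagSum_singleton a hB
    rcases hε with rfl | rfl
    · exact ⟨fun h => h0 (h.resolve_left (by norm_num)), fun _ => h1⟩
    · exact ⟨fun _ => h1, fun _ => h1.pow_succ_mul⟩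
  | succ n ih =>
    intro a B hn hB
    match B, hn, hB with
    | b :: B, hn, hB =>
    obtain ⟨J, hJ⟩ := exists_diagSum_cons_cons a b B hB
    have hB' : ∀ j : ℕ, PositiveCoeffs ((a.1 + b.1 + 1 - j, a.2 + b.2) :: B) := by
      intro j x hx c hc
      rcases List.mem_cons.1 hx with rfl | hx
      · rw [map_add, Complex.add_re]
        have h1 := hB a List.mem_cons_self c hc
        have h2 := hB b (List.mem_cons_of_mem _ List.mem_cons_self) c hc
        linarith
      · exact hB x (List.mem_cons_of_mem _ (List.mem_cons_of_mem _ hx)) c hc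
    have ih' := fun j : ℕ => ih (a.1 + b.1 + 1 - j, a.2 + b.2) B (by simpa using hn) (hB' j)
    let R : (ℂ → ℂ) → (Fin l → ℂ) → ℝ → ℂ → ℂ := fun γ c v z =>
      (diagExp a γ c z + 1) * diagSum (a :: b :: B) γ c v z
    have h0 : ∀ γ c v, Admissible γ c v → ∀ᶠ z in 𝓝[≠] (0 : ℂ), diagExp a γ c z + 1 ≠ 0 ∧
        (diagExp a γ c z + 1) * diagSum (a :: b :: B) γ c v z = R γ c v z := fun γ c v hp => by
      obtain ⟨G, -, -, h⟩ := hJ γ c v hp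
      exact h.mono fun z hz => ⟨hz.1, rfl⟩
    let T : ℕ → (ℂ → ℂ) → (Fin l → ℂ) → ℝ → ℂ → ℂ := fun j γ c v z =>
      binom (diagExp a γ c z + 1) j * bernVal j (1 + v - v) *
        diagSum ((a.1 + b.1 + 1 - j, a.2 + b.2) :: B) γ c v z
    have hRT : ∀ e : ℕ, (-1 ≤ a.1 ∨ 1 ≤ e) → (∀ j, RationalAtZero fun γ c v z => z ^ e * T j γ c v z) →
        RationalAtZero fun γ c v z => z ^ e * R γ c v z := by
      intro e he hT
      have hG : RationalAtZero fun γ c v z => z ^ e * (R γ c v z + ∑ j ∈ Finset.range J,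
          T j γ c v z) := by
        refine rationalAtZero_of_eq_zero fun γ c v hp => ?_
        obtain ⟨G, hG, hG0, h⟩ := hJ γ c v hp
        refine ⟨fun z => z ^ e * G z, (analyticAt_id.pow e).mul hG, ?_, h.mono fun z hz => ?_⟩
        · rcases he with he | he
          · simp only [hG0 he, mul_zero]
          · simp only [zero_pow (Nat.one_le_iff_ne_zero.1 he), zero_mul]
        · simp only [R, T]
          rw [hz.2]; ring
      refine (hG.add ((rationalAtZero_const (-1)).mul
        (RationalAtZero.sum (Finset.range J) fun j _ => hT j))).congr fun γ c v _ =>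
        Eventually.of_forall fun z => ?_
      rw [← Finset.mul_sum]
      push_cast
      ring
    have hsmall : NonnegExps ε (b :: B) → -1 ≤ a.1 →
        RationalAtZero fun γ c v z => z ^ ε * R γ c v z := by
      intro hb ha
      refine hRT ε (Or.inl ha) fun j => ?_
      obtain ⟨d, hd⟩ : ∃ d : ℕ, a.1 + 1 = d := ⟨(a.1 + 1).toNat, by omega⟩
      rcases le_or_gt j d with hj | hj
      · have h1 := (ih' j).1 (hb.mono_head (by simp only; omega))
        refine (((rationalAtZero_binom a j).mul (rationalAtZero_bernVal_one j)).mul h1).congr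
          fun γ c v _ => Eventually.of_forall fun z => ?_
        simp only [T]
        ring
      · have h1 := (ih' j).2 hb.tail
        refine (((rationalAtZero_binom_div a hd hj).mul (rationalAtZero_bernVal_one j)).mul
          h1).congr fun γ c v _ => ?_
        filter_upwards [self_mem_nhdsWithin] with z hz
        have hz' : z ≠ 0 := hz
        simp only [T]
        field_simp
        ring
    have hmain : NonnegExps ε (a :: b :: B) →
        RationalAtZero fun γ c v z => z ^ ε * diagSum (a :: b :: B) γ c v z := fun h =>
      (rationalAtZero_diagSum_of_head ε hB h0 (hsmall h.2 (by have := h.1; omega))).1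
        (by have := h.1; omega)
    refine ⟨hmain, fun hb => ?_⟩
    -- For a head below `-1` the extra factor `z` kills the uncontrolled value of `G`; at `-1` it
    -- pays for the division; above `-1` it is not needed.
    rcases lt_trichotomy a.1 (-1) with ha | ha | ha
    · refine (rationalAtZero_diagSum_of_head (ε + 1) hB h0 (hRT _ (Or.inr (by omega)) fun j => ?_)).1
        (by omega)
      refine (((rationalAtZero_binom a j).mul (rationalAtZero_bernVal_one j)).mul
        ((ih' j).2 hb.tail)).congr fun γ c v _ => Eventually.of_forall fun z => ?_
      simp only [T]
      ring
    · exact (rationalAtZero_diagSum_of_head ε hB h0 (hsmall hb ha.ge)).2 ha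
    · exact (hmain ⟨by omega, hb⟩).pow_succ_mul

end Diagonal

/-! ### Passage to exponents indexed by `Fin l` and the final assembly -/

theorem nonnegExps_ofFn {l m ε : ℕ} (b : Fin l → ℤ) (κ : Fin l → MvPolynomial (Fin m) ℚ)
    (hb : ∀ i : Fin l, (i : ℕ) + 1 < l → 0 ≤ b i)
    (hlast : ε = 1 ∨ ∀ i : Fin l, (i : ℕ) + 1 = l → 0 ≤ b i) :
    NonnegExps ε (List.ofFn fun i => (b i, κ i)) := by
  induction l with
  | zero => trivial
  | succ l ih =>
    have ih' := ih (fun i => b i.succ) (fun i => κ i.succ)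
      (fun i hi => hb i.succ (by simpa using hi))
      (hlast.imp_right fun h i hi => h i.succ (by simpa using hi))
    cases l with
    | zero => exact hlast.imp_right fun h => h 0 rfl
    | succ l =>
      rw [List.ofFn_succ] at ih' ⊢
      rw [List.ofFn_succ]
      exact ⟨hb 0 (by simp), ih'⟩

section DiagonalFinal

variable {l : ℕ}

theorem evalAt_diagFamily_ofFn (b : Fin l → ℤ) (γ : ℂ → ℂ) (c : Fin l → ℂ) (v : ℝ) (z : ℂ) :
    evalAt (diagFamily (List.ofFn fun i => (b i, MvPolynomial.X i)) γ c v) z =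
      List.ofFn fun i => (v, exponents (fun i => (b i : ℂ)) c γ (fun _ => z) i) := by
  simp [evalAt, diagFamily, List.map_ofFn, Function.comp_def, diagExp, exponents]

theorem positiveCoeffs_ofFn_X (b : Fin l → ℤ) :
    PositiveCoeffs (List.ofFn fun i : Fin l => (b i, (MvPolynomial.X i : MvPolynomial (Fin l) ℚ))) := by
  intro a ha c hc
  obtain ⟨i, rfl⟩ := (List.mem_ofFn' _ _).1 ha
  simpa using hc i

theorem eventually_isCutoffNestedSum_diagonal (b : Fin l → ℤ) {W : Set ℂ} {γ : ℂ → ℂ}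
    (hγ : IsRegulator W γ) {c : Fin l → ℂ} (hc : ∀ j, 0 < (c j).re) {v : ℝ} (hv : 0 ≤ v) :
    ∀ᶠ z in 𝓝[≠] (0 : ℂ), IsCutoffNestedSum (fun _ => v)
      (exponents (fun i => (b i : ℂ)) c γ fun _ => z)
      (regSum (List.ofFn fun i => (v, exponents (fun i => (b i : ℂ)) c γ (fun _ => z) i))) := by
  have hadm : Admissible γ c v := ⟨⟨W, hγ⟩, hc, hv⟩
  filter_upwards [hadm.eventually_notMem_sumExponents _ (positiveCoeffs_ofFn_X b)] with z hz
  rw [evalAt_diagFamily_ofFn] at hz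
  exact isCutoffNestedSum_regSum (fun _ => hv) hz

theorem rationalAtZero_regSum_diagonal (hl : 0 < l) (b : Fin l → ℤ)
    (hb : ∀ i : Fin l, (i : ℕ) + 1 < l → 0 ≤ b i) {ε : ℕ} (hε : ε = 0 ∨ ε = 1)
    (hlast : ε = 1 ∨ 0 ≤ b ⟨l - 1, Nat.sub_lt hl Nat.one_pos⟩) :
    RationalAtZero fun γ c v z => z ^ ε *
      regSum (List.ofFn fun i => (v, exponents (fun i => (b i : ℂ)) c γ (fun _ => z) i)) := by
  have hne := nonnegExps_ofFn b (fun i => (MvPolynomial.X i : MvPolynomial (Fin l) ℚ)) hb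
    (hlast.imp_right fun h i hi => by
      rwa [show i = ⟨l - 1, Nat.sub_lt hl Nat.one_pos⟩ from Fin.ext (by simp only; omega)])
  have hpos := positiveCoeffs_ofFn_X b
  simp only [← evalAt_diagFamily_ofFn]
  rcases hB : List.ofFn fun i : Fin l => (b i, (MvPolynomial.X i : MvPolynomial (Fin l) ℚ)) with
    _ | ⟨a, B⟩
  · have := congrArg List.length hB
    simp at this
    omega
  · rw [hB] at hne hpos
    exact (rationalAtZero_diagSum hε B.length a B rfl hpos).1 hne

end DiagonalFinal

theorem mainTheorem2 (l : ℕ) (hl : 0 < l) :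
    -- meromorphy in several variables
    (∀ (W : Set ℂ) (γ : ℂ → ℂ), IsRegulator W γ →
      ∀ b c : Fin l → ℂ, (∀ j, 0 < (c j).re) →
      ∀ v : Fin l → ℝ, (∀ j, 0 ≤ v j) →
        ∃ F : (Fin l → ℂ) → ℂ,
          MeromorphicWithPolesOn F {z | ∀ i, z i ∈ W} (polarSet b c γ) ∧
          (∀ z : Fin l → ℂ, (∀ i, z i ∈ W) → z ∉ polarSet b c γ →
            IsCutoffNestedSum v (exponents b c γ z) (F z)) ∧
          ((∀ m : ℕ, 1 ≤ m → m ≤ l → ∀ k : ℕ,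
              (∑ i : Fin l with i.val < m, b i) ≠ -(m : ℂ) + (k : ℂ)) →
            AnalyticAt ℂ F 0)) ∧
    -- poles at the origin in depth two with equal shifts
    (∀ (W : Set ℂ) (γ : ℂ → ℂ), IsRegulator W γ →
      ∀ b c : Fin 2 → ℂ, (∀ j, 0 < (c j).re) →
      ∀ v : ℝ, 0 ≤ v →
        b 0 ≠ -1 → b 0 + b 1 ≠ -2 → b 0 + b 1 ≠ -1 → (∀ k : ℕ, b 0 + b 1 ≠ 2 * (k : ℂ)) →
        ∃ G : (Fin 2 → ℂ) → ℂ, AnalyticAt ℂ G 0 ∧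
          ∀ᶠ z in 𝓝 (0 : Fin 2 → ℂ), z ∉ polarSet b c γ →
            IsCutoffNestedSum (fun _ => v) (exponents b c γ z) (G z)) ∧
    -- behaviour at zero on the diagonal
    (∀ b : Fin l → ℤ, (∀ i : Fin l, (i : ℕ) + 1 < l → 0 ≤ b i) →
      (0 ≤ b ⟨l - 1, Nat.sub_lt hl Nat.one_pos⟩ →
        ∃ val : (Fin l → ℂ) → ℝ → ℂ, IsPolynomialWithRationalCoeffs val ∧
          ∀ (W : Set ℂ) (γ : ℂ → ℂ), IsRegulator W γ →
          ∀ c : Fin l → ℂ, (∀ j, 0 < (c j).re) →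
          ∀ v : ℝ, 0 ≤ v →
            ∃ G : ℂ → ℂ, AnalyticAt ℂ G 0 ∧ G 0 = val c v ∧
              ∀ᶠ z in 𝓝[≠] (0 : ℂ),
                IsCutoffNestedSum (fun _ => v)
                  (exponents (fun i => (b i : ℂ)) c γ (fun _ => z)) (G z)) ∧
      (b ⟨l - 1, Nat.sub_lt hl Nat.one_pos⟩ ≤ -1 →
        ∃ res : (Fin l → ℂ) → ℝ → ℂ, IsPolynomialWithRationalCoeffs res ∧
          ∀ (W : Set ℂ) (γ : ℂ → ℂ), IsRegulator W γ →
          ∀ c : Fin l → ℂ, (∀ j, 0 < (c j).re) →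
          ∀ v : ℝ, 0 ≤ v →
            ∃ G : ℂ → ℂ, AnalyticAt ℂ G 0 ∧ G 0 = res c v ∧
              ∀ᶠ z in 𝓝[≠] (0 : ℂ),
                IsCutoffNestedSum (fun _ => v)
                  (exponents (fun i => (b i : ℂ)) c γ (fun _ => z)) (G z / z))) := by
  refine ⟨fun W γ hγ b c _ v hv => meromorphic_cutoffNestedSum hγ b c hv,
    fun W γ hγ b c _ v hv h1 h2 h3 h4 => analytic_cutoffNestedSum_pair hγ b c hv h1 h2 h3 h4,
    fun b hb => ⟨fun hlast => ?_, fun _ => ?_⟩⟩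
  · obtain ⟨val, hval, h⟩ := rationalAtZero_regSum_diagonal hl b hb (Or.inl rfl) (Or.inr hlast)
    refine ⟨val, hval.isPolynomialWithRationalCoeffs, fun W γ hγ c hc v hv => ?_⟩
    obtain ⟨G, hG, hG0, hev⟩ := h γ c v ⟨⟨W, hγ⟩, hc, hv⟩
    refine ⟨G, hG, hG0, ?_⟩
    filter_upwards [hev, eventually_isCutoffNestedSum_diagonal b hγ hc hv] with z hz hsum
    rwa [← hz, pow_zero, one_mul]
  · obtain ⟨res, hres, h⟩ := rationalAtZero_regSum_diagonal hl b hb (Or.inr rfl) (Or.inl rfl)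
    refine ⟨res, hres.isPolynomialWithRationalCoeffs, fun W γ hγ c hc v hv => ?_⟩
    obtain ⟨G, hG, hG0, hev⟩ := h γ c v ⟨⟨W, hγ⟩, hc, hv⟩
    refine ⟨G, hG, hG0, ?_⟩
    filter_upwards [hev, eventually_isCutoffNestedSum_diagonal b hγ hc hv,
      self_mem_nhdsWithin] with z hz hsum hz0
    rwa [← hz, pow_one, mul_div_cancel_left₀ _ hz0]
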